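/- **Setting.** Let $m\ge 1$. There are $K$ parallel MDPs with finite state spaces $\mathcal S^{(k)}$, finite action spaces $\mathcal A^{(k)}$ and transition matrices $P^{(k)}_a$, $k=1,\dots,K$. The penalty and constraint functions of slot $t$ are $f^{(k)}_t(s,a)=\hat f^{(k)}(s,a,\mu_t)$ and $g^{(k)}_{i,t}(s,a)=\hat g^{(k)}_i(s,a,\omega_t)$, $i=1,\dots,m$, all bounded by $\Psi$ in absolute value, where $(\omega_t)_{t\ge0}$ is i.i.d. and independent of the arbitrary random sequence $(\mu_t)_{t\ge0}$. The initial joint state has law $d_0$ and is independent of $(\omega,\mu)$; given the whole sequences $\omega,\mu$, the states and actions up to slot $t$, and the next states of the other MDPs, the next state of the $k$-th MDP has law $P^{(k)}_{a^{(k)}_t}(s^{(k)}_t,\cdot)$. For a randomized stationary policy $\pi$ of the $k$-th MDP write $P^{(k)}_\pi(s,s')=\sum_a\pi(a|s)P^{(k)}_a(s,s')$; for a joint policy $\Pi(\mathbf a|\mathbf s)$ let $P_\Pi$ be the transition matrix on the product state space. Assume: * (Unichain) there is $\hat r\ge1$ such that for all $r\ge\hat r$ and all $k$, every product $P^{(k)}_{\pi_1}\cdots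 P^{(k)}_{\pi_r}$ over pure policies $\pi_1,\dots,\pi_r$ has strictly positive entries; * (Slater) for some $\eta>0$ there is a separable randomized stationary policy $\tilde\pi$ (a product $\tilde\pi(\mathbf a|\mathbf s)=\prod_k\tilde\pi^{(k)}(a^{(k)}|s^{(k)})$) that, started from its stationary distribution, satisfies $\mathbb E\big[\sum_k g^{(k)}_{i,t}(s^{(k)}_t,a^{(k)}_t)\big]\le-\eta$ for all $i$. **Algorithm $\mathscr P$** (parameters $V,\alpha>0$). Let $\Theta^{(k)}$ be the set of probability vectors $\theta$ on $\mathcal S^{(k)}\times\mathcal A^{(k)}$ with $\sum_{s,a}\theta(s,a)P^{(k)}_a(s,s')=\sum_a\theta(s',a)$ for all $s'$. Start from the stationary state-action probabilities $\theta^{(k)}_0$ of any randomized stationary policy of the $k$-th MDP and from $Q_i(0)=Q_i(1)=0$; for $t\ge1$ let $$\theta^{(k)}_t=\operatorname*{argmin}_{\theta\in\Theta^{(k)}}\Big\langle Vf^{(k)}_{t-1}+\sum_iQ_i(t)g^{(k)}_{i,t-1},\theta\Big\rangle+\alpha\|\theta-\theta^{(k)}_{t-1}\|_2^2,\qquad Q_i(t+1)=\max\Big\{Q_i(t)+\sum_k\langle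 g^{(k)}_{i,t-1},\theta^{(k)}_t\rangle,0\Big\}.$$ In slot $t\ge0$ the MDPs draw their actions independently, the $k$-th one with probabilities $\theta^{(k)}_t(s^{(k)}_t,a)/\sum_{a'}\theta^{(k)}_t(s^{(k)}_t,a')$. **Values.** For a policy $\mathscr R$ let $F_T(d_0,\mathscr R)$ and $G_{i,T}(d_0,\mathscr R)$ be the expectations of $\sum_t\sum_kf^{(k)}_t(s^{(k)}_t,a^{(k)}_t)$ and $\sum_t\sum_kg^{(k)}_{i,t}(s^{(k)}_t,a^{(k)}_t)$ under $\mathscr R$ with initial law $d_0$, where $t$ runs over the $T$ slots $b,\dots,b+T-1$; either convention $b=0$ or $b=1$ may be used. **Mixing parameters.** Call $(r,\tau,r_1)$ with an integer $r\ge1$, $\tau\ge1$ and $r_1>0$ mixing parameters of the system if $\|(d_1-d_2)P^{(k)}_{\pi_1}\cdots P^{(k)}_{\pi_r}\|_1\le e^{-1/\tau}\|d_1-d_2\|_1$ for all $k$, all distributions $d_1,d_2$ on $\mathcal S^{(k)}$ and all randomized stationary policies $\pi_1,\dots,\pi_r$, and $\|(d-d_\Pi)P_\Pi^t\|_1\le2e^{(r_1-t)/r_1}$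 for all joint randomized stationary policies $\Pi$ with stationary distribution $d_\Pi$, all distributions $d$ on the product state space and all $t\ge0$. **Theorem.** Mixing parameters exist for every such system. Moreover there is a constant $C=C(\Psi,\eta,r,\tau,r_1)$, depending on nothing else, such that for every such system with mixing parameters $(r,\tau,r_1)$, every $T\ge1$ and every initial distribution $d_0$ on the product state space, the algorithm $\mathscr P$ with $V=\sqrt T$ and $\alpha=T$ satisfies $$F_T(d_0,\mathscr P)-F_T(d_0,\Pi)\le C\,m^{3/2}K^2\sum_{k=1}^K|\mathcal A^{(k)}||\mathcal S^{(k)}|\,\sqrt T$$ for every joint randomized stationary policy $\Pi$ with $G_{i,T}(d_0,\Pi)\le0$ for all $i$, and $$G_{i,T}(d_0,\mathscr P)\le C\,m^{3/2}K^2\sum_{k=1}^K|\mathcal A^{(k)}||\mathcal S^{(k)}|\,\sqrt T,\qquad i=1,\dots,m.$$ -/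

import Mathlib

open MeasureTheory ProbabilityTheory

namespace OCMDP

noncomputable section

/-! ### A single finite Markov decision process -/

section Single

variable {S A : Type*} [Fintype S] [Fintype A]

/-- A randomized stationary policy: `π s a` is the probability of action `a` in state `s`. -/
def IsPolicy (π : S → A → ℝ) : Prop := ∀ s, π s ∈ stdSimplex ℝ A

/-- A pure policy: all probabilities are `0` or `1`. -/
def IsPurePolicy (π : S → A → ℝ) : Prop := IsPolicy π ∧ ∀ s a, π s a = 0 ∨ π s a = 1

/-- The transition matrix under the policy `π`. -/
def policyMatrix (P : A → Matrix S S ℝ) (π : S → A → ℝ) : Matrix S S ℝ :=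
  Matrix.of fun s s' => ∑ a, π s a * P a s s'

/-- `d` is a stationary distribution of the transition matrix `M`. -/
def IsStationary (M : Matrix S S ℝ) (d : S → ℝ) : Prop :=
  d ∈ stdSimplex ℝ S ∧ Matrix.vecMul d M = d

/-- `θ` is the vector of stationary state-action probabilities of some randomized stationary
policy. -/
def IsStateActionVector (P : A → Matrix S S ℝ) (θ : S → A → ℝ) : Prop :=
  ∃ (π : S → A → ℝ) (d : S → ℝ), IsPolicy π ∧ IsStationary (policyMatrix P π) d ∧
    ∀ s a, θ s a = d s * π s a

/-- The state-action polyhedron `Θ`. -/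
def stateActionPolyhedron (P : A → Matrix S S ℝ) : Set (S → A → ℝ) :=
  {θ | (∀ s a, 0 ≤ θ s a) ∧ ∑ s, ∑ a, θ s a = 1 ∧
    ∀ s', ∑ s, ∑ a, θ s a * P a s s' = ∑ a, θ s' a}

/-- The policy recovered from `θ`: `θ(s,a) / ∑ₐ θ(s,a)`, and `0` where the denominator is `0`. -/
def recoveredPolicy (θ : S → A → ℝ) (s : S) (a : A) : ℝ := θ s a / ∑ a', θ s a'

/-- The inner product of two functions of the state-action pair. -/
def pairing (c θ : S → A → ℝ) : ℝ := ∑ s, ∑ a, c s a * θ s a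

/-- The squared Euclidean norm on functions of the state-action pair. -/
def sqNorm (θ : S → A → ℝ) : ℝ := ∑ s, ∑ a, θ s a ^ 2

/-- The `ℓ¹` norm. -/
def l1Norm (d : S → ℝ) : ℝ := ∑ s, |d s|

/-- The objective of the subproblem of the `k`-th MDP. The arguments `f`, `g`, `Q`, `θ'` are the
last observed penalty and constraint functions, the current multipliers and the previous
state-action vector. -/
def subproblem {m : ℕ} (V α : ℝ)
    (f : S → A → ℝ) (g : Fin m → S → A → ℝ) (Q : Fin m → ℝ) (θ' θ : S → A → ℝ) : ℝ :=
  pairing (fun s a => V * f s a + ∑ i, Q i * g i s a) θ + α * sqNorm (θ - θ')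

end Single

/-! ### Parallel MDPs with time-varying costs -/

/-- The exogenous randomness: the first component is the sequence `(ω_t)` that drives the
constraint functions, the second is the sequence `(μ_t)` that drives the penalty functions. -/
abbrev EnvPath (E : Type*) := (ℕ → E) × (ℕ → E)

section Joint

variable {K : ℕ} {S A : Fin K → Type*}

/-- The separable joint policy with components `π k`. -/
def separable (π : ∀ k, S k → A k → ℝ) (s : ∀ k, S k) (a : ∀ k, A k) : ℝ :=
  ∏ k, π k (s k) (a k)

/-- The joint policy that the state-action vectors `θ` prescribe: each MDP on its own uses the
policy recovered from its vector. -/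
def prescribedPolicy [∀ k, Fintype (A k)] (θ : ∀ k, S k → A k → ℝ) : (∀ k, S k) → (∀ k, A k) → ℝ :=
  separable fun k => recoveredPolicy (θ k)

variable {E : Type*} [MeasurableSpace E] {Ω : Type*}

/-- Information `σ(ω, μ, s_0, …, s_t, a_0, …, a_{t-1})` before the action of slot `t`. -/
abbrev infoBefore (ξ : Ω → EnvPath E) (s : ℕ → Ω → ∀ k, S k) (a : ℕ → Ω → ∀ k, A k)
    (t : ℕ) : MeasurableSpace Ω :=
  MeasurableSpace.comap ξ inferInstance ⊔ (⨆ (j : ℕ) (_ : j ≤ t), MeasurableSpace.comap (s j) ⊤) ⊔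
    ⨆ (j : ℕ) (_ : j < t), MeasurableSpace.comap (a j) ⊤

/-- System information `σ(ω, μ, s_0, …, s_t, a_0, …, a_t)`. -/
abbrev infoAfter (ξ : Ω → EnvPath E) (s : ℕ → Ω → ∀ k, S k) (a : ℕ → Ω → ∀ k, A k)
    (t : ℕ) : MeasurableSpace Ω :=
  infoBefore ξ s a t ⊔ MeasurableSpace.comap (a t) ⊤

end Joint

/-- `K` parallel finite MDPs with `m` constraints. The penalty function of slot `t` is
`fhat k s a μ_t`, the constraint functions are `ghat i k s a ω_t`. The law `ν` of the pair of
sequences `(ω, μ)` makes `ω` i.i.d. and independent of `μ`; the law of `μ` is arbitrary. -/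
structure Model (K m : ℕ) (S A : Fin K → Type*) [∀ k, Fintype (S k)] [∀ k, Fintype (A k)]
    (E : Type*) [MeasurableSpace E] where
  P : ∀ k, A k → Matrix (S k) (S k) ℝ
  P_stochastic : ∀ k a s, P k a s ∈ stdSimplex ℝ (S k)
  fhat : ∀ k, S k → A k → E → ℝ
  ghat : Fin m → ∀ k, S k → A k → E → ℝ
  measurable_fhat : ∀ k s a, Measurable (fhat k s a)
  measurable_ghat : ∀ i k s a, Measurable (ghat i k s a)
  ν : Measure (EnvPath E)
  isProb : IsProbabilityMeasure ν
  indep_omega : iIndepFun (fun (t : ℕ) (x : EnvPath E) => x.1 t) ν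
  ident_omega : ∀ t : ℕ, IdentDistrib (fun x : EnvPath E => x.1 t) (fun x => x.1 0) ν ν
  indep_omega_mu : IndepFun (fun x : EnvPath E => x.1) (fun x => x.2) ν

namespace Model

variable {K m : ℕ} {S A : Fin K → Type*} [∀ k, Fintype (S k)] [∀ k, Fintype (A k)]
  {E : Type*} [MeasurableSpace E]

/-- The penalty function `f_t^{(k)}` on the exogenous path `x`. -/
def f (M : Model K m S A E) (x : EnvPath E) (t : ℕ) (k : Fin K) (s : S k) (a : A k) : ℝ :=
  M.fhat k s a (x.2 t)

/-- The constraint function `g_{i,t}^{(k)}` on the exogenous path `x`. -/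
def g (M : Model K m S A E) (x : EnvPath E) (t : ℕ) (i : Fin m) (k : Fin K) (s : S k) (a : A k) :
    ℝ :=
  M.ghat i k s a (x.1 t)

/-- All penalty and constraint functions are bounded by `Ψ` in absolute value. -/
def BoundedBy (M : Model K m S A E) (Ψ : ℝ) : Prop :=
  (∀ k s a e, |M.fhat k s a e| ≤ Ψ) ∧ ∀ i k s a e, |M.ghat i k s a e| ≤ Ψ

/-- The transition matrices of the product MDP: the components move independently. -/
def jointP (M : Model K m S A E) (a : ∀ k, A k) : Matrix (∀ k, S k) (∀ k, S k) ℝ :=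
  Matrix.of fun s s' => ∏ k, M.P k (a k) (s k) (s' k)

/-- Unichain assumption: all long enough products of transition matrices of pure policies are
entrywise positive. -/
def Unichain [∀ k, DecidableEq (S k)] (M : Model K m S A E) : Prop :=
  ∃ r₀ : ℕ, 1 ≤ r₀ ∧ ∀ r : ℕ, r₀ ≤ r → ∀ (k : Fin K) (π : Fin r → S k → A k → ℝ),
    (∀ j, IsPurePolicy (π j)) →
      ∀ s s', 0 < (List.ofFn fun j => policyMatrix (M.P k) (π j)).prod s s'

/-- Slater's condition with margin `η`: some separable randomized stationary policy, started from
its stationary distribution, has all expected per-slot constraint values at most `-η`. -/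
def Slater (M : Model K m S A E) (η : ℝ) : Prop :=
  ∃ (π : ∀ k, S k → A k → ℝ) (d : (∀ k, S k) → ℝ), (∀ k, IsPolicy (π k)) ∧
    IsStationary (policyMatrix M.jointP (separable π)) d ∧
    ∀ (i : Fin m) (t : ℕ),
      ∫ x, ∑ s, ∑ a, d s * separable π s a * ∑ k, M.g x t i k (s k) (a k) ∂M.ν ≤ -η

/-- `r` and `τ` are mixing parameters of the individual MDPs: any `r` consecutive randomized
stationary policies contract the `ℓ¹` distance of state distributions by `exp (-1/τ)`. -/
def IsMixing [∀ k, DecidableEq (S k)] (M : Model K m S A E) (r : ℕ) (τ : ℝ) : Prop :=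
  1 ≤ r ∧ 1 ≤ τ ∧ ∀ (k : Fin K) (d₁ d₂ : S k → ℝ), d₁ ∈ stdSimplex ℝ (S k) →
    d₂ ∈ stdSimplex ℝ (S k) → ∀ π : Fin r → S k → A k → ℝ, (∀ j, IsPolicy (π j)) →
      l1Norm (Matrix.vecMul (d₁ - d₂) (List.ofFn fun j => policyMatrix (M.P k) (π j)).prod) ≤
        Real.exp (-1 / τ) * l1Norm (d₁ - d₂)

/-- `r₁` is a mixing parameter of the product MDP, uniformly over all joint randomized stationary
policies. -/
def IsJointMixing [∀ k, DecidableEq (S k)] (M : Model K m S A E) (r₁ : ℝ) : Prop :=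
  0 < r₁ ∧ ∀ (Pi : (∀ k, S k) → (∀ k, A k) → ℝ) (d₀ dPi : (∀ k, S k) → ℝ), IsPolicy Pi →
    d₀ ∈ stdSimplex ℝ (∀ k, S k) → IsStationary (policyMatrix M.jointP Pi) dPi →
      ∀ t : ℕ, l1Norm (Matrix.vecMul (d₀ - dPi) (policyMatrix M.jointP Pi ^ t)) ≤
        2 * Real.exp ((r₁ - t) / r₁)

/-- `θ t k` and `Q t i` are the state-action vectors and virtual queues that the algorithm with
parameters `V`, `α` and initial vectors `θ₀` produces on the exogenous path `x`. -/
structure IsAlgorithmRun (M : Model K m S A E) (V α : ℝ) (θ₀ : ∀ k, S k → A k → ℝ)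
    (x : EnvPath E) (θ : ℕ → ∀ k, S k → A k → ℝ) (Q : ℕ → Fin m → ℝ) : Prop where
  theta_zero : θ 0 = θ₀
  queue_zero : ∀ i, Q 0 i = 0
  queue_one : ∀ i, Q 1 i = 0
  queue_succ : ∀ t i,
    Q (t + 2) i = max (Q (t + 1) i + ∑ k, pairing (M.g x t i k) (θ (t + 1) k)) 0
  theta_mem : ∀ t k, θ (t + 1) k ∈ stateActionPolyhedron (M.P k)
  theta_min : ∀ t k, IsMinOn
    (subproblem V α (M.f x t k) (fun i => M.g x t i k) (Q (t + 1)) (θ t k))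
    (stateActionPolyhedron (M.P k)) (θ (t + 1) k)

section Trajectory

variable {Ω : Type*} [MeasurableSpace Ω]

/-- On the probability space `(Ω, Pr)`, `ξ` is the exogenous path and `(s, a)` the state-action
process that starts from `d₀` and uses in slot `t` the joint policy `pol t` (which may depend on
the exogenous path): the initial state is independent of the exogenous path, actions are drawn
from `pol`, and given the past and the next states of the other MDPs, the next state of the `k`-th
MDP follows its own transition matrix. -/
structure IsTrajectory (M : Model K m S A E) (Pr : Measure Ω) (d₀ : (∀ k, S k) → ℝ)
    (pol : ℕ → EnvPath E → (∀ k, S k) → (∀ k, A k) → ℝ)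
    (ξ : Ω → EnvPath E) (s : ℕ → Ω → ∀ k, S k) (a : ℕ → Ω → ∀ k, A k) : Prop where
  measurable_env : Measurable ξ
  law_env : Measure.map ξ Pr = M.ν
  measurable_state : ∀ t y, MeasurableSet (s t ⁻¹' {y})
  measurable_action : ∀ t y, MeasurableSet (a t ⁻¹' {y})
  init : ∀ y, condExp (MeasurableSpace.comap ξ inferInstance) Pr
    ((s 0 ⁻¹' {y}).indicator fun _ => (1 : ℝ)) =ᵐ[Pr] fun _ => d₀ y
  action : ∀ t y, condExp (infoBefore ξ s a t) Pr
    ((a t ⁻¹' {y}).indicator fun _ => (1 : ℝ)) =ᵐ[Pr] fun w => pol t (ξ w) (s t w) y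
  transition : ∀ (t : ℕ) (k : Fin K) (y : S k),
    condExp (infoAfter ξ s a t ⊔
        ⨆ (j : Fin K) (_ : j ≠ k), MeasurableSpace.comap (fun w => s (t + 1) w j) ⊤) Pr
      ({w | s (t + 1) w k = y}.indicator fun _ => (1 : ℝ)) =ᵐ[Pr]
    fun w => M.P k (a t w k) (s t w k) y

/-- Expected total penalty over the `T` slots `b, …, b + T - 1`. -/
def totalPenalty (M : Model K m S A E) (Pr : Measure Ω) (ξ : Ω → EnvPath E)
    (s : ℕ → Ω → ∀ k, S k) (a : ℕ → Ω → ∀ k, A k) (b T : ℕ) : ℝ :=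
  ∫ w, ∑ t ∈ Finset.Ico b (b + T), ∑ k, M.f (ξ w) t k (s t w k) (a t w k) ∂Pr

/-- Expected total value of the `i`-th constraint over the `T` slots `b, …, b + T - 1`. -/
def totalConstraint (M : Model K m S A E) (Pr : Measure Ω) (ξ : Ω → EnvPath E)
    (s : ℕ → Ω → ∀ k, S k) (a : ℕ → Ω → ∀ k, A k) (b T : ℕ) (i : Fin m) : ℝ :=
  ∫ w, ∑ t ∈ Finset.Ico b (b + T), ∑ k, M.g (ξ w) t i k (s t w k) (a t w k) ∂Pr

end Trajectory

end Model

end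

end OCMDP

set_option linter.unusedSectionVars false

/-! The proof separates the iterates of the algorithm from the Markov chains that they steer.

Iterates. Fix reference vectors `φ k` in the state-action polyhedra and put L_t = (1/2) Σ_i
Q_i(t+1)² + α Σ_k ‖φ_k − θ_t‖². Each update minimizes a linear function plus a quadratic over a
convex set, so strong convexity (`add_sqNorm_le_of_isMinOn`) together with the queue recursion gives
the drift inequality `drift_le`: V f_t(θ_{t+1}) + α‖θ_{t+1} − θ_t‖² + L_{t+1} ≤ L_t + V f_t(φ) + Σ_i
Q_i(t+1) g_{i,t}(φ) + m(KΨ)²/2. Here Q(t+1) and θ_t are determined by the environment before slot t,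
hence independent of ω_t, and E[Q_i(t+1) g_{i,t}(φ)] = E[Q_i(t+1)] E[g_{i,t}(φ)]
(`integral_queue_mul_constraintAt`). Two choices of `φ` are used.

(a) For the Slater vectors the last expectation is at most −η. Summation gives Σ_t Σ_i E Q_i =
O(T^{3/2}) (`sum_integral_queue_le`), and an exponential-moment argument for √(2L) gives E Q_i(t) =
O(√T) for each t (`integral_queue_le`).

(b) For the marginals of the stationary law of a feasible competitor, mixing of the joint chain and
the i.i.d. assumption give E[g_{i,t}(φ)] = O(1/T) (`exists_comparator`). By (a) the queue term then
totals O(√T), which division by V = √T makes O(1); the remaining terms, L_0 = O(αK) and O(1) per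
slot, are O(T) and become O(√T) (`sum_penaltyAt_sub_le`).

Chains. One update moves θ^(k) in ℓ¹ by at most |A||S|Ψ(V + Σ_i Q_i)/(2α) (`entryNorm_step_le`), so
by (a) the expected total movement is O(√T). The marginal state law of each MDP is driven by these
slowly changing kernels; contraction over r steps keeps it near the state distribution of θ_t, with
total error at most (initial error + movement)/(1 − e^{−1/τ}) up to factors of r
(`sum_trackingError_le`). Actual costs therefore differ from the costs of the iterates by O(√T). The
constraint costs of the iterates telescope through the queue recursion, leaving the final queue and
the movement (`totalConstraint_le`).

Conditional expectations along a trajectory are eliminated once, in `integral_cost`: expected costs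
become integrals over the exogenous path of costs under a deterministic recursion for the state law.

Mixing parameters come from Doeblin minorization. The least probability of being in y after r steps,
over all choices of actions, is attained by pure policies, so it is positive; products of these
minima bound the joint chain from below, even under policies that correlate the MDPs. -/

namespace OCMDP

noncomputable section

/-! ### Finite chains: ℓ¹ contraction and stationary distributions. -/

section Chains

variable {S : Type*} [Fintype S]

theorem l1Norm_nonneg (d : S → ℝ) : 0 ≤ l1Norm d :=
  Finset.sum_nonneg fun _ _ => abs_nonneg _

theorem l1Norm_add_le (d e : S → ℝ) : l1Norm (d + e) ≤ l1Norm d + l1Norm e := by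
  unfold l1Norm
  rw [← Finset.sum_add_distrib]
  exact Finset.sum_le_sum fun s _ => abs_add_le _ _

theorem l1Norm_sub_le_two {d e : S → ℝ} (hd : d ∈ stdSimplex ℝ S) (he : e ∈ stdSimplex ℝ S) :
    l1Norm (d - e) ≤ 2 := by
  have h : l1Norm (d - e) ≤ ∑ s, (d s + e s) := Finset.sum_le_sum fun s _ => by
    have h1 := hd.1 s
    have h2 := he.1 s
    rw [Pi.sub_apply, abs_le]
    constructor <;> linarith
  rw [Finset.sum_add_distrib, hd.2, he.2] at h
  linarith

theorem abs_sum_mul_le_l1Norm {d c : S → ℝ} {B : ℝ} (hc : ∀ s, |c s| ≤ B) :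
    |∑ s, d s * c s| ≤ B * l1Norm d := by
  refine (Finset.abs_sum_le_sum_abs _ _).trans ?_
  unfold l1Norm
  rw [Finset.mul_sum]
  refine Finset.sum_le_sum fun s _ => ?_
  rw [abs_mul, mul_comm]
  exact mul_le_mul_of_nonneg_right (hc s) (abs_nonneg _)

variable [DecidableEq S]

theorem mem_rowStochastic_iff_mem_stdSimplex {M : Matrix S S ℝ} :
    M ∈ Matrix.rowStochastic ℝ S ↔ ∀ s, M s ∈ stdSimplex ℝ S := by
  rw [Matrix.mem_rowStochastic_iff_sum]
  exact ⟨fun h s => ⟨h.1 s, h.2 s⟩, fun h => ⟨fun s => (h s).1, fun s => (h s).2⟩⟩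

theorem sum_vecMul_of_mem_rowStochastic {M : Matrix S S ℝ} (hM : M ∈ Matrix.rowStochastic ℝ S)
    (v : S → ℝ) : ∑ s, Matrix.vecMul v M s = ∑ s, v s := by
  simp only [Matrix.vecMul, dotProduct]
  rw [Finset.sum_comm]
  refine Finset.sum_congr rfl fun s _ => ?_
  rw [← Finset.mul_sum, Matrix.sum_row_of_mem_rowStochastic hM, mul_one]

theorem vecMul_mem_stdSimplex {M : Matrix S S ℝ} (hM : M ∈ Matrix.rowStochastic ℝ S) {d : S → ℝ}
    (hd : d ∈ stdSimplex ℝ S) : Matrix.vecMul d M ∈ stdSimplex ℝ S :=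
  ⟨Matrix.nonneg_vecMul_of_mem_rowStochastic hM hd.1,
    (sum_vecMul_of_mem_rowStochastic hM d).trans hd.2⟩

/-- Doeblin's contraction: a stochastic matrix with entries at least `δ` contracts vectors of total
mass zero. -/
theorem l1Norm_vecMul_le_of_le [Nonempty S] {M : Matrix S S ℝ}
    (hM : M ∈ Matrix.rowStochastic ℝ S) {δ : ℝ} (hδ : 0 ≤ δ) (h : ∀ s s', δ ≤ M s s') {v : S → ℝ}
    (hv : ∑ s, v s = 0) : l1Norm (Matrix.vecMul v M) ≤ (1 - δ) * l1Norm v := by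
  have h1 : ∀ s', |Matrix.vecMul v M s'| ≤ ∑ s, |v s| * (M s s' - δ) := fun s' => by
    have : Matrix.vecMul v M s' = ∑ s, v s * (M s s' - δ) := by
      simp only [mul_sub, Finset.sum_sub_distrib, ← Finset.sum_mul, hv, zero_mul, sub_zero]
      rfl
    rw [this]
    refine (Finset.abs_sum_le_sum_abs _ _).trans (Finset.sum_le_sum fun s _ => ?_)
    rw [abs_mul, abs_of_nonneg (sub_nonneg.2 (h s s'))]
  refine (Finset.sum_le_sum fun s' _ => h1 s').trans ?_
  rw [Finset.sum_comm]
  unfold l1Norm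
  rw [Finset.mul_sum]
  refine Finset.sum_le_sum fun s _ => ?_
  rw [← Finset.mul_sum, mul_comm, Finset.sum_sub_distrib, Matrix.sum_row_of_mem_rowStochastic hM]
  refine mul_le_mul_of_nonneg_right ?_ (abs_nonneg _)
  have hcard : (1 : ℝ) ≤ Fintype.card S := by exact_mod_cast Fintype.card_pos
  simp only [Finset.sum_const, Finset.card_univ, nsmul_eq_mul]
  nlinarith

theorem l1Norm_vecMul_le {M : Matrix S S ℝ} (hM : M ∈ Matrix.rowStochastic ℝ S) (v : S → ℝ) :
    l1Norm (Matrix.vecMul v M) ≤ l1Norm v := by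
  have h1 : ∀ s', |Matrix.vecMul v M s'| ≤ ∑ s, |v s| * M s s' := fun s' => by
    refine (Finset.abs_sum_le_sum_abs _ _).trans (Finset.sum_le_sum fun s _ => ?_)
    rw [abs_mul, abs_of_nonneg (Matrix.nonneg_of_mem_rowStochastic hM)]
  refine (Finset.sum_le_sum fun s' _ => h1 s').trans ?_
  rw [Finset.sum_comm]
  refine Finset.sum_le_sum fun s _ => ?_
  rw [← Finset.mul_sum, Matrix.sum_row_of_mem_rowStochastic hM, mul_one]

/-- Since M fixes the all-ones vector, it also has a left eigenvector v for the eigenvalue 1. The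
triangle inequality gives |v| ≤ |v|M entrywise; both sides have the same total mass, so they agree,
and |v| can be normalized. -/
theorem exists_isStationary [Nonempty S] {M : Matrix S S ℝ} (hM : M ∈ Matrix.rowStochastic ℝ S) :
    ∃ d, IsStationary M d := by
  have hdet : (M - 1).det = 0 := by
    rw [← Matrix.exists_mulVec_eq_zero_iff]
    refine ⟨1, one_ne_zero, ?_⟩
    rw [Matrix.sub_mulVec, hM.2, Matrix.one_mulVec, sub_self]
  obtain ⟨v, hv0, hv⟩ := Matrix.exists_vecMul_eq_zero_iff.2 hdet
  rw [Matrix.vecMul_sub, Matrix.vecMul_one, sub_eq_zero] at hv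
  set u : S → ℝ := fun s => |v s| with hu
  have hle : ∀ s', u s' ≤ Matrix.vecMul u M s' := fun s' => by
    calc u s' = |Matrix.vecMul v M s'| := by rw [hv]
      _ ≤ ∑ s, |v s * M s s'| := Finset.abs_sum_le_sum_abs _ _
      _ = Matrix.vecMul u M s' := Finset.sum_congr rfl fun s _ => by
          rw [abs_mul, abs_of_nonneg (Matrix.nonneg_of_mem_rowStochastic hM)]
  have hfix : ∀ s', u s' = Matrix.vecMul u M s' := fun s' =>
    (Finset.sum_eq_sum_iff_of_le fun s _ => hle s).1
      (sum_vecMul_of_mem_rowStochastic hM u).symm s' (Finset.mem_univ _)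
  have hpos : 0 < ∑ s, u s := by
    obtain ⟨s, hs⟩ := Function.ne_iff.1 hv0
    exact Finset.sum_pos' (fun s _ => abs_nonneg _) ⟨s, Finset.mem_univ _, abs_pos.2 hs⟩
  refine ⟨(∑ s, u s)⁻¹ • u, ⟨fun s => ?_, ?_⟩, ?_⟩
  · exact mul_nonneg (inv_nonneg.2 hpos.le) (abs_nonneg _)
  · simp only [Pi.smul_apply, smul_eq_mul, ← Finset.mul_sum]
    exact inv_mul_cancel₀ hpos.ne'
  · rw [Matrix.smul_vecMul, ← funext hfix]

theorem IsStationary.vecMul_pow {M : Matrix S S ℝ} {d : S → ℝ} (hd : IsStationary M d) (n : ℕ) :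
    Matrix.vecMul d (M ^ n) = d := by
  induction n with
  | zero => simp
  | succ n ih => rw [pow_succ, ← Matrix.vecMul_vecMul, ih, hd.2]

end Chains

/-! ### Worst-case reaching probabilities. -/

section Reach

variable {S A : Type*} [Fintype S] [Fintype A]

theorem sum_vecMul_policyMatrix (P : A → Matrix S S ℝ) (π : S → A → ℝ) (d : S → ℝ) (s' : S) :
    Matrix.vecMul d (policyMatrix P π) s' = ∑ s, ∑ a, d s * π s a * P a s s' := by
  simp only [Matrix.vecMul, dotProduct, policyMatrix, Matrix.of_apply, Finset.mul_sum, mul_assoc]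

variable [DecidableEq S]

theorem policyMatrix_mem_rowStochastic {P : A → Matrix S S ℝ}
    (hP : ∀ a s, P a s ∈ stdSimplex ℝ S) {π : S → A → ℝ} (hπ : IsPolicy π) :
    policyMatrix P π ∈ Matrix.rowStochastic ℝ S := by
  rw [mem_rowStochastic_iff_mem_stdSimplex]
  refine fun s => ⟨fun s' => Finset.sum_nonneg fun a _ => mul_nonneg ((hπ s).1 a) ((hP a s).1 s'), ?_⟩
  simp only [policyMatrix, Matrix.of_apply]
  rw [Finset.sum_comm]
  simp only [← Finset.mul_sum, (hP _ s).2, mul_one, (hπ s).2]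

/-- The smallest probability, over all choices of actions, of being in `y` after `n` steps. -/
def worstReach (P : A → Matrix S S ℝ) (y : S) : ℕ → S → ℝ
  | 0, s => (1 : Matrix S S ℝ) s y
  | n + 1, s => ⨅ a, ∑ s', P a s s' * worstReach P y n s'

variable {P : A → Matrix S S ℝ}

theorem worstReach_succ_le (y : S) (n : ℕ) (s : S) (a : A) :
    worstReach P y (n + 1) s ≤ ∑ s', P a s s' * worstReach P y n s' :=
  ciInf_le (Set.finite_range _).bddBelow a

theorem worstReach_nonneg (hP : ∀ a s, P a s ∈ stdSimplex ℝ S) (y : S) (n : ℕ) (s : S) :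
    0 ≤ worstReach P y n s := by
  induction n generalizing s with
  | zero => simp only [worstReach, Matrix.one_apply]; split_ifs <;> norm_num
  | succ n ih =>
    exact Real.iInf_nonneg fun a => Finset.sum_nonneg fun s' _ => mul_nonneg ((hP a s).1 s') (ih s')

/-- Backward induction: a randomized action averages one-step values, none of which lies below the
minimum. -/
theorem worstReach_le_prod (hP : ∀ a s, P a s ∈ stdSimplex ℝ S) (y : S) (n : ℕ)
    (π : Fin n → S → A → ℝ) (hπ : ∀ j, IsPolicy (π j)) (s : S) :
    worstReach P y n s ≤ (List.ofFn fun j => policyMatrix P (π j)).prod s y := by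
  induction n generalizing s with
  | zero => simp [worstReach]
  | succ n ih =>
    rw [List.ofFn_succ, List.prod_cons, Matrix.mul_apply]
    calc worstReach P y (n + 1) s
        = ∑ a, π 0 s a * worstReach P y (n + 1) s := by
          rw [← Finset.sum_mul, (hπ 0 s).2, one_mul]
      _ ≤ ∑ a, π 0 s a * ∑ s', P a s s' * worstReach P y n s' :=
          Finset.sum_le_sum fun a _ =>
            mul_le_mul_of_nonneg_left (worstReach_succ_le y n s a) ((hπ 0 s).1 a)
      _ = ∑ s', policyMatrix P (π 0) s s' * worstReach P y n s' := by
          simp only [policyMatrix, Matrix.of_apply, Finset.mul_sum, Finset.sum_mul]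
          rw [Finset.sum_comm]
          simp only [mul_assoc]
      _ ≤ _ := Finset.sum_le_sum fun s' _ => mul_le_mul_of_nonneg_left
          (ih (fun j => π j.succ) (fun j => hπ j.succ) s')
          (Matrix.nonneg_of_mem_rowStochastic (policyMatrix_mem_rowStochastic hP (hπ 0)))

/-- The minimizing action is chosen separately in each state, so one sequence of pure policies
attains the minimum from all starting states. This carries positivity from pure policies to all
randomized ones. -/
theorem exists_pure_prod_eq_worstReach [Nonempty A] (y : S) (n : ℕ) :
    ∃ π : Fin n → S → A → ℝ, (∀ j, IsPurePolicy (π j)) ∧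
      ∀ s, (List.ofFn fun j => policyMatrix P (π j)).prod s y = worstReach P y n s := by
  classical
  induction n with
  | zero => exact ⟨fun j => j.elim0, fun j => j.elim0, fun s => by simp [worstReach]⟩
  | succ n ih =>
    obtain ⟨π, hπ, hπe⟩ := ih
    have hmin : ∀ s, ∃ a, ∑ s', P a s s' * worstReach P y n s' = worstReach P y (n + 1) s :=
      fun s => exists_eq_ciInf_of_finite
    choose act hact using hmin
    refine ⟨Fin.cons (fun s => Pi.single (act s) 1) π, fun j => ?_, fun s => ?_⟩
    · refine Fin.cases ?_ (fun j => ?_) j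
      · refine ⟨fun s => single_mem_stdSimplex ℝ (act s), fun s a => ?_⟩
        by_cases h : a = act s
        · subst h; simp
        · simp [h]
      · exact hπ j
    · rw [List.ofFn_succ, List.prod_cons, Matrix.mul_apply]
      simp only [Fin.cons_zero, Fin.cons_succ, hπe, ← hact]
      refine Finset.sum_congr rfl fun s' _ => ?_
      congr 1
      simp [policyMatrix, Pi.single_apply]

end Reach

/-! ### The state-action polyhedron and recovered policies. -/

section Polyhedron

variable {S A : Type*} [Fintype S] [Fintype A] {P : A → Matrix S S ℝ}

theorem IsStateActionVector.mem_stateActionPolyhedron {θ : S → A → ℝ}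
    (hθ : IsStateActionVector P θ) : θ ∈ stateActionPolyhedron P := by
  obtain ⟨π, d, hπ, hd, h⟩ := hθ
  have hmass : ∀ s, ∑ a, θ s a = d s := fun s => by
    simp only [h, ← Finset.mul_sum, (hπ s).2, mul_one]
  refine ⟨fun s a => ?_, ?_, fun s' => ?_⟩
  · rw [h]; exact mul_nonneg (hd.1.1 s) ((hπ s).1 a)
  · simp only [hmass]; exact hd.1.2
  · rw [hmass, ← congrFun hd.2 s', sum_vecMul_policyMatrix]
    simp only [h]

theorem convex_stateActionPolyhedron : Convex ℝ (stateActionPolyhedron P) := by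
  rintro θ ⟨h0, h1, h2⟩ θ' ⟨h0', h1', h2'⟩ x y hx hy hxy
  refine ⟨fun s a => add_nonneg (mul_nonneg hx (h0 s a)) (mul_nonneg hy (h0' s a)), ?_, fun s' => ?_⟩
  · simp only [Pi.add_apply, Pi.smul_apply, smul_eq_mul, Finset.sum_add_distrib, ← Finset.mul_sum,
      h1, h1', mul_one, hxy]
  · simp only [Pi.add_apply, Pi.smul_apply, smul_eq_mul, Finset.sum_add_distrib, add_mul,
      ← Finset.mul_sum, ← h2, ← h2', mul_assoc]

/-- The state distribution of a state-action vector. -/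
def stateMass {S A : Type*} [Fintype A] (θ : S → A → ℝ) (s : S) : ℝ := ∑ a, θ s a

theorem stateMass_mem_stdSimplex {θ : S → A → ℝ} (hθ : θ ∈ stateActionPolyhedron P) :
    stateMass θ ∈ stdSimplex ℝ S :=
  ⟨fun s => Finset.sum_nonneg fun a _ => hθ.1 s a, hθ.2.1⟩

theorem isPolicy_recoveredPolicy {θ : S → A → ℝ} (hθ : θ ∈ stateActionPolyhedron P)
    (hpos : ∀ s, 0 < stateMass θ s) : IsPolicy (recoveredPolicy θ) := by
  refine fun s => ⟨fun a => div_nonneg (hθ.1 s a) (hpos s).le, ?_⟩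
  simp only [recoveredPolicy, ← Finset.sum_div]
  exact div_self (hpos s).ne'

theorem stateMass_mul_recoveredPolicy {S A : Type*} [Fintype A] {θ : S → A → ℝ} {s : S} (hpos : 0 < stateMass θ s) (a : A) :
    stateMass θ s * recoveredPolicy θ s a = θ s a :=
  mul_div_cancel₀ _ hpos.ne'

theorem isStationary_stateMass {θ : S → A → ℝ} (hθ : θ ∈ stateActionPolyhedron P)
    (hpos : ∀ s, 0 < stateMass θ s) :
    IsStationary (policyMatrix P (recoveredPolicy θ)) (stateMass θ) := by
  refine ⟨stateMass_mem_stdSimplex hθ, funext fun s' => ?_⟩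
  rw [sum_vecMul_policyMatrix]
  simp only [stateMass_mul_recoveredPolicy (hpos _)]
  exact hθ.2.2 s'

/-- The state distribution of `θ` is stationary for a policy read off from `θ`, and r steps under
any policy reach `y` with positive probability. Hence no denominator of `recoveredPolicy` vanishes.
-/
theorem stateMass_pos [DecidableEq S] [Nonempty A] (hP : ∀ a s, P a s ∈ stdSimplex ℝ S) {r : ℕ}
    (hr : ∀ s y, 0 < worstReach P y r s) {θ : S → A → ℝ} (hθ : θ ∈ stateActionPolyhedron P)
    (y : S) : 0 < stateMass θ y := by
  classical
  obtain ⟨a₀⟩ := ‹Nonempty A›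
  -- In states without mass the quotient is 0/0, so a pure action is inserted; the flow balance does
  -- not see these states.
  set π : S → A → ℝ := fun s => if stateMass θ s = 0 then Pi.single a₀ 1 else recoveredPolicy θ s
    with hπdef
  have hmass := stateMass_mem_stdSimplex hθ
  have hπ : IsPolicy π := fun s => by
    by_cases h : stateMass θ s = 0
    · simp only [hπdef, h, if_true]; exact single_mem_stdSimplex ℝ a₀
    · simp only [hπdef, h, if_false]
      refine ⟨fun a => div_nonneg (hθ.1 s a) (hmass.1 s), ?_⟩
      simp only [recoveredPolicy, ← Finset.sum_div]
      exact div_self h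
  have hprod : ∀ s a, stateMass θ s * π s a = θ s a := fun s a => by
    by_cases h : stateMass θ s = 0
    · rw [h, zero_mul]
      exact ((Finset.sum_eq_zero_iff_of_nonneg fun a _ => hθ.1 s a).1 h a (Finset.mem_univ a)).symm
    · simp only [hπdef, h, if_false]
      exact mul_div_cancel₀ _ h
  have hstat : IsStationary (policyMatrix P π) (stateMass θ) := by
    refine ⟨hmass, funext fun s' => ?_⟩
    rw [sum_vecMul_policyMatrix]
    simp only [hprod]
    exact hθ.2.2 s'
  have hle : ∀ s, worstReach P y r s ≤ (policyMatrix P π ^ r) s y := fun s => by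
    simpa [List.ofFn_const] using worstReach_le_prod hP y r (fun _ => π) (fun _ => hπ) s
  obtain ⟨s, hs⟩ : ∃ s, 0 < stateMass θ s := by
    by_contra! h
    have := Finset.sum_nonpos fun s (_ : s ∈ Finset.univ) => h s
    rw [hmass.2] at this
    linarith
  rw [← congrFun (hstat.vecMul_pow r) y]
  exact Finset.sum_pos' (fun s _ => mul_nonneg (hmass.1 s) ((hr s y).le.trans (hle s)))
    ⟨s, Finset.mem_univ _, mul_pos hs ((hr s y).trans_le (hle s))⟩

end Polyhedron

/-! ### Sums over product spaces. -/

section ProductSums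

variable {ι : Type*} [Fintype ι] [DecidableEq ι] {X : ι → Type*} [∀ i, Fintype (X i)]

/-- Under a product distribution, a function of one coordinate has the expectation of that
coordinate. -/
theorem sum_prod_mul_apply {p : ∀ i, X i → ℝ} (hp : ∀ i, ∑ z, p i z = 1) (k : ι) (c : X k → ℝ) :
    ∑ y : ∀ i, X i, (∏ i, p i (y i)) * c (y k) = ∑ z, p k z * c z := by
  set q : ∀ i, X i → ℝ := Function.update p k fun z => p k z * c z with hq
  have hqk : q k = fun z => p k z * c z := Function.update_self ..
  have hqi : ∀ i, i ≠ k → q i = p i := fun i hi => Function.update_of_ne hi ..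
  have h1 : ∀ y : ∀ i, X i, (∏ i, p i (y i)) * c (y k) = ∏ i, q i (y i) := fun y => by
    rw [← Finset.mul_prod_erase _ _ (Finset.mem_univ k),
      ← Finset.mul_prod_erase _ (fun i => q i (y i)) (Finset.mem_univ k), hqk,
      Finset.prod_congr rfl fun i hi => by rw [← hqi i (Finset.ne_of_mem_erase hi)]]
    ring
  simp only [h1, ← Fintype.prod_sum]
  rw [← Finset.mul_prod_erase _ _ (Finset.mem_univ k), hqk,
    Finset.prod_eq_one fun i hi => by rw [hqi i (Finset.ne_of_mem_erase hi), hp i], mul_one]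

theorem prod_mem_stdSimplex {p : ∀ i, X i → ℝ} (hp : ∀ i, p i ∈ stdSimplex ℝ (X i)) :
    (fun y : ∀ i, X i => ∏ i, p i (y i)) ∈ stdSimplex ℝ (∀ i, X i) := by
  refine ⟨fun y => Finset.prod_nonneg fun i _ => (hp i).1 _, ?_⟩
  rw [← Fintype.prod_sum, Finset.prod_eq_one fun i _ => (hp i).2]

theorem sum_sum_ite_mul {Y Z : Type*} [Fintype Y] [Fintype Z] [DecidableEq Z] (u : Y → ℝ)
    (proj : Y → Z) (c : Z → ℝ) :
    ∑ z, (∑ y, if proj y = z then u y else 0) * c z = ∑ y, u y * c (proj y) := by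
  simp only [Finset.sum_mul, ite_mul, zero_mul]
  rw [Finset.sum_comm]
  simp

end ProductSums

/-! ### Existence of mixing parameters. -/

namespace Model

variable {K m : ℕ} {S A : Fin K → Type*} [∀ k, Fintype (S k)] [∀ k, Fintype (A k)]
  {E : Type*} [MeasurableSpace E] (M : Model K m S A E)

theorem jointP_mem_stdSimplex (a : ∀ k, A k) (s : ∀ k, S k) :
    M.jointP a s ∈ stdSimplex ℝ (∀ k, S k) :=
  prod_mem_stdSimplex fun k => M.P_stochastic k (a k) (s k)

variable [∀ k, DecidableEq (S k)]

/-- `Pi` may correlate the MDPs, but for a fixed joint action the next states are independent. The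
sum of products factorizes, and each factor is at least its own one-step minimum. -/
theorem prod_worstReach_le_pow {Pi : (∀ k, S k) → (∀ k, A k) → ℝ} (hPi : IsPolicy Pi)
    (y : ∀ k, S k) (n : ℕ) (s : ∀ k, S k) :
    ∏ k, worstReach (M.P k) (y k) n (s k) ≤ (policyMatrix M.jointP Pi ^ n) s y := by
  have hnn : ∀ n (s : ∀ k, S k), 0 ≤ ∏ k, worstReach (M.P k) (y k) n (s k) := fun n s =>
    Finset.prod_nonneg fun k _ => worstReach_nonneg (M.P_stochastic k) _ _ _
  induction n generalizing s with
  | zero =>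
    by_cases h : s = y
    · subst h; simp [worstReach]
    · obtain ⟨k, hk⟩ := Function.ne_iff.1 h
      rw [Finset.prod_eq_zero (Finset.mem_univ k) (by simp [worstReach, hk])]
      simp [h]
  | succ n ih =>
    rw [pow_succ', Matrix.mul_apply]
    calc ∏ k, worstReach (M.P k) (y k) (n + 1) (s k)
        = ∑ a, Pi s a * ∏ k, worstReach (M.P k) (y k) (n + 1) (s k) := by
          rw [← Finset.sum_mul, (hPi s).2, one_mul]
      _ ≤ ∑ a, Pi s a * ∏ k, ∑ z, M.P k (a k) (s k) z * worstReach (M.P k) (y k) n z :=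
          Finset.sum_le_sum fun a _ => mul_le_mul_of_nonneg_left
            (Finset.prod_le_prod (fun k _ => worstReach_nonneg (M.P_stochastic k) _ _ _)
              fun k _ => worstReach_succ_le _ _ _ _) ((hPi s).1 a)
      _ = ∑ s', policyMatrix M.jointP Pi s s' * ∏ k, worstReach (M.P k) (y k) n (s' k) := by
          simp only [policyMatrix, Matrix.of_apply, Finset.sum_mul, Fintype.prod_sum,
            Finset.prod_mul_distrib, Finset.mul_sum, jointP]
          rw [Finset.sum_comm]
          simp only [mul_assoc]
      _ ≤ _ := Finset.sum_le_sum fun s' _ => mul_le_mul_of_nonneg_left (ih s')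
          (Matrix.nonneg_of_mem_rowStochastic
            (policyMatrix_mem_rowStochastic M.jointP_mem_stdSimplex hPi))

variable {M}

theorem Unichain.exists_worstReach_pos [∀ k, Nonempty (A k)] (h : M.Unichain) :
    ∃ r : ℕ, 1 ≤ r ∧ ∀ k s y, 0 < worstReach (M.P k) y r s := by
  obtain ⟨r, hr, hpos⟩ := h
  refine ⟨r, hr, fun k s y => ?_⟩
  obtain ⟨π, hπ, hπe⟩ := exists_pure_prod_eq_worstReach (P := M.P k) y r
  rw [← hπe]
  exact hpos r le_rfl k π hπ s y

theorem exists_pos_forall_le {ι : Type*} [Finite ι] (f : ι → ℝ) (hf : ∀ i, 0 < f i) :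
    ∃ δ : ℝ, 0 < δ ∧ δ ≤ 1 ∧ ∀ i, δ ≤ f i := by
  rcases isEmpty_or_nonempty ι with h | h
  · exact ⟨1, one_pos, le_rfl, fun i => h.elim i⟩
  · obtain ⟨i, hi⟩ := Finite.exists_min f
    exact ⟨min (f i) 1, lt_min (hf i) one_pos, min_le_right _ _,
      fun j => (min_le_left _ _).trans (hi j)⟩

/-- Doeblin's contraction with δ below all r-step worst-case probabilities; `τ = 1/δ` works because
1 − δ ≤ e^{−δ}. -/
theorem Unichain.exists_isMixing [∀ k, Nonempty (S k)] [∀ k, Nonempty (A k)] (h : M.Unichain) :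
    ∃ (r : ℕ) (τ : ℝ), M.IsMixing r τ := by
  obtain ⟨r, hr, hpos⟩ := h.exists_worstReach_pos
  obtain ⟨δ, hδ, hδ1, hle⟩ := exists_pos_forall_le
    (fun i : Σ k, S k × S k => worstReach (M.P i.1) i.2.2 r i.2.1) fun i => hpos _ _ _
  refine ⟨r, 1 / δ, hr, by rw [le_div_iff₀ hδ]; linarith, fun k d₁ d₂ h₁ h₂ π hπ => ?_⟩
  have hst : (List.ofFn fun j => policyMatrix (M.P k) (π j)).prod ∈ Matrix.rowStochastic ℝ (S k) := by
    refine Submonoid.list_prod_mem _ fun N hN => ?_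
    obtain ⟨j, rfl⟩ := List.mem_ofFn.1 hN
    exact policyMatrix_mem_rowStochastic (M.P_stochastic k) (hπ j)
  refine (l1Norm_vecMul_le_of_le hst hδ.le (fun s s' => (hle ⟨k, s, s'⟩).trans
    (worstReach_le_prod (M.P_stochastic k) s' r π hπ s)) ?_).trans ?_
  · simp only [Pi.sub_apply, Finset.sum_sub_distrib, h₁.2, h₂.2, sub_self]
  · refine mul_le_mul_of_nonneg_right ?_ (l1Norm_nonneg _)
    have : -1 / (1 / δ) = -δ := by field_simp
    rw [this]
    exact Real.one_sub_le_exp_neg δ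

/-- Minorization on the product space contracts by 1 − δ every r steps. With `r₁ = r/δ` the claimed
bound is 2 exp(1 − tδ/r); the 1 in the exponent absorbs the incomplete last block, as δ ≤ 1. -/
theorem Unichain.exists_isJointMixing [∀ k, Nonempty (S k)] [∀ k, Nonempty (A k)]
    (h : M.Unichain) : ∃ r₁ : ℝ, M.IsJointMixing r₁ := by
  obtain ⟨r, hr, hpos⟩ := h.exists_worstReach_pos
  obtain ⟨δ, hδ, hδ1, hle⟩ := exists_pos_forall_le
    (fun i : (∀ k, S k) × (∀ k, S k) => ∏ k, worstReach (M.P k) (i.2 k) r (i.1 k))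
    fun i => Finset.prod_pos fun k _ => hpos _ _ _
  have hr0 : (0 : ℝ) < r := by exact_mod_cast hr
  refine ⟨r / δ, div_pos hr0 hδ, fun Pi d₀ dPi hPi h₀ hdPi t => ?_⟩
  set N := policyMatrix M.jointP Pi with hN
  have hst : N ∈ Matrix.rowStochastic ℝ (∀ k, S k) :=
    policyMatrix_mem_rowStochastic M.jointP_mem_stdSimplex hPi
  have hsum : ∀ n, ∑ s, Matrix.vecMul (d₀ - dPi) (N ^ n) s = 0 := fun n => by
    rw [sum_vecMul_of_mem_rowStochastic (Submonoid.pow_mem _ hst n)]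
    simp only [_root_.Pi.sub_apply, Finset.sum_sub_distrib, h₀.2, hdPi.1.2, sub_self]
  have hblock : ∀ q : ℕ, l1Norm (Matrix.vecMul (d₀ - dPi) (N ^ (r * q))) ≤ (1 - δ) ^ q * 2 := by
    intro q
    induction q with
    | zero => simpa using l1Norm_sub_le_two h₀ hdPi.1
    | succ q ih =>
      rw [Nat.mul_succ, pow_add, ← Matrix.vecMul_vecMul]
      refine (l1Norm_vecMul_le_of_le (Submonoid.pow_mem _ hst r) hδ.le (fun s s' =>
        (hle (s, s')).trans (M.prod_worstReach_le_pow hPi s' r s)) (hsum _)).trans ?_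
      rw [pow_succ', mul_assoc]
      exact mul_le_mul_of_nonneg_left ih (by linarith)
  have ht : N ^ t = N ^ (r * (t / r)) * N ^ (t % r) := by rw [← pow_add, Nat.div_add_mod]
  rw [ht, ← Matrix.vecMul_vecMul]
  refine (l1Norm_vecMul_le (Submonoid.pow_mem _ hst _) _).trans ((hblock _).trans ?_)
  rw [mul_comm]
  refine mul_le_mul_of_nonneg_left ?_ zero_le_two
  calc (1 - δ) ^ (t / r) ≤ Real.exp (-δ) ^ (t / r) :=
        pow_le_pow_left₀ (by linarith) (Real.one_sub_le_exp_neg δ) _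
    _ = Real.exp ((t / r : ℕ) * -δ) := (Real.exp_nat_mul _ _).symm
    _ ≤ _ := by
      apply Real.exp_le_exp.2
      have h1 : (t : ℝ) ≤ r * ((t / r : ℕ) + 1) := by
        have := Nat.lt_mul_div_succ t (show 0 < r by omega)
        exact_mod_cast this.le
      have h2 : (r / δ - t) / (r / δ) = 1 - t * δ / r := by field_simp
      rw [h2]
      have h3 : t * δ / r ≤ ((t / r : ℕ) + 1) * δ := by
        rw [div_le_iff₀ hr0]
        nlinarith
      nlinarith

/-! ### Marginals of a stationary joint state-action distribution. -/

variable (M)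

/-- The marginal of a joint state-action distribution on the `k`-th MDP. -/
def stateActionMarginal (d : (∀ k, S k) → ℝ) (Pi : (∀ k, S k) → (∀ k, A k) → ℝ) (k : Fin K)
    (s : S k) (a : A k) : ℝ :=
  open Classical in
  ∑ y : (∀ k, S k) × (∀ k, A k), if (y.1 k, y.2 k) = (s, a) then d y.1 * Pi y.1 y.2 else 0

theorem pairing_stateActionMarginal (d : (∀ k, S k) → ℝ) (Pi : (∀ k, S k) → (∀ k, A k) → ℝ)
    (k : Fin K) (c : S k → A k → ℝ) :
    pairing c (stateActionMarginal d Pi k) = ∑ y, ∑ b, d y * Pi y b * c (y k) (b k) := by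
  classical
  have h := sum_sum_ite_mul (fun y : (∀ k, S k) × (∀ k, A k) => d y.1 * Pi y.1 y.2)
    (fun y => (y.1 k, y.2 k)) (fun z => c z.1 z.2)
  simp only [Fintype.sum_prod_type] at h
  rw [← h]
  unfold pairing stateActionMarginal
  refine Finset.sum_congr rfl fun s _ => Finset.sum_congr rfl fun a _ => ?_
  rw [mul_comm, Fintype.sum_prod_type]

theorem sum_pairing_stateActionMarginal (d : (∀ k, S k) → ℝ) (Pi : (∀ k, S k) → (∀ k, A k) → ℝ)
    (c : ∀ k, S k → A k → ℝ) :
    ∑ k, pairing (c k) (stateActionMarginal d Pi k) =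
      ∑ y, ∑ b, d y * Pi y b * ∑ k, c k (y k) (b k) := by
  simp only [pairing_stateActionMarginal, Finset.mul_sum]
  rw [Finset.sum_comm]
  refine Finset.sum_congr rfl fun y _ => Finset.sum_comm

/-- The k-th coordinate of the product kernel moves by `P k` alone. Summing joint stationarity over
the other coordinates therefore leaves the flow balance of the k-th MDP, whether or not `Pi` is
separable. -/
theorem stateActionMarginal_mem {d : (∀ k, S k) → ℝ} {Pi : (∀ k, S k) → (∀ k, A k) → ℝ}
    (hPi : IsPolicy Pi) (hd : IsStationary (policyMatrix M.jointP Pi) d) (k : Fin K) :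
    stateActionMarginal d Pi k ∈ stateActionPolyhedron (M.P k) := by
  classical
  have hpair := pairing_stateActionMarginal d Pi k
  refine ⟨fun s a => Finset.sum_nonneg fun y _ => ?_, ?_, fun s' => ?_⟩
  · split_ifs
    · exact mul_nonneg (hd.1.1 _) ((hPi _).1 _)
    · exact le_rfl
  · have h := hpair fun _ _ => 1
    simp only [pairing, one_mul, mul_one, ← Finset.mul_sum, (hPi _).2] at h
    rw [h, hd.1.2]
  · have h1 := hpair fun s a => M.P k a s s'
    have h2 := hpair fun s _ => if s = s' then 1 else 0
    simp only [pairing, mul_comm (M.P k _ _ _)] at h1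
    rw [h1]
    have h3 : ∑ a, stateActionMarginal d Pi k s' a =
        pairing (fun s _ => if s = s' then 1 else 0) (stateActionMarginal d Pi k) := by
      simp [pairing, ite_mul]
    have h4 : ∀ y' : ∀ k, S k, d y' = ∑ y, ∑ b, d y * Pi y b * M.jointP b y y' := fun y' => by
      rw [← sum_vecMul_policyMatrix, hd.2]
    have h5 : ∀ y : ∀ k, S k, ∑ b, d y * Pi y b * (if y k = s' then 1 else 0) =
        (∑ z, ∑ b, d z * Pi z b * M.jointP b z y) * if y k = s' then 1 else 0 := fun y => by
      rw [← h4, ← Finset.sum_mul, ← Finset.mul_sum, (hPi y).2, mul_one]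
    rw [h3, h2, Finset.sum_congr rfl fun y _ => h5 y]
    symm
    simp only [Finset.sum_mul]
    rw [Finset.sum_comm]
    refine Finset.sum_congr rfl fun y _ => ?_
    rw [Finset.sum_comm]
    refine Finset.sum_congr rfl fun b _ => ?_
    simp only [mul_assoc, ← Finset.mul_sum]
    congr 2
    have := sum_prod_mul_apply (p := fun j => M.P j (b j) (y j))
      (fun j => (M.P_stochastic j (b j) (y j)).2) k fun z => if z = s' then 1 else 0
    simp only [mul_ite, mul_one, mul_zero, Finset.sum_ite_eq', Finset.mem_univ, if_true] at this
    simp only [jointP, Matrix.of_apply, mul_ite, mul_one, mul_zero]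
    exact this

end Model

/-! ### Proximal minimizers: strong convexity and stability. -/

section Proximal

variable {S A : Type*} [Fintype S] [Fintype A]

/-- The `ℓ¹` norm on functions of the state-action pair. -/
def entryNorm (θ : S → A → ℝ) : ℝ := ∑ s, ∑ a, |θ s a|

theorem entryNorm_nonneg (θ : S → A → ℝ) : 0 ≤ entryNorm θ :=
  Finset.sum_nonneg fun _ _ => Finset.sum_nonneg fun _ _ => abs_nonneg _

theorem sqNorm_nonneg (θ : S → A → ℝ) : 0 ≤ sqNorm θ :=
  Finset.sum_nonneg fun _ _ => Finset.sum_nonneg fun _ _ => sq_nonneg _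

theorem entryNorm_sq_le (θ : S → A → ℝ) :
    entryNorm θ ^ 2 ≤ Fintype.card A * Fintype.card S * sqNorm θ := by
  have h := sq_sum_le_card_mul_sum_sq (s := (Finset.univ : Finset (S × A)))
    (f := fun z => |θ z.1 z.2|)
  simp only [Fintype.sum_prod_type, sq_abs, Finset.card_univ, Fintype.card_prod, Nat.cast_mul] at h
  rw [mul_comm (Fintype.card A : ℝ)]
  exact h

theorem abs_pairing_le {c : S → A → ℝ} {B : ℝ} (hc : ∀ s a, |c s a| ≤ B) (θ : S → A → ℝ) :
    |pairing c θ| ≤ B * entryNorm θ := by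
  unfold pairing entryNorm
  rw [Finset.mul_sum]
  refine (Finset.abs_sum_le_sum_abs _ _).trans (Finset.sum_le_sum fun s _ => ?_)
  rw [Finset.mul_sum]
  refine (Finset.abs_sum_le_sum_abs _ _).trans (Finset.sum_le_sum fun a _ => ?_)
  rw [abs_mul]
  exact mul_le_mul_of_nonneg_right (hc s a) (abs_nonneg _)

theorem pairing_sub (c θ θ' : S → A → ℝ) : pairing c (θ - θ') = pairing c θ - pairing c θ' := by
  simp only [pairing, Pi.sub_apply, mul_sub, Finset.sum_sub_distrib]

theorem entryNorm_eq_one {P : A → Matrix S S ℝ} {θ : S → A → ℝ}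
    (hθ : θ ∈ stateActionPolyhedron P) : entryNorm θ = 1 := by
  unfold entryNorm
  simp only [abs_of_nonneg (hθ.1 _ _), hθ.2.1]

theorem abs_pairing_le_of_mem {P : A → Matrix S S ℝ} {θ : S → A → ℝ}
    (hθ : θ ∈ stateActionPolyhedron P) {c : S → A → ℝ} {B : ℝ} (hc : ∀ s a, |c s a| ≤ B) :
    |pairing c θ| ≤ B := by
  simpa [entryNorm_eq_one hθ] using abs_pairing_le hc θ

theorem sqNorm_sub_le_two {P : A → Matrix S S ℝ} {θ θ' : S → A → ℝ}
    (hθ : θ ∈ stateActionPolyhedron P) (hθ' : θ' ∈ stateActionPolyhedron P) :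
    sqNorm (θ - θ') ≤ 2 := by
  have hle : ∀ {φ : S → A → ℝ}, φ ∈ stateActionPolyhedron P → ∀ s a, φ s a ≤ 1 := fun h s a =>
    calc _ ≤ ∑ a, _ := Finset.single_le_sum (fun a _ => h.1 s a) (Finset.mem_univ a)
      _ ≤ ∑ s, ∑ a, _ := Finset.single_le_sum (f := fun s => ∑ a, _)
          (fun s _ => Finset.sum_nonneg fun a _ => h.1 s a) (Finset.mem_univ s)
      _ = 1 := h.2.1
  calc sqNorm (θ - θ') ≤ ∑ s, ∑ a, (θ s a + θ' s a) :=
        Finset.sum_le_sum fun s _ => Finset.sum_le_sum fun a _ => by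
          have := hle hθ s a
          have := hle hθ' s a
          have := hθ.1 s a
          have := hθ'.1 s a
          simp only [Pi.sub_apply]
          nlinarith
    _ = 2 := by
        simp only [Finset.sum_add_distrib, hθ.2.1, hθ'.2.1]
        norm_num

/-- Strong convexity: the minimizer of a linear function plus a quadratic proximal term beats every
other point by the proximal distance. -/
theorem add_sqNorm_le_of_isMinOn {C : Set (S → A → ℝ)} (hC : Convex ℝ C) {c θ' p q : S → A → ℝ}
    {α : ℝ} (hp : p ∈ C) (hq : q ∈ C)
    (hmin : IsMinOn (fun θ => pairing c θ + α * sqNorm (θ - θ')) C p) :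
    pairing c p + α * sqNorm (p - θ') + α * sqNorm (q - p) ≤
      pairing c q + α * sqNorm (q - θ') := by
  set D : ℝ := ∑ s, ∑ a, (c s a + 2 * α * (p s a - θ' s a)) * (q s a - p s a) with hD
  set H : ℝ := α * sqNorm (q - p) with hH
  have hexp : ∀ ε : ℝ, pairing c (p + ε • (q - p)) + α * sqNorm (p + ε • (q - p) - θ') =
      pairing c p + α * sqNorm (p - θ') + ε * D + ε ^ 2 * H := fun ε => by
    simp only [hD, hH, pairing, sqNorm, Finset.mul_sum, ← Finset.sum_add_distrib]
    refine Finset.sum_congr rfl fun s _ => Finset.sum_congr rfl fun a _ => ?_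
    simp only [Pi.add_apply, Pi.sub_apply, Pi.smul_apply, smul_eq_mul]
    ring
  have hD0 : 0 ≤ D := by
    by_contra! hneg
    have hden : 0 < |H| + -D := by have := abs_nonneg H; linarith
    -- Chosen so that ε(|H| + |D|) = |D|/2: the first-order loss ε D outweighs ε² H, contradicting
    -- minimality.
    set ε : ℝ := -D / (2 * (|H| + -D)) with hε
    have hε0 : 0 < ε := div_pos (by linarith) (by linarith)
    have hε1 : ε ≤ 1 := by
      rw [hε, div_le_one (by linarith)]
      have := abs_nonneg H
      linarith
    have hεm : ε * (|H| + -D) = -D / 2 := by rw [hε]; field_simp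
    have hmem : p + ε • (q - p) ∈ C := hC.add_smul_sub_mem hp hq ⟨hε0.le, hε1⟩
    have h := hmin hmem
    simp only [Set.mem_ofPred_eq, hexp] at h
    have h1 : H ≤ |H| := le_abs_self H
    have h2 : 0 ≤ ε * (D + ε * H) := by nlinarith
    have h3 : 0 ≤ D + ε * H := nonneg_of_mul_nonneg_right h2 hε0
    nlinarith
  have h1 := hexp 1
  simp only [one_smul, add_sub_cancel, one_mul, one_pow] at h1
  linarith

/-- Cauchy–Schwarz replaces the Euclidean norm by the ℓ¹ norm at the price of |A||S|, after which
one factor of the norm cancels. This is how |A||S| enters the movement of the iterates. -/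
theorem entryNorm_le_of_sqNorm_le {α B : ℝ} (hα : 0 < α) (hB : 0 ≤ B) {θ : S → A → ℝ}
    (h : 2 * α * sqNorm θ ≤ B * entryNorm θ) :
    entryNorm θ ≤ Fintype.card A * Fintype.card S * B / (2 * α) := by
  have h1 := entryNorm_sq_le θ
  have h0 := entryNorm_nonneg θ
  have hn : (0 : ℝ) ≤ Fintype.card A * Fintype.card S := by positivity
  rcases h0.eq_or_lt with h0 | h0
  · rw [← h0]; positivity
  · rw [le_div_iff₀ (by linarith)]
    have h2 : entryNorm θ ^ 2 * (2 * α) ≤ Fintype.card A * Fintype.card S * (B * entryNorm θ) :=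
      calc _ ≤ Fintype.card A * Fintype.card S * sqNorm θ * (2 * α) :=
            mul_le_mul_of_nonneg_right h1 (by linarith)
        _ = Fintype.card A * Fintype.card S * (2 * α * sqNorm θ) := by ring
        _ ≤ _ := mul_le_mul_of_nonneg_left h hn
    nlinarith

/-- Proximal minimizers depend Lipschitz-continuously on the data. -/
theorem entryNorm_sub_le_of_isMinOn {C : Set (S → A → ℝ)} (hC : Convex ℝ C)
    {c₁ θ₁ p₁ c₂ θ₂ p₂ : S → A → ℝ} {α B : ℝ} (hα : 0 < α) (hB : 0 ≤ B) (hp₁ : p₁ ∈ C)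
    (hp₂ : p₂ ∈ C) (h₁ : IsMinOn (fun θ => pairing c₁ θ + α * sqNorm (θ - θ₁)) C p₁)
    (h₂ : IsMinOn (fun θ => pairing c₂ θ + α * sqNorm (θ - θ₂)) C p₂)
    (hc : ∀ s a, |(c₁ s a - 2 * α * θ₁ s a) - (c₂ s a - 2 * α * θ₂ s a)| ≤ B) :
    entryNorm (p₂ - p₁) ≤ Fintype.card A * Fintype.card S * B / (2 * α) := by
  refine entryNorm_le_of_sqNorm_le hα hB ?_
  -- Each minimizer is tested against the other. Up to constants the objective is ⟨c − 2αθ', ·⟩ +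
  -- α‖·‖², so only the difference of the vectors c − 2αθ' survives.
  have e₁ := add_sqNorm_le_of_isMinOn hC hp₁ hp₂ h₁
  have e₂ := add_sqNorm_le_of_isMinOn hC hp₂ hp₁ h₂
  have hsymm : sqNorm (p₁ - p₂) = sqNorm (p₂ - p₁) := by
    simp only [sqNorm, Pi.sub_apply, sub_sq_comm]
  have hid : pairing (fun s a => (c₁ s a - 2 * α * θ₁ s a) - (c₂ s a - 2 * α * θ₂ s a)) (p₂ - p₁) =
      (pairing c₁ p₂ + α * sqNorm (p₂ - θ₁)) - (pairing c₁ p₁ + α * sqNorm (p₁ - θ₁)) +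
      ((pairing c₂ p₁ + α * sqNorm (p₁ - θ₂)) - (pairing c₂ p₂ + α * sqNorm (p₂ - θ₂))) := by
    simp only [pairing, sqNorm, Finset.mul_sum, ← Finset.sum_add_distrib, ← Finset.sum_sub_distrib]
    refine Finset.sum_congr rfl fun s _ => Finset.sum_congr rfl fun a _ => ?_
    simp only [Pi.sub_apply]
    ring
  have hle := (le_abs_self _).trans (abs_pairing_le hc (p₂ - p₁))
  rw [hsymm] at e₂
  linarith

/-- The minimizer is tested against the proximal center, where the quadratic term vanishes. -/
theorem entryNorm_sub_le_of_isMinOn_self {C : Set (S → A → ℝ)} (hC : Convex ℝ C)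
    {c θ' p : S → A → ℝ} {α B : ℝ} (hα : 0 < α) (hB : 0 ≤ B) (hp : p ∈ C) (hθ' : θ' ∈ C)
    (h : IsMinOn (fun θ => pairing c θ + α * sqNorm (θ - θ')) C p) (hc : ∀ s a, |c s a| ≤ B) :
    entryNorm (θ' - p) ≤ Fintype.card A * Fintype.card S * B / (2 * α) := by
  refine entryNorm_le_of_sqNorm_le hα hB ?_
  have e := add_sqNorm_le_of_isMinOn hC hp hθ' h
  have hsymm : sqNorm (p - θ') = sqNorm (θ' - p) := by
    simp only [sqNorm, Pi.sub_apply, sub_sq_comm]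
  have h0 : sqNorm (θ' - θ') = 0 := by simp [sqNorm]
  have hle := (le_abs_self _).trans (abs_pairing_le hc (θ' - p))
  rw [pairing_sub] at hle
  rw [hsymm, h0] at e
  linarith

theorem abs_apply_le_entryNorm (θ : S → A → ℝ) (s : S) (a : A) : |θ s a| ≤ entryNorm θ :=
  calc |θ s a| ≤ ∑ a, |θ s a| :=
        Finset.single_le_sum (f := fun a => |θ s a|) (fun _ _ => abs_nonneg _) (Finset.mem_univ a)
    _ ≤ entryNorm θ := Finset.single_le_sum (f := fun s => ∑ a, |θ s a|)
        (fun _ _ => Finset.sum_nonneg fun _ _ => abs_nonneg _) (Finset.mem_univ s)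

/-- A function that is Lipschitz with respect to measurable data is measurable. -/
theorem measurable_of_abs_sub_le_dist {X F : Type*} [MeasurableSpace X] [PseudoMetricSpace F]
    [MeasurableSpace F] [BorelSpace F] {c : X → F} (hc : Measurable c) {p : X → ℝ} {L : NNReal}
    (h : ∀ x y, |p x - p y| ≤ L * dist (c x) (c y)) : Measurable p := by
  rcases isEmpty_or_nonempty X with hX | hX
  · exact measurable_of_empty p
  -- `p` factors through `c` as a Lipschitz function on the range of `c`. This range need not be
  -- measurable, so the function is extended to the whole space before composing.
  have hinv : ∀ x, c (Function.invFun c (c x)) = c x := fun x => Function.invFun_eq ⟨x, rfl⟩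
  have hlip : LipschitzOnWith L (fun z => p (Function.invFun c z)) (Set.range c) := by
    refine LipschitzOnWith.of_dist_le_mul ?_
    rintro _ ⟨x, rfl⟩ _ ⟨y, rfl⟩
    rw [Real.dist_eq]
    simpa only [hinv] using h (Function.invFun c (c x)) (Function.invFun c (c y))
  obtain ⟨g, hg, hgeq⟩ := hlip.extend_real
  have : p = g ∘ c := funext fun x => by
    rw [Function.comp_apply, ← hgeq ⟨x, rfl⟩]
    have h0 := h x (Function.invFun c (c x))
    rw [hinv, dist_self, mul_zero] at h0
    exact sub_eq_zero.1 (abs_nonpos_iff.1 h0)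
  rw [this]
  exact hg.continuous.measurable.comp hc

end Proximal

/-! ### The algorithm on one path; dependence on the environment. -/

namespace Model

variable {K m : ℕ} {S A : Fin K → Type*} [∀ k, Fintype (S k)] [∀ k, Fintype (A k)]
  {E : Type*} [MeasurableSpace E] {M : Model K m S A E}

/-- The total penalty of slot `t` under the state-action vectors `φ`. -/
def penaltyAt (M : Model K m S A E) (x : EnvPath E) (t : ℕ) (φ : ∀ k, S k → A k → ℝ) : ℝ :=
  ∑ k, pairing (M.f x t k) (φ k)

/-- The total value of the `i`-th constraint in slot `t` under the state-action vectors `φ`. -/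
def constraintAt (M : Model K m S A E) (x : EnvPath E) (t : ℕ) (i : Fin m)
    (φ : ∀ k, S k → A k → ℝ) : ℝ :=
  ∑ k, pairing (M.g x t i k) (φ k)

theorem abs_sum_le_card_mul {B : ℝ} {c : Fin K → ℝ} (h : ∀ k, |c k| ≤ B) : |∑ k, c k| ≤ K * B := by
  refine (Finset.abs_sum_le_sum_abs _ _).trans ((Finset.sum_le_sum fun k _ => h k).trans ?_)
  simp

theorem BoundedBy.abs_penaltyAt_le {Ψ : ℝ} (hM : M.BoundedBy Ψ) {φ : ∀ k, S k → A k → ℝ}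
    (hφ : ∀ k, φ k ∈ stateActionPolyhedron (M.P k)) (x : EnvPath E) (t : ℕ) :
    |M.penaltyAt x t φ| ≤ K * Ψ :=
  abs_sum_le_card_mul fun k => abs_pairing_le_of_mem (hφ k) fun s a => hM.1 k s a _

theorem BoundedBy.abs_constraintAt_le {Ψ : ℝ} (hM : M.BoundedBy Ψ) {φ : ∀ k, S k → A k → ℝ}
    (hφ : ∀ k, φ k ∈ stateActionPolyhedron (M.P k)) (x : EnvPath E) (t : ℕ) (i : Fin m) :
    |M.constraintAt x t i φ| ≤ K * Ψ :=
  abs_sum_le_card_mul fun k => abs_pairing_le_of_mem (hφ k) fun s a => hM.2 i k s a _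

theorem pairing_weighted {S A : Type*} [Fintype S] [Fintype A] (V : ℝ) (f : S → A → ℝ)
    (g : Fin m → S → A → ℝ) (Q : Fin m → ℝ) (θ : S → A → ℝ) :
    pairing (fun s a => V * f s a + ∑ i, Q i * g i s a) θ =
      V * pairing f θ + ∑ i, Q i * pairing (g i) θ := by
  simp only [pairing, add_mul, Finset.sum_add_distrib, Finset.mul_sum, Finset.sum_mul, mul_assoc]
  congr 1
  symm
  rw [Finset.sum_comm]
  refine Finset.sum_congr rfl fun s _ => ?_
  rw [Finset.sum_comm]

namespace IsAlgorithmRun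

section Path

variable {V α Ψ : ℝ} {θ₀ : ∀ k, S k → A k → ℝ} {x : EnvPath E} {θ : ℕ → ∀ k, S k → A k → ℝ}
  {Q : ℕ → Fin m → ℝ}

theorem mem (run : M.IsAlgorithmRun V α θ₀ x θ Q)
    (hθ₀ : ∀ k, θ₀ k ∈ stateActionPolyhedron (M.P k)) (t : ℕ) (k : Fin K) :
    θ t k ∈ stateActionPolyhedron (M.P k) := by
  cases t with
  | zero => rw [run.theta_zero]; exact hθ₀ k
  | succ t => exact run.theta_mem t k

theorem queue_nonneg (run : M.IsAlgorithmRun V α θ₀ x θ Q) (t : ℕ) (i : Fin m) : 0 ≤ Q t i := by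
  rcases t with _ | _ | t
  · rw [run.queue_zero]
  · rw [run.queue_one]
  · rw [run.queue_succ]; exact le_max_right _ _

theorem queue_le (run : M.IsAlgorithmRun V α θ₀ x θ Q) (hM : M.BoundedBy Ψ) (hΨ : 0 ≤ Ψ)
    (t : ℕ) (i : Fin m) : Q (t + 1) i ≤ t * (K * Ψ) := by
  induction t with
  | zero => rw [run.queue_one]; simp
  | succ t ih =>
    rw [run.queue_succ]
    have h := (le_abs_self _).trans (hM.abs_constraintAt_le (run.theta_mem t) x t i)
    unfold constraintAt at h
    have h0 : 0 ≤ K * Ψ := by positivity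
    refine max_le ?_ (by positivity)
    push_cast
    linarith

theorem add_constraintAt_le (run : M.IsAlgorithmRun V α θ₀ x θ Q) (t : ℕ) (i : Fin m) :
    Q (t + 1) i + M.constraintAt x t i (θ (t + 1)) ≤ Q (t + 2) i := by
  rw [run.queue_succ]
  exact le_max_left _ _

theorem queue_sq_le (run : M.IsAlgorithmRun V α θ₀ x θ Q) (hM : M.BoundedBy Ψ) (t : ℕ)
    (i : Fin m) :
    Q (t + 2) i ^ 2 ≤
      Q (t + 1) i ^ 2 + 2 * (Q (t + 1) i * M.constraintAt x t i (θ (t + 1))) + (K * Ψ) ^ 2 := by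
  have h := sq_le_sq' (abs_le.1 (hM.abs_constraintAt_le (run.theta_mem t) x t i)).1
    (abs_le.1 (hM.abs_constraintAt_le (run.theta_mem t) x t i)).2
  have h1 : Q (t + 2) i ^ 2 ≤ (Q (t + 1) i + M.constraintAt x t i (θ (t + 1))) ^ 2 := by
    rw [run.queue_succ]
    change max (_ + M.constraintAt x t i (θ (t + 1))) 0 ^ 2 ≤ _
    rcases max_cases (Q (t + 1) i + M.constraintAt x t i (θ (t + 1))) 0 with h | h
    · rw [h.1]
    · rw [h.1]; exact le_trans (by norm_num) (sq_nonneg _)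
  nlinarith

/-- The drift-plus-penalty inequality of one step, against arbitrary fixed state-action vectors. -/
theorem drift_le (run : M.IsAlgorithmRun V α θ₀ x θ Q) (hM : M.BoundedBy Ψ)
    {φ : ∀ k, S k → A k → ℝ} (hφ : ∀ k, φ k ∈ stateActionPolyhedron (M.P k)) (t : ℕ) :
    V * M.penaltyAt x t (θ (t + 1)) + α * ∑ k, sqNorm (θ (t + 1) k - θ t k) +
        (∑ i, Q (t + 2) i ^ 2) / 2 + α * ∑ k, sqNorm (φ k - θ (t + 1) k) ≤
      V * M.penaltyAt x t φ + ∑ i, Q (t + 1) i * M.constraintAt x t i φ +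
        (∑ i, Q (t + 1) i ^ 2) / 2 + α * ∑ k, sqNorm (φ k - θ t k) + m * (K * Ψ) ^ 2 / 2 := by
  have hlin : ∀ ψ : ∀ k, S k → A k → ℝ, ∑ k, pairing
      (fun s a => V * M.f x t k s a + ∑ i, Q (t + 1) i * M.g x t i k s a) (ψ k) =
        V * M.penaltyAt x t ψ + ∑ i, Q (t + 1) i * M.constraintAt x t i ψ := fun ψ => by
    unfold penaltyAt constraintAt
    rw [Finset.sum_congr rfl fun k _ => pairing_weighted V (M.f x t k) (fun i => M.g x t i k)
      (Q (t + 1)) (ψ k)]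
    simp only [Finset.mul_sum, Finset.sum_add_distrib]
    rw [Finset.sum_comm (s := (Finset.univ : Finset (Fin m)))]
  have hk := Finset.sum_le_sum fun k (_ : k ∈ Finset.univ) =>
    add_sqNorm_le_of_isMinOn convex_stateActionPolyhedron (run.theta_mem t k) (hφ k)
      (run.theta_min t k)
  have hq := Finset.sum_le_sum fun i (_ : i ∈ Finset.univ) => run.queue_sq_le hM t i
  simp only [Finset.sum_add_distrib, ← Finset.mul_sum, hlin, Finset.sum_const, Finset.card_univ,
    Fintype.card_fin, nsmul_eq_mul] at hk hq
  linarith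

/-- The linear part of the subproblem has entries at most Ψ(V + Σ_i Q_i), against the proximal
weight α. With α = T and queues of order √T, a single step is of order 1/√T. -/
theorem entryNorm_step_le (run : M.IsAlgorithmRun V α θ₀ x θ Q) (hM : M.BoundedBy Ψ) (hΨ : 0 ≤ Ψ)
    (hV : 0 ≤ V) (hα : 0 < α) (hθ₀ : ∀ k, θ₀ k ∈ stateActionPolyhedron (M.P k)) (t : ℕ)
    (k : Fin K) :
    entryNorm (θ t k - θ (t + 1) k) ≤
      Fintype.card (A k) * Fintype.card (S k) * (Ψ * (V + ∑ i, Q (t + 1) i)) / (2 * α) := by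
  have hQ := run.queue_nonneg (t + 1)
  refine entryNorm_sub_le_of_isMinOn_self convex_stateActionPolyhedron hα
    (mul_nonneg hΨ (add_nonneg hV (Finset.sum_nonneg fun i _ => hQ i))) (run.theta_mem t k)
    (run.mem hθ₀ t k) (run.theta_min t k) fun s a => ?_
  have h1 : |V * M.f x t k s a| ≤ V * Ψ := by
    rw [abs_mul, abs_of_nonneg hV]
    exact mul_le_mul_of_nonneg_left (hM.1 k s a _) hV
  have h2 : |∑ i, Q (t + 1) i * M.g x t i k s a| ≤ ∑ i, Q (t + 1) i * Ψ :=
    (Finset.abs_sum_le_sum_abs _ _).trans (Finset.sum_le_sum fun i _ => by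
      rw [abs_mul, abs_of_nonneg (hQ i)]
      exact mul_le_mul_of_nonneg_left (hM.2 i k s a _) (hQ i))
  rw [← Finset.sum_mul] at h2
  refine (abs_add_le _ _).trans ?_
  linarith

end Path

section Dependence

variable {V α Ψ : ℝ} {θ₀ : ∀ k, S k → A k → ℝ} {θ : EnvPath E → ℕ → ∀ k, S k → A k → ℝ}
  {Q : EnvPath E → ℕ → Fin m → ℝ}

/-- The iterates of slot `t` are determined by the environment before slot `t`. -/
theorem eq_of_agree (run : ∀ x, M.IsAlgorithmRun V α θ₀ x (θ x) (Q x)) (hα : 0 < α)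
    {x x' : EnvPath E} (t : ℕ) (h₁ : ∀ j < t, x.1 j = x'.1 j) (h₂ : ∀ j < t, x.2 j = x'.2 j) :
    θ x t = θ x' t ∧ Q x (t + 1) = Q x' (t + 1) := by
  induction t with
  | zero =>
    exact ⟨by rw [(run x).theta_zero, (run x').theta_zero],
      funext fun i => by rw [(run x).queue_one, (run x').queue_one]⟩
  | succ t ih =>
    obtain ⟨hθ, hQ⟩ := ih (fun j hj => h₁ j (by omega)) (fun j hj => h₂ j (by omega))
    have hθ' : θ x (t + 1) = θ x' (t + 1) := funext fun k => by
      -- Equal data give distance zero: the Lipschitz estimate with `B = 0` is uniqueness of the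
      -- minimizer.
      have h := entryNorm_sub_le_of_isMinOn convex_stateActionPolyhedron hα le_rfl
        ((run x).theta_mem t k) ((run x').theta_mem t k) ((run x).theta_min t k)
        ((run x').theta_min t k) (fun s a => by
          simp [f, g, h₁ t (Nat.lt_succ_self t), h₂ t (Nat.lt_succ_self t), hθ, hQ])
      rw [mul_zero, zero_div] at h
      funext s a
      have h' := (abs_apply_le_entryNorm _ s a).trans h
      exact (sub_eq_zero.1 (abs_nonpos_iff.1 h')).symm
    refine ⟨hθ', funext fun i => ?_⟩
    have hg : M.g x t = M.g x' t := by
      funext i k s a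
      simp only [g, h₁ t (Nat.lt_succ_self t)]
    rw [(run x).queue_succ, (run x').queue_succ, hθ', hQ, hg]

theorem measurable_f (k : Fin K) (s : S k) (a : A k) (t : ℕ) :
    Measurable fun x : EnvPath E => M.f x t k s a :=
  (M.measurable_fhat k s a).comp ((measurable_pi_apply t).comp measurable_snd)

theorem measurable_g (i : Fin m) (k : Fin K) (s : S k) (a : A k) (t : ℕ) :
    Measurable fun x : EnvPath E => M.g x t i k s a :=
  (M.measurable_ghat i k s a).comp ((measurable_pi_apply t).comp measurable_fst)

theorem measurable_pairing {X S A : Type*} [MeasurableSpace X] [Fintype S] [Fintype A]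
    {c θ : X → S → A → ℝ} (hc : ∀ s a, Measurable fun x => c x s a)
    (hθ : ∀ s a, Measurable fun x => θ x s a) : Measurable fun x => pairing (c x) (θ x) :=
  Finset.measurable_sum _ fun s _ => Finset.measurable_sum _ fun a _ => (hc s a).mul (hθ s a)

/-- The iterates are known only through minimality, with no measurable selection assumed. They are
measurable because the minimizer is Lipschitz in the data V f + Σ_i Q_i g_i − 2αθ, which are
measurable by induction. -/
theorem measurable_iterates (run : ∀ x, M.IsAlgorithmRun V α θ₀ x (θ x) (Q x)) (hα : 0 < α)
    (t : ℕ) : (∀ k s a, Measurable fun x => θ x t k s a) ∧ ∀ i, Measurable fun x => Q x (t + 1) i := by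
  induction t with
  | zero =>
    refine ⟨fun k s a => ?_, fun i => ?_⟩
    · simp only [(run _).theta_zero]; exact measurable_const
    · simp only [(run _).queue_one]; exact measurable_const
  | succ t ih =>
    obtain ⟨hθ, hQ⟩ := ih
    have hθ' : ∀ k s a, Measurable fun x => θ x (t + 1) k s a := fun k s a => by
      set c : EnvPath E → S k → A k → ℝ := fun x s a =>
        V * M.f x t k s a + ∑ i, Q x (t + 1) i * M.g x t i k s a - 2 * α * θ x t k s a with hc
      have hcm : Measurable c := measurable_pi_iff.2 fun s => measurable_pi_iff.2 fun a =>
        (((measurable_f k s a t).const_mul V).add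
          (Finset.measurable_sum _ fun i _ => (hQ i).mul (measurable_g i k s a t))).sub
          ((hθ k s a).const_mul _)
      refine measurable_of_abs_sub_le_dist hcm
        (L := ⟨Fintype.card (A k) * Fintype.card (S k) / (2 * α), by positivity⟩) fun x y => ?_
      have h := entryNorm_sub_le_of_isMinOn convex_stateActionPolyhedron hα
        (dist_nonneg (x := c x) (y := c y))
        ((run x).theta_mem t k) ((run y).theta_mem t k) ((run x).theta_min t k)
        ((run y).theta_min t k) (fun s a => by
          rw [← Real.dist_eq]
          exact (dist_le_pi_dist (c x s) (c y s) a).trans (dist_le_pi_dist (c x) (c y) s))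
      have h' := (abs_apply_le_entryNorm _ s a).trans h
      rw [abs_sub_comm]
      refine h'.trans (le_of_eq ?_)
      change _ = Fintype.card (A k) * Fintype.card (S k) / (2 * α) * dist (c x) (c y)
      ring
    refine ⟨hθ', fun i => ?_⟩
    simp only [(run _).queue_succ]
    exact ((hQ i).add (Finset.measurable_sum _ fun k _ =>
      measurable_pairing (fun s a => measurable_g i k s a t) (hθ' k))).max measurable_const

end Dependence

end IsAlgorithmRun

end Model

/-! ### Indicators and conditional expectations in weak form. -/

section Indicators

variable {Ω Y : Type*}

/-- The indicator function of the event that `f` takes the value `y`. -/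
def eventInd (f : Ω → Y) (y : Y) : Ω → ℝ := (f ⁻¹' {y}).indicator fun _ => (1 : ℝ)

theorem eventInd_apply [DecidableEq Y] (f : Ω → Y) (y : Y) (w : Ω) :
    eventInd f y w = if f w = y then 1 else 0 := by
  by_cases h : f w = y
  · rw [if_pos h]; exact Set.indicator_of_mem (s := f ⁻¹' {y}) h _
  · rw [if_neg h]; exact Set.indicator_of_notMem (s := f ⁻¹' {y}) h _

theorem abs_eventInd_le (f : Ω → Y) (y : Y) (w : Ω) : |eventInd f y w| ≤ 1 := by
  classical
  rw [eventInd_apply]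
  split_ifs <;> simp

theorem sum_eventInd_mul [Fintype Y] (f : Ω → Y) (w : Ω) (c : Y → ℝ) :
    ∑ y, eventInd f y w * c y = c (f w) := by
  classical
  simp [eventInd_apply]

theorem eventInd_mul_apply (f : Ω → Y) (y : Y) (w : Ω) (c : Y → ℝ) :
    eventInd f y w * c (f w) = eventInd f y w * c y := by
  classical
  rw [eventInd_apply]
  split_ifs with h
  · rw [h]
  · simp

theorem eventInd_pi {K : ℕ} {S : Fin K → Type*} (f : Ω → ∀ k, S k) (y : ∀ k, S k) (w : Ω) :
    eventInd f y w = ∏ k, eventInd (fun w => f w k) (y k) w := by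
  classical
  simp only [eventInd_apply, Finset.prod_ite_zero, Finset.prod_const_one, Finset.mem_univ,
    forall_true_left, funext_iff]

theorem stronglyMeasurable_eventInd {m : MeasurableSpace Ω} {f : Ω → Y} {y : Y}
    (h : MeasurableSet[m] (f ⁻¹' {y})) : StronglyMeasurable[m] (eventInd f y) :=
  stronglyMeasurable_const.indicator h

theorem measurableSet_preimage_of_comap_le {m : MeasurableSpace Ω} {f : Ω → Y}
    (h : MeasurableSpace.comap f ⊤ ≤ m) (B : Set Y) : MeasurableSet[m] (f ⁻¹' B) :=
  h _ ⟨B, trivial, rfl⟩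

theorem comap_top_le {m : MeasurableSpace Ω} [Finite Y] {f : Ω → Y}
    (h : ∀ y, MeasurableSet[m] (f ⁻¹' {y})) : MeasurableSpace.comap f ⊤ ≤ m := by
  rintro _ ⟨B, -, rfl⟩
  rw [← Set.biUnion_preimage_singleton]
  exact (Set.toFinite B).measurableSet_biUnion fun y _ => h y

/-- The known factor is pulled out of the conditional expectation. In this form the defining
properties of a trajectory are used only by testing against bounded functions of the past. -/
theorem integral_mul_eq_of_condExp_ae_eq {m m0 : MeasurableSpace Ω} (hm : m ≤ m0)
    {μ : Measure[m0] Ω} [IsFiniteMeasure μ] {h F φ : Ω → ℝ} (hh : StronglyMeasurable[m] h) {B : ℝ}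
    (hB : ∀ w, |h w| ≤ B) (hF : Integrable F μ) (hφ : condExp m μ F =ᵐ[μ] φ) :
    ∫ w, h w * F w ∂μ = ∫ w, h w * φ w ∂μ := by
  have h1 := condExp_stronglyMeasurable_mul_of_bound hm hh hF B
    (Filter.Eventually.of_forall fun w => by simpa using hB w)
  calc ∫ w, h w * F w ∂μ = ∫ w, condExp m μ (h * F) w ∂μ := (integral_condExp hm).symm
    _ = ∫ w, h w * φ w ∂μ := by
        refine integral_congr_ae ?_
        filter_upwards [h1, hφ] with w h1 h2
        rw [h1, Pi.mul_apply, h2]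

theorem integrable_of_measurable_of_abs_le {m0 : MeasurableSpace Ω} {μ : Measure Ω}
    [IsFiniteMeasure μ] {h : Ω → ℝ} (hh : Measurable h) {B : ℝ} (hB : ∀ w, |h w| ≤ B) :
    Integrable h μ :=
  Integrable.of_bound hh.aestronglyMeasurable B
    (Filter.Eventually.of_forall fun w => by simpa using hB w)

end Indicators

/-! ### Laws of trajectories given the exogenous path. -/

namespace Model

variable {K m : ℕ} {S A : Fin K → Type*} [∀ k, Fintype (S k)] [∀ k, Fintype (A k)]
  {E : Type*} [MeasurableSpace E] {M : Model K m S A E}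

/-- The law of the joint state of slot `t`, given the exogenous path `x`. -/
def stateLaw (M : Model K m S A E) (d₀ : (∀ k, S k) → ℝ)
    (pol : ℕ → EnvPath E → (∀ k, S k) → (∀ k, A k) → ℝ) (x : EnvPath E) : ℕ → (∀ k, S k) → ℝ
  | 0 => d₀
  | t + 1 => Matrix.vecMul (stateLaw M d₀ pol x t) (policyMatrix M.jointP (pol t x))

theorem stateLaw_mem_stdSimplex {d₀ : (∀ k, S k) → ℝ} (hd₀ : d₀ ∈ stdSimplex ℝ (∀ k, S k))
    {pol : ℕ → EnvPath E → (∀ k, S k) → (∀ k, A k) → ℝ} (hpol : ∀ t x, IsPolicy (pol t x))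
    (x : EnvPath E) (t : ℕ) : M.stateLaw d₀ pol x t ∈ stdSimplex ℝ (∀ k, S k) := by
  classical
  induction t with
  | zero => exact hd₀
  | succ t ih =>
    exact vecMul_mem_stdSimplex
      (policyMatrix_mem_rowStochastic M.jointP_mem_stdSimplex (hpol t x)) ih

theorem measurable_stateLaw {d₀ : (∀ k, S k) → ℝ}
    {pol : ℕ → EnvPath E → (∀ k, S k) → (∀ k, A k) → ℝ}
    (hpol : ∀ t y b, Measurable fun x => pol t x y b) (t : ℕ) (y : ∀ k, S k) :
    Measurable fun x => M.stateLaw d₀ pol x t y := by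
  induction t generalizing y with
  | zero => exact measurable_const
  | succ t ih =>
    simp only [stateLaw, sum_vecMul_policyMatrix]
    exact Finset.measurable_sum _ fun z _ => Finset.measurable_sum _ fun b _ =>
      ((ih z).mul (hpol t z b)).mul_const _

theorem le_one_of_mem_stdSimplex {X : Type*} [Fintype X] {p : X → ℝ} (hp : p ∈ stdSimplex ℝ X)
    (x : X) : |p x| ≤ 1 := by
  rw [abs_of_nonneg (hp.1 x), ← hp.2]
  exact Finset.single_le_sum (fun x _ => hp.1 x) (Finset.mem_univ x)

namespace IsTrajectory

variable {Ω : Type*} [m0 : MeasurableSpace Ω] {Pr : Measure Ω} [IsProbabilityMeasure Pr]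
  {d₀ : (∀ k, S k) → ℝ} {pol : ℕ → EnvPath E → (∀ k, S k) → (∀ k, A k) → ℝ}
  {ξ : Ω → EnvPath E} {s : ℕ → Ω → ∀ k, S k} {a : ℕ → Ω → ∀ k, A k}

theorem infoBefore_le (tr : M.IsTrajectory Pr d₀ pol ξ s a) (t : ℕ) : infoBefore ξ s a t ≤ m0 :=
  sup_le (sup_le tr.measurable_env.comap_le
    (iSup₂_le fun j _ => comap_top_le (tr.measurable_state j)))
    (iSup₂_le fun j _ => comap_top_le (tr.measurable_action j))

theorem infoAfter_le (tr : M.IsTrajectory Pr d₀ pol ξ s a) (t : ℕ) : infoAfter ξ s a t ≤ m0 :=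
  sup_le (tr.infoBefore_le t) (comap_top_le (tr.measurable_action t))

theorem comap_env_le_infoBefore (t : ℕ) :
    MeasurableSpace.comap ξ inferInstance ≤ infoBefore ξ s a t :=
  le_sup_left.trans le_sup_left

theorem comap_state_le_infoBefore (t : ℕ) :
    MeasurableSpace.comap (s t) ⊤ ≤ infoBefore ξ s a t :=
  (le_iSup₂_of_le (f := fun (j : ℕ) (_ : j ≤ t) => MeasurableSpace.comap (s j) ⊤) t le_rfl
    le_rfl).trans (le_sup_right.trans le_sup_left)

theorem integral_env (tr : M.IsTrajectory Pr d₀ pol ξ s a) {h : EnvPath E → ℝ}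
    (hh : Measurable h) : ∫ w, h (ξ w) ∂Pr = ∫ x, h x ∂M.ν := by
  rw [← tr.law_env, integral_map tr.measurable_env.aemeasurable hh.aestronglyMeasurable]

theorem stronglyMeasurable_comp_env {mΩ : MeasurableSpace Ω} {h : EnvPath E → ℝ}
    (hh : Measurable h) (hle : MeasurableSpace.comap ξ inferInstance ≤ mΩ) :
    StronglyMeasurable[mΩ] fun w => h (ξ w) :=
  Measurable.stronglyMeasurable fun B hB => hle _ ⟨h ⁻¹' B, hh hB, rfl⟩

/-- Given the past, the components of the next state move independently. -/
theorem integral_mul_prod_next (tr : M.IsTrajectory Pr d₀ pol ξ s a) (t : ℕ) (J : Finset (Fin K))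
    (y : ∀ k, S k) {H : Ω → ℝ} (hH : StronglyMeasurable[infoAfter ξ s a t] H) {B : ℝ}
    (hB : ∀ w, |H w| ≤ B) :
    ∫ w, H w * ∏ k ∈ J, eventInd (fun w => s (t + 1) w k) (y k) w ∂Pr =
      ∫ w, H w * ∏ k ∈ J, M.P k (a t w k) (s t w k) (y k) ∂Pr := by
  -- One component is replaced at a time. `H` varies because the transition probability that
  -- replaces an indicator joins it; the indicators still left belong to other components, on which
  -- the transition law conditions.
  induction J using Finset.induction_on generalizing H B with
  | empty => rfl
  | insert k J hk ih =>
    have hcomp : ∀ j, MeasurableSpace.comap (fun w => s (t + 1) w j) ⊤ ≤ m0 := fun j => by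
      refine le_trans ?_ (comap_top_le (tr.measurable_state (t + 1)))
      rintro _ ⟨B, -, rfl⟩
      exact ⟨(fun z => z j) ⁻¹' B, trivial, rfl⟩
    have hle : (infoAfter ξ s a t ⊔
        ⨆ (j : Fin K) (_ : j ≠ k), MeasurableSpace.comap (fun w => s (t + 1) w j) ⊤) ≤ m0 :=
      sup_le (tr.infoAfter_le t) (iSup₂_le fun j _ => hcomp j)
    set G : Ω → ℝ := fun w => H w * ∏ j ∈ J, eventInd (fun w => s (t + 1) w j) (y j) w with hG
    have hGm : StronglyMeasurable[infoAfter ξ s a t ⊔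
        ⨆ (j : Fin K) (_ : j ≠ k), MeasurableSpace.comap (fun w => s (t + 1) w j) ⊤] G := by
      have hH' : StronglyMeasurable[infoAfter ξ s a t ⊔
          ⨆ (j : Fin K) (_ : j ≠ k), MeasurableSpace.comap (fun w => s (t + 1) w j) ⊤] H :=
        hH.mono le_sup_left
      refine hH'.mul (Finset.stronglyMeasurable_fun_prod _ fun j hj => ?_)
      refine stronglyMeasurable_eventInd (measurableSet_preimage_of_comap_le ?_ _)
      refine le_trans ?_ le_sup_right
      exact le_iSup₂_of_le (f := fun (j : Fin K) (_ : j ≠ k) =>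
        MeasurableSpace.comap (fun w => s (t + 1) w j) ⊤) j (fun h => hk (h ▸ hj)) le_rfl
    have hGB : ∀ w, |G w| ≤ B := fun w => by
      rw [hG, abs_mul, Finset.abs_prod]
      refine (mul_le_of_le_one_right (abs_nonneg _) ?_).trans (hB w)
      exact Finset.prod_le_one (fun _ _ => abs_nonneg _) fun _ _ => abs_eventInd_le _ _ _
    have hint : Integrable (eventInd (fun w => s (t + 1) w k) (y k)) Pr :=
      integrable_of_measurable_of_abs_le (stronglyMeasurable_eventInd
        (measurableSet_preimage_of_comap_le (hcomp k) _)).measurable (abs_eventInd_le _ _)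
    have h1 := integral_mul_eq_of_condExp_ae_eq hle hGm hGB hint (tr.transition t k (y k))
    have hPm : StronglyMeasurable[infoAfter ξ s a t]
        fun w => M.P k (a t w k) (s t w k) (y k) := by
      have hfun : (fun w => M.P k (a t w k) (s t w k) (y k)) =
          fun w => ∑ z, ∑ b, eventInd (s t) z w * (eventInd (a t) b w *
            M.P k (b k) (z k) (y k)) := funext fun w => by
        simp only [← Finset.mul_sum]
        rw [sum_eventInd_mul (s t) w fun z => ∑ b, eventInd (a t) b w * M.P k (b k) (z k) (y k)]
        exact (sum_eventInd_mul (a t) w fun b => M.P k (b k) (s t w k) (y k)).symm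
      rw [hfun]
      refine Finset.stronglyMeasurable_fun_sum _ fun z _ =>
        Finset.stronglyMeasurable_fun_sum _ fun b _ => ?_
      refine (stronglyMeasurable_eventInd (measurableSet_preimage_of_comap_le
        ((comap_state_le_infoBefore t).trans le_sup_left) _)).mul
        ((stronglyMeasurable_eventInd (measurableSet_preimage_of_comap_le
        le_sup_right _)).mul stronglyMeasurable_const)
    have hP1 : ∀ w, |M.P k (a t w k) (s t w k) (y k)| ≤ 1 := fun w =>
      le_one_of_mem_stdSimplex (M.P_stochastic k _ _) _
    have hB0 : ∀ w, |H w * M.P k (a t w k) (s t w k) (y k)| ≤ B := fun w => by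
      rw [abs_mul]
      exact (mul_le_of_le_one_right (abs_nonneg _) (hP1 w)).trans (hB w)
    have h2 := ih (H := fun w => H w * M.P k (a t w k) (s t w k) (y k)) (hH.mul hPm) hB0
    simp only [Finset.prod_insert hk]
    calc _ = ∫ w, G w * eventInd (fun w => s (t + 1) w k) (y k) w ∂Pr :=
          integral_congr_ae (Filter.Eventually.of_forall fun w => by simp only [hG]; ring)
      _ = ∫ w, G w * M.P k (a t w k) (s t w k) (y k) ∂Pr := h1
      _ = ∫ w, (H w * M.P k (a t w k) (s t w k) (y k)) *
            ∏ j ∈ J, eventInd (fun w => s (t + 1) w j) (y j) w ∂Pr :=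
          integral_congr_ae (Filter.Eventually.of_forall fun w => by simp only [hG]; ring)
      _ = _ := h2
      _ = _ := integral_congr_ae (Filter.Eventually.of_forall fun w => by ring)

/-- The state law of the same slot is a hypothesis so that this step is available inside the
induction that proves `integral_state`. -/
theorem integral_state_action_of_state (tr : M.IsTrajectory Pr d₀ pol ξ s a)
    (hpol : ∀ t x, IsPolicy (pol t x)) (hmeas : ∀ t y b, Measurable fun x => pol t x y b) (t : ℕ)
    (hstate : ∀ {h : EnvPath E → ℝ}, Measurable h → ∀ {B : ℝ}, (∀ x, |h x| ≤ B) →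
      ∀ y, ∫ w, h (ξ w) * eventInd (s t) y w ∂Pr = ∫ x, h x * M.stateLaw d₀ pol x t y ∂M.ν)
    {h : EnvPath E → ℝ} (hh : Measurable h) {B : ℝ} (hB : ∀ x, |h x| ≤ B) (y : ∀ k, S k)
    (b : ∀ k, A k) :
    ∫ w, h (ξ w) * eventInd (s t) y w * eventInd (a t) b w ∂Pr =
      ∫ x, h x * (M.stateLaw d₀ pol x t y * pol t x y b) ∂M.ν := by
  have hm : StronglyMeasurable[infoBefore ξ s a t] fun w => h (ξ w) * eventInd (s t) y w :=
    (stronglyMeasurable_comp_env hh (comap_env_le_infoBefore t)).mul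
      (stronglyMeasurable_eventInd
        (measurableSet_preimage_of_comap_le (comap_state_le_infoBefore t) _))
  have hb : ∀ w, |h (ξ w) * eventInd (s t) y w| ≤ B := fun w => by
    rw [abs_mul]
    exact (mul_le_of_le_one_right (abs_nonneg _) (abs_eventInd_le _ _ _)).trans (hB _)
  have hint : Integrable (eventInd (a t) b) Pr :=
    integrable_of_measurable_of_abs_le
      (stronglyMeasurable_eventInd (tr.measurable_action t b)).measurable (abs_eventInd_le _ _)
  rw [integral_mul_eq_of_condExp_ae_eq (tr.infoBefore_le t) hm hb hint (tr.action t b)]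
  have h1 : ∀ w, h (ξ w) * eventInd (s t) y w * pol t (ξ w) (s t w) b =
      (h (ξ w) * pol t (ξ w) y b) * eventInd (s t) y w := fun w => by
    rw [mul_assoc, eventInd_mul_apply (s t) y w fun z => pol t (ξ w) z b]
    ring
  simp only [h1]
  rw [hstate (h := fun x => h x * pol t x y b) (hh.mul (hmeas t y b)) (B := B) (fun x => ?_) y]
  · exact integral_congr_ae (Filter.Eventually.of_forall fun w => by ring)
  · rw [abs_mul]
    exact (mul_le_of_le_one_right (abs_nonneg _) (le_one_of_mem_stdSimplex (hpol t x y) b)).trans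
      (hB x)

/-- Testing against all bounded `h` expresses that `stateLaw` is the conditional law of the state
given the exogenous path. The induction splits over the state and action of the previous slot. -/
theorem integral_state (tr : M.IsTrajectory Pr d₀ pol ξ s a) (hd₀ : d₀ ∈ stdSimplex ℝ (∀ k, S k))
    (hpol : ∀ t x, IsPolicy (pol t x)) (hmeas : ∀ t y b, Measurable fun x => pol t x y b) (t : ℕ)
    {h : EnvPath E → ℝ} (hh : Measurable h) {B : ℝ} (hB : ∀ x, |h x| ≤ B) (y : ∀ k, S k) :
    ∫ w, h (ξ w) * eventInd (s t) y w ∂Pr = ∫ x, h x * M.stateLaw d₀ pol x t y ∂M.ν := by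
  have hν : IsProbabilityMeasure M.ν := M.isProb
  induction t generalizing h B y with
  | zero =>
    have hint : Integrable (eventInd (s 0) y) Pr :=
      integrable_of_measurable_of_abs_le
        (stronglyMeasurable_eventInd (tr.measurable_state 0 y)).measurable (abs_eventInd_le _ _)
    rw [integral_mul_eq_of_condExp_ae_eq tr.measurable_env.comap_le
      (stronglyMeasurable_comp_env hh le_rfl) (fun w => hB (ξ w)) hint (tr.init y)]
    exact tr.integral_env (h := fun x => h x * d₀ y) (hh.mul_const _)
  | succ t ih =>
    have hsa := fun z b => tr.integral_state_action_of_state hpol hmeas t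
      (fun {h} hh {B} hB y => ih hh hB y) hh hB z b
    have hterm : ∀ z b, ∫ w, (h (ξ w) * eventInd (s t) z w * eventInd (a t) b w) *
        eventInd (s (t + 1)) y w ∂Pr =
        ∫ x, h x * (M.stateLaw d₀ pol x t z * pol t x z b * M.jointP b z y) ∂M.ν := fun z b => by
      have hHm : StronglyMeasurable[infoAfter ξ s a t]
          fun w => h (ξ w) * eventInd (s t) z w * eventInd (a t) b w :=
        ((stronglyMeasurable_comp_env hh ((comap_env_le_infoBefore t).trans le_sup_left)).mul
          (stronglyMeasurable_eventInd (measurableSet_preimage_of_comap_le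
            ((comap_state_le_infoBefore t).trans le_sup_left) _))).mul
          (stronglyMeasurable_eventInd (measurableSet_preimage_of_comap_le le_sup_right _))
      have hHB : ∀ w, |h (ξ w) * eventInd (s t) z w * eventInd (a t) b w| ≤ B := fun w => by
        rw [abs_mul, abs_mul]
        exact (mul_le_of_le_one_right (by positivity) (abs_eventInd_le _ _ _)).trans
          ((mul_le_of_le_one_right (abs_nonneg _) (abs_eventInd_le _ _ _)).trans (hB _))
      have h1 := tr.integral_mul_prod_next t Finset.univ y hHm hHB
      simp only [← eventInd_pi] at h1
      rw [h1]
      have h2 : ∀ w, h (ξ w) * eventInd (s t) z w * eventInd (a t) b w *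
          ∏ k, M.P k (a t w k) (s t w k) (y k) =
          (h (ξ w) * eventInd (s t) z w * eventInd (a t) b w) * M.jointP b z y := fun w => by
        have e1 := eventInd_mul_apply (a t) b w fun c => ∏ k, M.P k (c k) (s t w k) (y k)
        have e2 := eventInd_mul_apply (s t) z w fun c => ∏ k, M.P k (b k) (c k) (y k)
        simp only [jointP, Matrix.of_apply]
        calc _ = h (ξ w) * eventInd (s t) z w * (eventInd (a t) b w *
              ∏ k, M.P k (a t w k) (s t w k) (y k)) := by ring
          _ = h (ξ w) * eventInd (a t) b w * (eventInd (s t) z w *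
              ∏ k, M.P k (b k) (s t w k) (y k)) := by rw [e1]; ring
          _ = _ := by rw [e2]; ring
      simp only [h2]
      rw [integral_mul_const, hsa z b, ← integral_mul_const]
      exact integral_congr_ae (Filter.Eventually.of_forall fun w => by ring)
    have hL : ∀ w, h (ξ w) * eventInd (s (t + 1)) y w = ∑ z, ∑ b,
        (h (ξ w) * eventInd (s t) z w * eventInd (a t) b w) * eventInd (s (t + 1)) y w := fun w => by
      have e1 := sum_eventInd_mul (s t) w fun _ => (1 : ℝ)
      have e2 := sum_eventInd_mul (a t) w fun _ => (1 : ℝ)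
      simp only [mul_one] at e1 e2
      simp only [← Finset.sum_mul, ← Finset.mul_sum, e1, e2, mul_one]
    have hmS : ∀ t z, Measurable (eventInd (s t) z) := fun t z =>
      (stronglyMeasurable_eventInd (tr.measurable_state t z)).measurable
    have hmA : ∀ t z, Measurable (eventInd (a t) z) := fun t z =>
      (stronglyMeasurable_eventInd (tr.measurable_action t z)).measurable
    simp only [hL]
    rw [integral_finsetSum]
    swap
    · refine fun z _ => integrable_finsetSum _ fun b _ => ?_
      refine integrable_of_measurable_of_abs_le (B := B)
        ((((hh.comp tr.measurable_env).mul (hmS t z)).mul (hmA t b)).mul (hmS (t + 1) y))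
        fun w => ?_
      simp only [abs_mul]
      exact (mul_le_of_le_one_right (by positivity) (abs_eventInd_le _ _ _)).trans
        ((mul_le_of_le_one_right (by positivity) (abs_eventInd_le _ _ _)).trans
        ((mul_le_of_le_one_right (abs_nonneg _) (abs_eventInd_le _ _ _)).trans (hB _)))
    have hint2 : ∀ z b, Integrable (fun x => h x *
        (M.stateLaw d₀ pol x t z * pol t x z b * M.jointP b z y)) M.ν := fun z b => by
      refine integrable_of_measurable_of_abs_le (B := B)
        (hh.mul (((measurable_stateLaw hmeas t z).mul (hmeas t z b)).mul_const _)) fun x => ?_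
      rw [abs_mul, abs_mul, abs_mul]
      refine (mul_le_of_le_one_right (abs_nonneg _) ?_).trans (hB x)
      refine mul_le_one₀ (mul_le_one₀ ?_ (abs_nonneg _) ?_) (abs_nonneg _) ?_
      · exact le_one_of_mem_stdSimplex (stateLaw_mem_stdSimplex hd₀ hpol x t) z
      · exact le_one_of_mem_stdSimplex (hpol t x z) b
      · exact le_one_of_mem_stdSimplex (M.jointP_mem_stdSimplex b z) y
    have hR : ∀ x, h x * M.stateLaw d₀ pol x (t + 1) y = ∑ z, ∑ b, h x *
        (M.stateLaw d₀ pol x t z * pol t x z b * M.jointP b z y) := fun x => by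
      simp only [stateLaw, sum_vecMul_policyMatrix, Finset.mul_sum]
    simp only [hR]
    rw [integral_finsetSum _ fun z _ => integrable_finsetSum _ fun b _ => hint2 z b]
    refine Finset.sum_congr rfl fun z _ => ?_
    rw [integral_finsetSum _ fun b _ => hint2 z b, integral_finsetSum]
    · exact Finset.sum_congr rfl fun b _ => hterm z b
    · intro b _
      refine integrable_of_measurable_of_abs_le (B := B)
        ((((hh.comp tr.measurable_env).mul (hmS t z)).mul (hmA t b)).mul (hmS (t + 1) y))
        fun w => ?_
      simp only [abs_mul]
      exact (mul_le_of_le_one_right (by positivity) (abs_eventInd_le _ _ _)).trans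
        ((mul_le_of_le_one_right (by positivity) (abs_eventInd_le _ _ _)).trans
        ((mul_le_of_le_one_right (abs_nonneg _) (abs_eventInd_le _ _ _)).trans (hB _)))

/-- Expected costs of a trajectory, as an integral over the exogenous path. -/
theorem integral_cost (tr : M.IsTrajectory Pr d₀ pol ξ s a) (hd₀ : d₀ ∈ stdSimplex ℝ (∀ k, S k))
    (hpol : ∀ t x, IsPolicy (pol t x)) (hmeas : ∀ t y b, Measurable fun x => pol t x y b) (t : ℕ)
    {c : EnvPath E → (∀ k, S k) → (∀ k, A k) → ℝ} (hc : ∀ y b, Measurable fun x => c x y b)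
    {B : ℝ} (hB : ∀ x y b, |c x y b| ≤ B) :
    Integrable (fun w => c (ξ w) (s t w) (a t w)) Pr ∧
    ∫ w, c (ξ w) (s t w) (a t w) ∂Pr =
      ∫ x, ∑ y, ∑ b, M.stateLaw d₀ pol x t y * pol t x y b * c x y b ∂M.ν := by
  have hν : IsProbabilityMeasure M.ν := M.isProb
  have hL : ∀ w, c (ξ w) (s t w) (a t w) =
      ∑ y, ∑ b, c (ξ w) y b * eventInd (s t) y w * eventInd (a t) b w := fun w => by
    rw [← sum_eventInd_mul (s t) w fun y => c (ξ w) y (a t w)]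
    refine Finset.sum_congr rfl fun y _ => ?_
    rw [← sum_eventInd_mul (a t) w fun b => c (ξ w) y b, Finset.mul_sum]
    exact Finset.sum_congr rfl fun b _ => by ring
  have hint1 : ∀ y b, Integrable
      (fun w => c (ξ w) y b * eventInd (s t) y w * eventInd (a t) b w) Pr := fun y b => by
    refine integrable_of_measurable_of_abs_le (B := B)
      ((((hc y b).comp tr.measurable_env).mul
        (stronglyMeasurable_eventInd (tr.measurable_state t y)).measurable).mul
        (stronglyMeasurable_eventInd (tr.measurable_action t b)).measurable) fun w => ?_
    simp only [abs_mul]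
    exact (mul_le_of_le_one_right (by positivity) (abs_eventInd_le _ _ _)).trans
      ((mul_le_of_le_one_right (abs_nonneg _) (abs_eventInd_le _ _ _)).trans (hB _ _ _))
  have hint2 : ∀ y b, Integrable
      (fun x => c x y b * (M.stateLaw d₀ pol x t y * pol t x y b)) M.ν := fun y b => by
    refine integrable_of_measurable_of_abs_le (B := B)
      ((hc y b).mul ((measurable_stateLaw hmeas t y).mul (hmeas t y b))) fun x => ?_
    rw [abs_mul, abs_mul]
    refine (mul_le_of_le_one_right (abs_nonneg _) (mul_le_one₀ ?_ (abs_nonneg _) ?_)).trans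
      (hB x y b)
    · exact le_one_of_mem_stdSimplex (stateLaw_mem_stdSimplex hd₀ hpol x t) y
    · exact le_one_of_mem_stdSimplex (hpol t x y) b
  simp only [hL, mul_comm (M.stateLaw _ _ _ _ _ * _)]
  refine ⟨integrable_finsetSum _ fun y _ => integrable_finsetSum _ fun b _ => hint1 y b, ?_⟩
  rw [integral_finsetSum _ fun y _ => integrable_finsetSum _ fun b _ => hint1 y b,
    integral_finsetSum _ fun y _ => integrable_finsetSum _ fun b _ => hint2 y b]
  refine Finset.sum_congr rfl fun y _ => ?_
  rw [integral_finsetSum _ fun b _ => hint1 y b, integral_finsetSum _ fun b _ => hint2 y b]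
  exact Finset.sum_congr rfl fun b _ => tr.integral_state_action_of_state hpol hmeas t
    (fun {h} hh {B} hB y => tr.integral_state hd₀ hpol hmeas t hh hB y) (hc y b) (B := B)
      (fun x => hB x y b) y b

end IsTrajectory

end Model

/-! ### Independence of pairs and exponential drift. -/

section ExponentialMoments

/-- If `X` is independent of `Y` and the pair `(X, Y)` is independent of `Z`, then `X` is
independent of the pair `(Y, Z)`. -/
theorem indepFun_prodMk_of_indepFun {Ω α β γ : Type*} [MeasurableSpace Ω] [MeasurableSpace α]
    [MeasurableSpace β] [MeasurableSpace γ] {μ : Measure Ω} [IsProbabilityMeasure μ] {X : Ω → α}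
    {Y : Ω → β} {Z : Ω → γ} (hX : Measurable X) (hY : Measurable Y) (hZ : Measurable Z)
    (hXY : IndepFun X Y μ) (hXYZ : IndepFun (fun w => (X w, Y w)) Z μ) :
    IndepFun X (fun w => (Y w, Z w)) μ := by
  have hYZ : IndepFun Y Z μ := hXYZ.comp measurable_snd measurable_id
  rw [indepFun_iff_map_prod_eq_prod_map_map hX.aemeasurable hY.aemeasurable] at hXY
  rw [indepFun_iff_map_prod_eq_prod_map_map hY.aemeasurable hZ.aemeasurable] at hYZ
  rw [indepFun_iff_map_prod_eq_prod_map_map (hX.prodMk hY).aemeasurable hZ.aemeasurable,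
    hXY] at hXYZ
  have : IsProbabilityMeasure (μ.map X) := Measure.isProbabilityMeasure_map hX.aemeasurable
  have : IsProbabilityMeasure (μ.map Y) := Measure.isProbabilityMeasure_map hY.aemeasurable
  have : IsProbabilityMeasure (μ.map Z) := Measure.isProbabilityMeasure_map hZ.aemeasurable
  rw [indepFun_iff_map_prod_eq_prod_map_map hX.aemeasurable (hY.prodMk hZ).aemeasurable, hYZ,
    ← Measure.prodAssoc_prod, ← hXYZ, Measure.map_map MeasurableEquiv.prodAssoc.measurable
      ((hX.prodMk hY).prodMk hZ)]
  rfl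

variable {X : Type*} [MeasurableSpace X] {μ : Measure X} [IsProbabilityMeasure μ]

/-- One step of the exponential drift argument. `L` and `L'` are successive values of a quadratic
Lyapunov function; `R` is the random part of the increment, whose conditional mean given `L` is at
most `-η (√(2L) - σ)`. -/
theorem integral_exp_sqrt_step_le {L L' R : X → ℝ} {β κ η σ D B c lam : ℝ} (hL : Measurable L)
    (hL' : Measurable L') (hR : Measurable R) (hL0 : ∀ x, 0 ≤ L x) (hLc : ∀ x, L x ≤ c)
    (hL'0 : ∀ x, 0 ≤ L' x) (hL'c : ∀ x, L' x ≤ c) (hβ : 0 ≤ β) (hκ : 0 ≤ κ) (hη : 0 < η)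
    (hσ : 0 < σ) (hD : D = κ + η) (hB : B = 2 / η * (β + η * σ)) (hlam : lam = η / (4 * D ^ 2))
    (hstep : ∀ x, L' x ≤ L x + (β + R x)) (hRb : ∀ x, |R x| ≤ κ * √(2 * L x))
    (hdrift : ∀ F : ℝ → ℝ, Measurable F → (∀ z, 0 ≤ F z) → (∃ C, ∀ x, F (L x) ≤ C) →
      ∫ x, F (L x) * R x ∂μ ≤ -η * ∫ x, F (L x) * (√(2 * L x) - σ) ∂μ) :
    ∫ x, Real.exp (lam * √(2 * L' x)) ∂μ ≤
      (1 - lam * η / 4) * ∫ x, Real.exp (lam * √(2 * L x)) ∂μ + Real.exp (lam * (B + D)) := by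
  have hD0 : 0 < D := by linarith
  have hlam0 : 0 < lam := by rw [hlam]; positivity
  have hB0 : 0 < B := by rw [hB]; positivity
  have hηB : η * B = 2 * (β + η * σ) := by rw [hB]; field_simp
  have hlamD : lam * D ^ 2 = η / 4 := by rw [hlam]; field_simp
  have hlamD1 : lam * D ≤ 1 := by
    have h1 : lam * D * D ≤ 1 * D := by nlinarith
    exact le_of_mul_le_mul_right h1 hD0
  have hηD : η ≤ D := by linarith
  have hlamη : lam * η ≤ 1 := (mul_le_mul_of_nonneg_left hηD hlam0.le).trans hlamD1
  set Z : X → ℝ := fun x => √(2 * L x) with hZ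
  have hZ0 : ∀ x, 0 ≤ Z x := fun x => Real.sqrt_nonneg _
  have hZsq : ∀ x, Z x ^ 2 = 2 * L x := fun x => Real.sq_sqrt (by linarith [hL0 x])
  have hZc : ∀ x, Z x ≤ √(2 * c) := fun x => Real.sqrt_le_sqrt (by linarith [hLc x])
  have hZm : Measurable Z := (hL.const_mul 2).sqrt
  -- `G` is the exponential of λ√(2L) restricted to √(2L) ≥ B. Dividing by √(2L) gives the weight
  -- `F`, which converts the increment β + R of L into an increment of √(2L).
  set G : ℝ → ℝ := fun z => (Set.Ici B).indicator (fun _ => (1 : ℝ)) (√(2 * z)) *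
    Real.exp (lam * √(2 * z)) with hG
  set F : ℝ → ℝ := fun z => G z / √(2 * z) with hF
  have hsm : Measurable fun z : ℝ => √(2 * z) := (measurable_id.const_mul 2).sqrt
  have hGm : Measurable G :=
    ((measurable_const.indicator measurableSet_Ici).comp hsm).mul (hsm.const_mul lam).exp
  have hFm : Measurable F := hGm.div hsm
  have hind0 : ∀ z, 0 ≤ (Set.Ici B).indicator (fun _ => (1 : ℝ)) z := fun z =>
    Set.indicator_nonneg (fun _ _ => zero_le_one) z
  have hG0 : ∀ z, 0 ≤ G z := fun z => mul_nonneg (hind0 _) (Real.exp_pos _).le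
  have hF0 : ∀ z, 0 ≤ F z := fun z => div_nonneg (hG0 z) (Real.sqrt_nonneg _)
  have hGbig : ∀ x, B ≤ Z x → G (L x) = Real.exp (lam * Z x) := fun x hx => by
    simp only [hG]
    rw [Set.indicator_of_mem (s := Set.Ici B) hx, one_mul]
  have hGsmall : ∀ x, Z x < B → G (L x) = 0 := fun x hx => by
    simp only [hG]
    rw [Set.indicator_of_notMem (s := Set.Ici B) (not_le.2 hx), zero_mul]
  have hGexp : ∀ x, G (L x) ≤ Real.exp (lam * Z x) := fun x => by
    rcases le_or_gt B (Z x) with h | h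
    · exact (hGbig x h).le
    · rw [hGsmall x h]; exact (Real.exp_pos _).le
  have hexpc : ∀ x, Real.exp (lam * Z x) ≤ Real.exp (lam * √(2 * c)) := fun x =>
    Real.exp_le_exp.2 (mul_le_mul_of_nonneg_left (hZc x) hlam0.le)
  have hFZ : ∀ x, F (L x) * Z x = G (L x) := fun x => by
    rcases le_or_gt B (Z x) with h | h
    · exact div_mul_cancel₀ _ (hB0.trans_le h).ne'
    · simp only [hF]; rw [hGsmall x h]; simp
  have hFc : ∀ x, F (L x) ≤ Real.exp (lam * √(2 * c)) / B := fun x => by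
    rcases le_or_gt B (Z x) with h | h
    · exact div_le_div₀ (Real.exp_pos _).le ((hGexp x).trans (hexpc x)) hB0 h
    · simp only [hF]; rw [hGsmall x h, zero_div]; positivity
  -- the pathwise inequality
  have hpath : ∀ x, Real.exp (lam * √(2 * L' x)) ≤
      G (L x) * (1 + lam ^ 2 * D ^ 2) + lam * (β * F (L x) + F (L x) * R x) +
        Real.exp (lam * (B + D)) := fun x => by
    have hR1 := abs_le.1 (hRb x)
    have hst := hstep x
    have hzz := hZsq x
    change _ ∧ R x ≤ κ * Z x at hR1
    rcases le_or_gt B (Z x) with h | h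
    · have hz : 0 < Z x := hB0.trans_le h
      -- By concavity of the square root, √(2L') exceeds Z = √(2L) by at most y. Above the threshold
      -- β ≤ ηZ, so |y| ≤ κ + η = D.
      set y : ℝ := (β + R x) / Z x with hy
      have hyz : y * Z x = β + R x := div_mul_cancel₀ _ hz.ne'
      have hyD : |y| ≤ D := by
        have hβz : β ≤ η * Z x := by nlinarith
        rw [hy, abs_div, abs_of_pos hz, div_le_iff₀ hz, abs_le, hD]
        constructor
        · nlinarith [hR1.1]
        · nlinarith [hR1.2]
      have hle : √(2 * L' x) ≤ Z x + y := by
        have h0 := hL'0 x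
        have hzy : 0 ≤ Z x + y := by
          have : 0 ≤ Z x * (Z x + 2 * y) := by nlinarith
          have := nonneg_of_mul_nonneg_right this hz
          linarith
        refine Real.sqrt_le_iff.2 ⟨hzy, ?_⟩
        nlinarith [sq_nonneg y]
      have hly : |lam * y| ≤ 1 := by
        rw [abs_mul, abs_of_pos hlam0]
        exact (mul_le_mul_of_nonneg_left hyD hlam0.le).trans hlamD1
      have hexp := (abs_le.1 (Real.abs_exp_sub_one_sub_id_le hly)).2
      have hy2 : (lam * y) ^ 2 ≤ lam ^ 2 * D ^ 2 := by
        rw [mul_pow]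
        refine mul_le_mul_of_nonneg_left ?_ (sq_nonneg _)
        rw [← sq_abs y]
        exact pow_le_pow_left₀ (abs_nonneg _) hyD 2
      have hFy : β * F (L x) + F (L x) * R x = G (L x) * y := by
        rw [← hFZ x]
        linear_combination -F (L x) * hyz
      rw [hFy]
      have hGp := hG0 (L x)
      calc Real.exp (lam * √(2 * L' x)) ≤ Real.exp (lam * Z x + lam * y) := by
            rw [← mul_add]
            exact Real.exp_le_exp.2 (mul_le_mul_of_nonneg_left hle hlam0.le)
        _ = G (L x) * Real.exp (lam * y) := by rw [Real.exp_add, hGbig x h]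
        _ ≤ G (L x) * (1 + lam * y + lam ^ 2 * D ^ 2) :=
            mul_le_mul_of_nonneg_left (by linarith) hGp
        _ ≤ _ := by nlinarith [(Real.exp_pos (lam * (B + D))).le]
    · have hG' := hGsmall x h
      have hF' : F (L x) = 0 := by simp only [hF]; rw [hG', zero_div]
      rw [hG', hF']
      simp only [zero_mul, mul_zero, zero_add, add_zero]
      refine Real.exp_le_exp.2 (mul_le_mul_of_nonneg_left ?_ hlam0.le)
      -- Below the threshold, 2L' ≤ Z² + 2β + 2κZ ≤ B² + 2DB.
      refine Real.sqrt_le_iff.2 ⟨by linarith, ?_⟩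
      have h1 : κ * Z x ≤ κ * B := mul_le_mul_of_nonneg_left h.le hκ
      have h2 : Z x ^ 2 ≤ B ^ 2 := pow_le_pow_left₀ (hZ0 x) h.le 2
      have h3 : 2 * β ≤ η * B := by nlinarith
      rw [hD]
      nlinarith [sq_nonneg (κ + η), hR1.2, mul_pos hη hB0]
  -- integration
  have hint : ∀ {h : X → ℝ} {C : ℝ}, Measurable h → (∀ x, |h x| ≤ C) → Integrable h μ :=
    fun hm hC => integrable_of_measurable_of_abs_le hm hC
  have hF1 : Integrable (fun x => F (L x)) μ :=
    hint (hFm.comp hL) fun x => by rw [abs_of_nonneg (hF0 _)]; exact hFc x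
  have hGi : Integrable (fun x => G (L x)) μ := hint (hGm.comp hL) fun x => by
    rw [abs_of_nonneg (hG0 _)]; exact (hGexp x).trans (hexpc x)
  have hEi : Integrable (fun x => Real.exp (lam * Z x)) μ := hint (hZm.const_mul lam).exp fun x => by
    rw [abs_of_pos (Real.exp_pos _)]; exact hexpc x
  have hE'i : Integrable (fun x => Real.exp (lam * √(2 * L' x))) μ :=
    hint (((hL'.const_mul 2).sqrt).const_mul lam).exp (C := Real.exp (lam * √(2 * c))) fun x => by
      rw [abs_of_pos (Real.exp_pos _)]
      exact Real.exp_le_exp.2 (mul_le_mul_of_nonneg_left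
        (Real.sqrt_le_sqrt (by linarith [hL'c x])) hlam0.le)
  have hFR : Integrable (fun x => F (L x) * R x) μ :=
    hint ((hFm.comp hL).mul hR) (C := Real.exp (lam * √(2 * c)) / B * (κ * √(2 * c))) fun x => by
      rw [abs_mul, abs_of_nonneg (hF0 _)]
      exact mul_le_mul (hFc x) ((hRb x).trans (mul_le_mul_of_nonneg_left (hZc x) hκ))
        (abs_nonneg _) (by positivity)
  have hdr := hdrift F hFm hF0 ⟨_, hFc⟩
  have hFZi : ∫ x, F (L x) * (√(2 * L x) - σ) ∂μ = ∫ x, G (L x) ∂μ - σ * ∫ x, F (L x) ∂μ := by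
    rw [← integral_const_mul, ← integral_sub hGi (hF1.const_mul σ)]
    refine integral_congr_ae (Filter.Eventually.of_forall fun x => ?_)
    have := hFZ x
    simp only [hZ] at this
    linear_combination this
  have hBF : B * ∫ x, F (L x) ∂μ ≤ ∫ x, G (L x) ∂μ := by
    rw [← integral_const_mul]
    refine integral_mono (hF1.const_mul B) hGi fun x => ?_
    rw [← hFZ x]
    rcases le_or_gt B (Z x) with h | h
    · change B * F (L x) ≤ F (L x) * Z x
      nlinarith [hF0 (L x)]
    · have hF' : F (L x) = 0 := by simp only [hF]; rw [hGsmall x h, zero_div]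
      simp [hF']
  have hGE : ∫ x, G (L x) ∂μ ≤ ∫ x, Real.exp (lam * Z x) ∂μ := integral_mono hGi hEi hGexp
  have hGi' : Integrable (fun x => G (L x) * (1 + lam ^ 2 * D ^ 2)) μ := hGi.mul_const _
  have hFR' : Integrable (fun x => β * F (L x) + F (L x) * R x) μ := (hF1.const_mul β).add hFR
  have hFR'' : Integrable (fun x => lam * (β * F (L x) + F (L x) * R x)) μ := hFR'.const_mul lam
  have hsum : Integrable
      (fun x => G (L x) * (1 + lam ^ 2 * D ^ 2) + lam * (β * F (L x) + F (L x) * R x)) μ :=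
    hGi'.add hFR''
  have hsum' : Integrable (fun x => G (L x) * (1 + lam ^ 2 * D ^ 2) +
      lam * (β * F (L x) + F (L x) * R x) + Real.exp (lam * (B + D))) μ :=
    hsum.add (integrable_const _)
  refine (integral_mono hE'i hsum' hpath).trans ?_
  rw [integral_add hsum (integrable_const _), integral_add hGi' hFR'', integral_mul_const,
    integral_const_mul, integral_add (hF1.const_mul β) hFR, integral_const_mul, integral_const,
    probReal_univ, one_smul]
  rw [hFZi] at hdr
  set g := ∫ x, G (L x) ∂μ
  set φ := ∫ x, F (L x) ∂μ
  -- The threshold B makes (β + ησ)F integrate to at most (η/2)G, so half of the drift η survives.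
  -- With λ = η/(4D²) the quadratic term λ²D² = λη/4 uses half of the rest, leaving the factor 1 −
  -- λη/4.
  have hkey : β * φ + ∫ x, F (L x) * R x ∂μ ≤ -(η / 2) * g := by
    have h1 : (β + η * σ) * φ = η / 2 * (B * φ) := by linear_combination (-φ / 2) * hηB
    have h2 := mul_le_mul_of_nonneg_left hBF (half_pos hη).le
    linarith
  have h1 := mul_le_mul_of_nonneg_left hkey hlam0.le
  have h2 : lam ^ 2 * D ^ 2 = lam * η / 4 := by rw [pow_two, mul_assoc, hlamD]; ring
  have h3 : (1 - lam * η / 4) * g ≤ (1 - lam * η / 4) * ∫ x, Real.exp (lam * Z x) ∂μ :=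
    mul_le_mul_of_nonneg_left hGE (by linarith)
  rw [h2]
  simp only [hZ] at h3
  linarith

/-- A nonnegative process whose exponential moments contract as in `integral_exp_sqrt_step_le` has
bounded first moments. -/
theorem integral_le_of_exp_step {Z : ℕ → X → ℝ} {η D B lam : ℝ} (hη : 0 < η) (hηD : η ≤ D)
    (hlam : lam = η / (4 * D ^ 2)) (h0 : ∀ x, Z 0 x ≤ B) (hZm : ∀ t, Measurable (Z t))
    (hZ0 : ∀ t x, 0 ≤ Z t x) (hZc : ∀ t, ∃ c, ∀ x, Z t x ≤ c)
    (hstep : ∀ t, ∫ x, Real.exp (lam * Z (t + 1) x) ∂μ ≤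
      (1 - lam * η / 4) * ∫ x, Real.exp (lam * Z t x) ∂μ + Real.exp (lam * (B + D))) (t : ℕ) :
    ∫ x, Z t x ∂μ ≤ B + D + 32 * D ^ 3 / η ^ 2 := by
  have hD0 : 0 < D := by linarith
  have hlam0 : 0 < lam := by rw [hlam]; positivity
  have hlamη : lam * η / 4 = (η / (4 * D)) ^ 2 := by rw [hlam]; field_simp
  have hle1 : lam * η / 4 ≤ 1 := by
    rw [hlamη]
    refine pow_le_one₀ (by positivity) ?_
    rw [div_le_one (by positivity)]
    linarith
  have hEi : ∀ t, Integrable (fun x => Real.exp (lam * Z t x)) μ := fun t => by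
    obtain ⟨c, hc⟩ := hZc t
    refine integrable_of_measurable_of_abs_le ((hZm t).const_mul lam).exp
      (B := Real.exp (lam * c)) fun x => ?_
    rw [abs_of_pos (Real.exp_pos _)]
    exact Real.exp_le_exp.2 (mul_le_mul_of_nonneg_left (hc x) hlam0.le)
  have hZi : Integrable (Z t) μ := by
    obtain ⟨c, hc⟩ := hZc t
    exact integrable_of_measurable_of_abs_le (hZm t) fun x => by
      rw [abs_of_nonneg (hZ0 t x)]; exact hc x
  -- The level exp(e) is preserved by the recursion: λη/4 = (η/(4D))², and (4D/η)² ≤ exp(8D/η).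
  -- Dividing e by λ turns the second summand into 32D³/η².
  set e : ℝ := lam * (B + D) + 8 * D / η with he
  have hfix : Real.exp (lam * (B + D)) ≤ lam * η / 4 * Real.exp e := by
    rw [he, Real.exp_add]
    have hy : 4 * D / η ≤ Real.exp (4 * D / η) := by
      linarith [Real.add_one_le_exp (4 * D / η)]
    have hy2 : (4 * D / η) ^ 2 ≤ Real.exp (8 * D / η) := by
      have : Real.exp (8 * D / η) = Real.exp (4 * D / η) ^ 2 := by
        rw [← Real.exp_nat_mul]
        congr 1
        push_cast
        ring
      rw [this]
      exact pow_le_pow_left₀ (by positivity) hy 2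
    have h1 : 1 ≤ lam * η / 4 * Real.exp (8 * D / η) := by
      have h2 : lam * η / 4 * (4 * D / η) ^ 2 = 1 := by rw [hlamη]; field_simp
      rw [← h2]
      exact mul_le_mul_of_nonneg_left hy2 (by positivity)
    nlinarith [Real.exp_pos (lam * (B + D))]
  have hmom : ∀ t, ∫ x, Real.exp (lam * Z t x) ∂μ ≤ Real.exp e := by
    intro t
    induction t with
    | zero =>
      have hle : ∀ x, Real.exp (lam * Z 0 x) ≤ Real.exp e := fun x => by
        refine Real.exp_le_exp.2 ?_
        have h1 := mul_le_mul_of_nonneg_left (h0 x) hlam0.le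
        have h2 : 0 ≤ 8 * D / η := by positivity
        have h3 : 0 ≤ lam * D := by positivity
        rw [he, mul_add]
        linarith
      calc _ ≤ ∫ _, Real.exp e ∂μ := integral_mono (hEi 0) (integrable_const _) hle
        _ = Real.exp e := by simp
    | succ t ih =>
      have h1 := mul_le_mul_of_nonneg_left ih (sub_nonneg.2 hle1)
      linarith [hstep t]
  -- Jensen's inequality, by way of the tangent line of exp at e.
  have hlow : Real.exp e * (1 + (lam * ∫ x, Z t x ∂μ - e)) ≤ Real.exp e := by
    have hi1 : Integrable (fun x => lam * Z t x - e) μ :=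
      (hZi.const_mul lam).sub (integrable_const e)
    have hi2 : Integrable (fun x => 1 + (lam * Z t x - e)) μ := (integrable_const 1).add hi1
    have h1 : ∫ x, Real.exp e * (1 + (lam * Z t x - e)) ∂μ =
        Real.exp e * (1 + (lam * ∫ x, Z t x ∂μ - e)) := by
      rw [integral_const_mul, integral_add (integrable_const _) hi1,
        integral_sub (hZi.const_mul lam) (integrable_const _), integral_const_mul]
      simp
    rw [← h1]
    refine (integral_mono (hi2.const_mul _) (hEi t) fun x => ?_).trans (hmom t)
    change Real.exp e * (1 + (lam * Z t x - e)) ≤ Real.exp (lam * Z t x)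
    have h2 : Real.exp (lam * Z t x) = Real.exp e * Real.exp (lam * Z t x - e) := by
      rw [← Real.exp_add]
      congr 1
      ring
    rw [h2]
    refine mul_le_mul_of_nonneg_left ?_ (Real.exp_pos e).le
    linarith [Real.add_one_le_exp (lam * Z t x - e)]
  have hfin : lam * ∫ x, Z t x ∂μ ≤ e := by
    by_contra! h
    nlinarith [Real.exp_pos e]
  have he' : e = lam * (B + D + 32 * D ^ 3 / η ^ 2) := by
    rw [he, hlam]
    field_simp
    ring
  rw [he'] at hfin
  exact le_of_mul_le_mul_left hfin hlam0

end ExponentialMoments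

/-! ### Drift of queues and iterates in expectation. -/

namespace Model

variable {K m : ℕ} {S A : Fin K → Type*} [∀ k, Fintype (S k)] [∀ k, Fintype (A k)]
  {E : Type*} [MeasurableSpace E] {M : Model K m S A E}

/-- The constraint noise of slot `t` is independent of the constraint noise of earlier slots and of
the whole penalty noise. -/
theorem indepFun_present_past (M : Model K m S A E) (t : ℕ) :
    IndepFun (fun x : EnvPath E => x.1 t)
      (fun x => ((fun j : Finset.range t => x.1 j), x.2)) M.ν := by
  have hν : IsProbabilityMeasure M.ν := M.isProb
  have hcoord : ∀ j : ℕ, Measurable fun x : EnvPath E => x.1 j := fun j =>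
    (measurable_pi_apply j).comp measurable_fst
  have hpast : Measurable fun x : EnvPath E => (fun j : Finset.range t => x.1 j) :=
    measurable_pi_iff.2 fun j => hcoord j
  refine indepFun_prodMk_of_indepFun (hcoord t) hpast measurable_snd ?_ ?_
  · have h := M.indep_omega.indepFun_finset {t} (Finset.range t) (by simp) hcoord
    exact h.comp (φ := fun z : ({t} : Finset ℕ) → E => z ⟨t, Finset.mem_singleton_self t⟩)
      (measurable_pi_apply _) measurable_id
  · exact M.indep_omega_mu.comp
      (φ := fun z : ℕ → E => (z t, fun j : Finset.range t => z j))
      ((measurable_pi_apply t).prodMk (measurable_pi_iff.2 fun j => measurable_pi_apply _))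
      measurable_id

theorem measurable_constraintAt (t : ℕ) (i : Fin m) (φ : ∀ k, S k → A k → ℝ) :
    Measurable fun x : EnvPath E => M.constraintAt x t i φ :=
  Finset.measurable_sum _ fun k _ => IsAlgorithmRun.measurable_pairing
    (fun s a => IsAlgorithmRun.measurable_g i k s a t) fun _ _ => measurable_const

theorem integral_mul_constraintAt {t : ℕ} {W : EnvPath E → ℝ} (hW : Measurable W)
    (hdep : ∀ x x' : EnvPath E, (∀ j < t, x.1 j = x'.1 j) → x.2 = x'.2 → W x = W x') (i : Fin m)
    (φ : ∀ k, S k → A k → ℝ) :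
    ∫ x, W x * M.constraintAt x t i φ ∂M.ν =
      (∫ x, W x ∂M.ν) * ∫ x, M.constraintAt x t i φ ∂M.ν := by
  have hν : IsProbabilityMeasure M.ν := M.isProb
  obtain ⟨x₀⟩ : Nonempty (EnvPath E) := Measure.nonempty_of_neZero M.ν
  -- Replacing the present and future of ω by a fixed path exhibits `W` as a function of past ω and
  -- all of μ. All of μ is allowed, since ω is independent of the whole sequence.
  set W' : (Finset.range t → E) × (ℕ → E) → ℝ := fun z =>
    W (fun j => if h : j < t then z.1 ⟨j, Finset.mem_range.2 h⟩ else x₀.1 j, z.2) with hW'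
  have hW'm : Measurable W' := by
    refine hW.comp (Measurable.prodMk (measurable_pi_iff.2 fun j => ?_) measurable_snd)
    by_cases h : j < t
    · simp only [h, dif_pos]
      exact (measurable_pi_apply _).comp measurable_fst
    · simp only [h, dif_neg, not_false_eq_true]
      exact measurable_const
  have hWeq : ∀ x : EnvPath E, W x = W' ((fun j : Finset.range t => x.1 j), x.2) := fun x =>
    hdep _ _ (fun j hj => by simp [hj]) rfl
  set H : E → ℝ := fun e => ∑ k, ∑ s, ∑ a, M.ghat i k s a e * φ k s a with hH
  have hHm : Measurable H := Finset.measurable_sum _ fun k _ => Finset.measurable_sum _ fun s _ =>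
    Finset.measurable_sum _ fun a _ => (M.measurable_ghat i k s a).mul_const _
  have hind := ((M.indepFun_present_past t).comp hHm hW'm).symm
  have h := hind.integral_fun_mul_eq_mul_integral
    (hW'm.comp (Measurable.prodMk (measurable_pi_iff.2 fun j =>
      (measurable_pi_apply _).comp measurable_fst) measurable_snd)).aestronglyMeasurable
    (hHm.comp ((measurable_pi_apply t).comp measurable_fst)).aestronglyMeasurable
  simp only [Function.comp_apply, ← hWeq] at h
  exact h

theorem integral_constraintAt_eq (t : ℕ) (i : Fin m) (φ : ∀ k, S k → A k → ℝ) :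
    ∫ x, M.constraintAt x t i φ ∂M.ν = ∫ x, M.constraintAt x 0 i φ ∂M.ν := by
  have hHm : Measurable fun e => ∑ k, ∑ s, ∑ a, M.ghat i k s a e * φ k s a :=
    Finset.measurable_sum _ fun k _ => Finset.measurable_sum _ fun s _ =>
      Finset.measurable_sum _ fun a _ => (M.measurable_ghat i k s a).mul_const _
  exact ((M.ident_omega t).comp hHm).integral_eq

/-- The Slater policy is used only through the marginals of its stationary state-action law, which
are valid reference vectors for the drift inequality. -/
theorem Slater.exists_vectors {η : ℝ} (h : M.Slater η) :
    ∃ φ : ∀ k, S k → A k → ℝ, (∀ k, φ k ∈ stateActionPolyhedron (M.P k)) ∧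
      ∀ (i : Fin m) (t : ℕ), ∫ x, M.constraintAt x t i φ ∂M.ν ≤ -η := by
  classical
  obtain ⟨π, d, hπ, hd, hle⟩ := h
  have hpol : IsPolicy (separable π) := fun s => prod_mem_stdSimplex fun k => hπ k (s k)
  refine ⟨stateActionMarginal d (separable π), M.stateActionMarginal_mem hpol hd, fun i t => ?_⟩
  refine le_trans (le_of_eq ?_) (hle i t)
  refine integral_congr_ae (Filter.Eventually.of_forall fun x => ?_)
  exact sum_pairing_stateActionMarginal d (separable π) fun k => M.g x t i k

/-- The Lyapunov function of the algorithm relative to the state-action vectors `φ`. -/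
def lyapunov (α : ℝ) (φ : ∀ k, S k → A k → ℝ) (θ : ℕ → ∀ k, S k → A k → ℝ) (Q : ℕ → Fin m → ℝ)
    (t : ℕ) : ℝ :=
  (∑ i, Q (t + 1) i ^ 2) / 2 + α * ∑ k, sqNorm (φ k - θ t k)

namespace IsAlgorithmRun

section Path

variable {V α Ψ : ℝ} {θ₀ φ : ∀ k, S k → A k → ℝ} {x : EnvPath E} {θ : ℕ → ∀ k, S k → A k → ℝ}
  {Q : ℕ → Fin m → ℝ}

theorem sum_sqNorm_nonneg (θ : ∀ k, S k → A k → ℝ) : 0 ≤ ∑ k, sqNorm (θ k) :=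
  Finset.sum_nonneg fun _ _ => sqNorm_nonneg _

theorem sum_sqNorm_sub_le (run : M.IsAlgorithmRun V α θ₀ x θ Q)
    (hθ₀ : ∀ k, θ₀ k ∈ stateActionPolyhedron (M.P k))
    (hφ : ∀ k, φ k ∈ stateActionPolyhedron (M.P k)) (t : ℕ) :
    ∑ k, sqNorm (φ k - θ t k) ≤ 2 * K := by
  refine (Finset.sum_le_sum fun k _ => sqNorm_sub_le_two (hφ k) (run.mem hθ₀ t k)).trans ?_
  simp [mul_comm]

theorem lyapunov_zero_le (run : M.IsAlgorithmRun V α θ₀ x θ Q) (hα : 0 < α)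
    (hθ₀ : ∀ k, θ₀ k ∈ stateActionPolyhedron (M.P k))
    (hφ : ∀ k, φ k ∈ stateActionPolyhedron (M.P k)) : lyapunov α φ θ Q 0 ≤ 2 * α * K := by
  have h := mul_le_mul_of_nonneg_left (run.sum_sqNorm_sub_le hθ₀ hφ 0) hα.le
  simp only [lyapunov, zero_add, run.queue_one]
  simp only [ne_eq, OfNat.ofNat_ne_zero, not_false_eq_true, zero_pow, Finset.sum_const_zero,
    zero_div, zero_add]
  linarith

theorem lyapunov_nonneg (hα : 0 < α) (t : ℕ) : 0 ≤ lyapunov α φ θ Q t :=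
  add_nonneg (div_nonneg (Finset.sum_nonneg fun _ _ => sq_nonneg _) zero_le_two)
    (mul_nonneg hα.le (sum_sqNorm_nonneg fun k => φ k - θ t k))

theorem lyapunov_le (run : M.IsAlgorithmRun V α θ₀ x θ Q) (hM : M.BoundedBy Ψ) (hΨ : 0 ≤ Ψ)
    (hα : 0 < α) (hθ₀ : ∀ k, θ₀ k ∈ stateActionPolyhedron (M.P k))
    (hφ : ∀ k, φ k ∈ stateActionPolyhedron (M.P k)) {t n : ℕ} (htn : t ≤ n) :
    lyapunov α φ θ Q t ≤ m * (n * (K * Ψ)) ^ 2 / 2 + 2 * α * K := by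
  have h := mul_le_mul_of_nonneg_left (run.sum_sqNorm_sub_le hθ₀ hφ t) hα.le
  have hq : ∑ i, Q (t + 1) i ^ 2 ≤ ∑ _i : Fin m, (n * (K * Ψ)) ^ 2 :=
    Finset.sum_le_sum fun i _ => by
      refine pow_le_pow_left₀ (run.queue_nonneg _ i) ((run.queue_le hM hΨ t i).trans ?_) 2
      have : (t : ℝ) ≤ n := by exact_mod_cast htn
      exact mul_le_mul_of_nonneg_right this (by positivity)
  simp only [Finset.sum_const, Finset.card_univ, Fintype.card_fin, nsmul_eq_mul] at hq
  unfold lyapunov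
  linarith

/-- For queue bounds the penalties are mere disturbance: the two of them cost at most 2VKΨ, and the
proximal movement is dropped. -/
theorem lyapunov_succ_le (run : M.IsAlgorithmRun V α θ₀ x θ Q) (hM : M.BoundedBy Ψ) (hV : 0 ≤ V)
    (hα : 0 < α) (hφ : ∀ k, φ k ∈ stateActionPolyhedron (M.P k)) (t : ℕ) :
    lyapunov α φ θ Q (t + 1) ≤ lyapunov α φ θ Q t +
      ((2 * V * (K * Ψ) + m * (K * Ψ) ^ 2 / 2) + ∑ i, Q (t + 1) i * M.constraintAt x t i φ) := by
  have h := run.drift_le hM hφ t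
  have h1 := mul_le_mul_of_nonneg_left (abs_le.1 (hM.abs_penaltyAt_le (run.theta_mem t) x t)).1 hV
  have h2 := mul_le_mul_of_nonneg_left (abs_le.1 (hM.abs_penaltyAt_le hφ x t)).2 hV
  have h3 := mul_nonneg hα.le (sum_sqNorm_nonneg fun k => θ (t + 1) k - θ t k)
  unfold lyapunov
  linarith

/-- One step of the regret analysis. -/
theorem penaltyAt_add_lyapunov_le (run : M.IsAlgorithmRun V α θ₀ x θ Q) (hM : M.BoundedBy Ψ)
    (hV : 0 ≤ V) (hα : 0 < α) (hφ : ∀ k, φ k ∈ stateActionPolyhedron (M.P k)) (t : ℕ) :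
    V * (M.penaltyAt x t (θ t) - M.penaltyAt x t φ) + lyapunov α φ θ Q (t + 1) ≤
      lyapunov α φ θ Q t + (m * (K * Ψ) ^ 2 / 2 + V ^ 2 * Ψ ^ 2 *
        (∑ k, (Fintype.card (A k) : ℝ) * Fintype.card (S k)) / (4 * α)) +
        ∑ i, Q (t + 1) i * M.constraintAt x t i φ := by
  have h := run.drift_le hM hφ t
  -- Slot t is charged at θ_t, whereas the drift inequality concerns θ_{t+1}. By Young's inequality
  -- the difference is paid for by the retained term α‖θ_{t+1} − θ_t‖², leaving V²Ψ²|A||S|/(4α).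
  have hk : ∀ k, V * (pairing (M.f x t k) (θ t k) - pairing (M.f x t k) (θ (t + 1) k)) ≤
      α * sqNorm (θ (t + 1) k - θ t k) +
        V ^ 2 * Ψ ^ 2 * ((Fintype.card (A k) : ℝ) * Fintype.card (S k)) / (4 * α) := fun k => by
    set n : ℝ := (Fintype.card (A k) : ℝ) * Fintype.card (S k)
    have hn : 0 ≤ n := by positivity
    set e := entryNorm (θ t k - θ (t + 1) k)
    set q := sqNorm (θ (t + 1) k - θ t k)
    have hq : sqNorm (θ t k - θ (t + 1) k) = q := by
      simp only [q, sqNorm, Pi.sub_apply, sub_sq_comm]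
    have he : e ^ 2 ≤ n * q := by rw [← hq]; exact entryNorm_sq_le _
    have hq0 : 0 ≤ q := sqNorm_nonneg _
    have hp := (le_abs_self _).trans
      (abs_pairing_le (fun s a => hM.1 k s a (x.2 t)) (θ t k - θ (t + 1) k))
    rw [pairing_sub] at hp
    refine (mul_le_mul_of_nonneg_left hp hV).trans ?_
    rcases hn.eq_or_lt with hn0 | hn0
    · have he0 : e = 0 := by
        rw [← hn0, zero_mul] at he
        exact pow_eq_zero_iff two_ne_zero |>.1 (le_antisymm he (sq_nonneg _))
      change V * (Ψ * e) ≤ _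
      rw [he0]
      simp only [mul_zero]
      positivity
    · change V * (Ψ * e) ≤ _
      rw [← sub_le_iff_le_add', le_div_iff₀ (by positivity)]
      have h1 := sq_nonneg (2 * α * e - V * Ψ * n)
      have h2 : 4 * α ^ 2 * e ^ 2 ≤ 4 * α ^ 2 * (n * q) :=
        mul_le_mul_of_nonneg_left he (by positivity)
      have h3 : ((V * (Ψ * e) - α * q) * (4 * α)) * n ≤ (V ^ 2 * Ψ ^ 2 * n) * n := by nlinarith
      exact le_of_mul_le_mul_right h3 hn0
  have hsum := Finset.sum_le_sum fun k (_ : k ∈ Finset.univ) => hk k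
  simp only [← Finset.mul_sum, Finset.sum_sub_distrib, Finset.sum_add_distrib,
    ← Finset.sum_div] at hsum
  change V * (M.penaltyAt x t (θ t) - M.penaltyAt x t (θ (t + 1))) ≤ _ at hsum
  unfold lyapunov
  linarith

end Path

section Expectation

variable {V α Ψ : ℝ} {θ₀ φ : ∀ k, S k → A k → ℝ} {θ : EnvPath E → ℕ → ∀ k, S k → A k → ℝ}
  {Q : EnvPath E → ℕ → Fin m → ℝ}

theorem measurable_lyapunov (run : ∀ x, M.IsAlgorithmRun V α θ₀ x (θ x) (Q x)) (hα : 0 < α)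
    (t : ℕ) : Measurable fun x => lyapunov α φ (θ x) (Q x) t := by
  obtain ⟨hθ, hQ⟩ := measurable_iterates run hα t
  refine ((Finset.measurable_sum _ fun i _ => (hQ i).pow_const 2).div_const 2).add
    ((Finset.measurable_sum _ fun k _ => Finset.measurable_sum _ fun s _ =>
      Finset.measurable_sum _ fun a _ => ?_).const_mul α)
  exact (measurable_const.sub (hθ k s a)).pow_const 2

theorem integrable_queue (run : ∀ x, M.IsAlgorithmRun V α θ₀ x (θ x) (Q x)) (hM : M.BoundedBy Ψ)
    (hΨ : 0 ≤ Ψ) (hα : 0 < α) (t : ℕ) (i : Fin m) : Integrable (fun x => Q x (t + 1) i) M.ν := by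
  have hν : IsProbabilityMeasure M.ν := M.isProb
  refine integrable_of_measurable_of_abs_le (B := t * (K * Ψ))
    ((measurable_iterates run hα t).2 i) fun x => ?_
  rw [abs_of_nonneg ((run x).queue_nonneg _ i)]
  exact (run x).queue_le hM hΨ t i

theorem integrable_lyapunov (run : ∀ x, M.IsAlgorithmRun V α θ₀ x (θ x) (Q x))
    (hM : M.BoundedBy Ψ) (hΨ : 0 ≤ Ψ) (hα : 0 < α)
    (hθ₀ : ∀ k, θ₀ k ∈ stateActionPolyhedron (M.P k))
    (hφ : ∀ k, φ k ∈ stateActionPolyhedron (M.P k)) (t : ℕ) :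
    Integrable (fun x => lyapunov α φ (θ x) (Q x) t) M.ν := by
  have hν : IsProbabilityMeasure M.ν := M.isProb
  refine integrable_of_measurable_of_abs_le (B := m * (t * (K * Ψ)) ^ 2 / 2 + 2 * α * K)
    (measurable_lyapunov run hα t) fun x => ?_
  rw [abs_of_nonneg (lyapunov_nonneg hα t)]
  exact (run x).lyapunov_le hM hΨ hα hθ₀ hφ le_rfl

/-- The Lyapunov value and the queue are functions of ω before slot t and of μ, hence independent of
ω_t. The weight `F` is 1 for the summed drift and an exponential weight for the uniform queue bound.
-/
theorem integral_queue_mul_constraintAt (run : ∀ x, M.IsAlgorithmRun V α θ₀ x (θ x) (Q x))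
    (hM : M.BoundedBy Ψ) (hΨ : 0 ≤ Ψ) (hα : 0 < α)
    (hφ : ∀ k, φ k ∈ stateActionPolyhedron (M.P k)) {F : ℝ → ℝ} (hF : Measurable F) {t : ℕ} {C : ℝ}
    (hFC : ∀ x, |F (lyapunov α φ (θ x) (Q x) t)| ≤ C) (i : Fin m) :
    Integrable (fun x => F (lyapunov α φ (θ x) (Q x) t) * Q x (t + 1) i) M.ν ∧
    Integrable (fun x => F (lyapunov α φ (θ x) (Q x) t) *
      (Q x (t + 1) i * M.constraintAt x t i φ)) M.ν ∧
    ∫ x, F (lyapunov α φ (θ x) (Q x) t) * (Q x (t + 1) i * M.constraintAt x t i φ) ∂M.ν =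
      (∫ x, F (lyapunov α φ (θ x) (Q x) t) * Q x (t + 1) i ∂M.ν) *
        ∫ x, M.constraintAt x t i φ ∂M.ν := by
  have hν : IsProbabilityMeasure M.ν := M.isProb
  have hC0 : 0 ≤ C := by
    obtain ⟨x₀⟩ : Nonempty (EnvPath E) := Measure.nonempty_of_neZero M.ν
    exact (abs_nonneg _).trans (hFC x₀)
  have hWm : Measurable fun x => F (lyapunov α φ (θ x) (Q x) t) * Q x (t + 1) i :=
    (hF.comp (measurable_lyapunov run hα t)).mul ((measurable_iterates run hα t).2 i)
  have hWb : ∀ x, |F (lyapunov α φ (θ x) (Q x) t) * Q x (t + 1) i| ≤ C * (t * (K * Ψ)) :=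
    fun x => by
      rw [abs_mul, abs_of_nonneg ((run x).queue_nonneg _ i)]
      exact mul_le_mul (hFC x) ((run x).queue_le hM hΨ t i) ((run x).queue_nonneg _ i) hC0
  refine ⟨integrable_of_measurable_of_abs_le hWm hWb, ?_, ?_⟩
  · simp only [← mul_assoc]
    refine integrable_of_measurable_of_abs_le (B := C * (t * (K * Ψ)) * (K * Ψ))
      (hWm.mul (measurable_constraintAt t i φ)) fun x => ?_
    rw [abs_mul]
    exact mul_le_mul (hWb x) (hM.abs_constraintAt_le hφ x t i) (abs_nonneg _)
      (mul_nonneg hC0 (by positivity))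
  · simp only [← mul_assoc]
    refine integral_mul_constraintAt hWm (fun x x' h₁ h₂ => ?_) i φ
    obtain ⟨e₁, e₂⟩ := eq_of_agree run hα t h₁ fun j _ => by rw [h₂]
    simp only [lyapunov, e₁, e₂]

/-- Summed drift in expectation, against state-action vectors whose expected constraint values are
at most `γ`. -/
theorem sum_integral_le_of_step (run : ∀ x, M.IsAlgorithmRun V α θ₀ x (θ x) (Q x))
    (hM : M.BoundedBy Ψ) (hΨ : 0 ≤ Ψ) (hα : 0 < α)
    (hθ₀ : ∀ k, θ₀ k ∈ stateActionPolyhedron (M.P k))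
    (hφ : ∀ k, φ k ∈ stateActionPolyhedron (M.P k)) {γ : ℝ}
    (hγ : ∀ i t, ∫ x, M.constraintAt x t i φ ∂M.ν ≤ γ) {p : ℕ → EnvPath E → ℝ} {c : ℝ}
    (hp : ∀ t, Integrable (p t) M.ν)
    (hstep : ∀ t x, p t x + lyapunov α φ (θ x) (Q x) (t + 1) ≤
      lyapunov α φ (θ x) (Q x) t + c + ∑ i, Q x (t + 1) i * M.constraintAt x t i φ) (N : ℕ) :
    ∑ t ∈ Finset.range N, ∫ x, p t x ∂M.ν ≤
      2 * α * K + N * c + γ * ∑ t ∈ Finset.range N, ∑ i, ∫ x, Q x (t + 1) i ∂M.ν := by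
  have hν : IsProbabilityMeasure M.ν := M.isProb
  have hL := integrable_lyapunov run hM hΨ hα hθ₀ hφ
  have hone : ∀ t, ∫ x, p t x ∂M.ν + ∫ x, lyapunov α φ (θ x) (Q x) (t + 1) ∂M.ν ≤
      ∫ x, lyapunov α φ (θ x) (Q x) t ∂M.ν + c + γ * ∑ i, ∫ x, Q x (t + 1) i ∂M.ν := fun t => by
    have hqc := fun i => integral_queue_mul_constraintAt run hM hΨ hα hφ (F := fun _ => 1)
      measurable_const (t := t) (C := 1) (fun x => by simp) i
    simp only [one_mul] at hqc
    have hR : Integrable (fun x => ∑ i, Q x (t + 1) i * M.constraintAt x t i φ) M.ν :=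
      integrable_finsetSum _ fun i _ => (hqc i).2.1
    have hLc : Integrable (fun x => lyapunov α φ (θ x) (Q x) t + c) M.ν :=
      (hL t).add (integrable_const c)
    have h := integral_mono ((hp t).add (hL (t + 1))) (hLc.add hR) fun x => hstep t x
    simp only [Pi.add_apply] at h
    rw [integral_add (hp t) (hL (t + 1)), integral_add hLc hR,
      integral_add (hL t) (integrable_const c), integral_finsetSum _ fun i _ => (hqc i).2.1,
      integral_const, probReal_univ, one_smul] at h
    refine h.trans (add_le_add le_rfl ?_)
    rw [Finset.mul_sum]
    refine Finset.sum_le_sum fun i _ => ?_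
    rw [(hqc i).2.2, mul_comm]
    exact mul_le_mul_of_nonneg_right (hγ i t)
      (integral_nonneg fun x => (run x).queue_nonneg _ i)
  have hall : ∑ t ∈ Finset.range N, ∫ x, p t x ∂M.ν + ∫ x, lyapunov α φ (θ x) (Q x) N ∂M.ν ≤
      2 * α * K + N * c + γ * ∑ t ∈ Finset.range N, ∑ i, ∫ x, Q x (t + 1) i ∂M.ν := by
    induction N with
    | zero =>
      simp only [Finset.range_zero, Finset.sum_empty, zero_add, Nat.cast_zero, zero_mul, add_zero,
        mul_zero]
      calc _ ≤ ∫ _, 2 * α * K ∂M.ν := integral_mono (hL 0) (integrable_const _) fun x =>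
            (run x).lyapunov_zero_le hα hθ₀ hφ
        _ = 2 * α * K := by simp
    | succ N ih =>
      rw [Finset.sum_range_succ, Finset.sum_range_succ, mul_add]
      push_cast
      linarith [hone N]
  have hLN : 0 ≤ ∫ x, lyapunov α φ (θ x) (Q x) N ∂M.ν := integral_nonneg fun x => lyapunov_nonneg hα N
  linarith

/-- The expected queue lengths are of order `√T` on average. -/
theorem sum_integral_queue_le (run : ∀ x, M.IsAlgorithmRun V α θ₀ x (θ x) (Q x))
    (hM : M.BoundedBy Ψ) (hΨ : 0 ≤ Ψ) (hV : 0 ≤ V) (hα : 0 < α)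
    (hθ₀ : ∀ k, θ₀ k ∈ stateActionPolyhedron (M.P k)) {η : ℝ} (hS : M.Slater η) (N : ℕ) :
    η * ∑ t ∈ Finset.range N, ∑ i, ∫ x, Q x (t + 1) i ∂M.ν ≤
      2 * α * K + N * (2 * V * (K * Ψ) + m * (K * Ψ) ^ 2 / 2) := by
  obtain ⟨φ, hφ, hγ⟩ := hS.exists_vectors
  have h := sum_integral_le_of_step run hM hΨ hα hθ₀ hφ hγ (p := fun _ _ => 0)
    (c := 2 * V * (K * Ψ) + m * (K * Ψ) ^ 2 / 2) (fun _ => integrable_zero _ _ _)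
    (fun t x => by
      have := (run x).lyapunov_succ_le hM hV hα hφ t
      linarith) N
  simp only [integral_zero, Finset.sum_const_zero] at h
  linarith

/-- A bound on each expected queue length that is uniform in time. -/
theorem integral_queue_le (run : ∀ x, M.IsAlgorithmRun V α θ₀ x (θ x) (Q x))
    (hM : M.BoundedBy Ψ) (hΨ : 0 ≤ Ψ) (hV : 0 ≤ V) (hα : 0 < α) (hK : 1 ≤ K)
    (hθ₀ : ∀ k, θ₀ k ∈ stateActionPolyhedron (M.P k)) {η D : ℝ} (hη : 0 < η) (hS : M.Slater η)
    (hD : D = K * Ψ * √m + η) (t : ℕ) (i : Fin m) :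
    ∫ x, Q x (t + 1) i ∂M.ν ≤
      2 / η * ((2 * V * (K * Ψ) + m * (K * Ψ) ^ 2 / 2) + η * (2 * √(α * K))) + D +
        32 * D ^ 3 / η ^ 2 := by
  have hν : IsProbabilityMeasure M.ν := M.isProb
  obtain ⟨φ, hφ, hγ⟩ := hS.exists_vectors
  have hKpos : (0 : ℝ) < K := by exact_mod_cast hK
  set β : ℝ := 2 * V * (K * Ψ) + m * (K * Ψ) ^ 2 / 2 with hβ
  -- Since 2L ≤ (Σ_i Q_i)² + 4αK, the difference √(2L) − Σ_i Q_i is at most σ; the same σ bounds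
  -- √(2L) at time 0.
  set σ : ℝ := 2 * √(α * K) with hσ
  have hσ0 : 0 < σ := by positivity
  have hσ2 : σ ^ 2 = 4 * α * K := by
    rw [hσ, mul_pow, Real.sq_sqrt (by positivity)]; ring
  have hβ0 : 0 ≤ β := by positivity
  have hL0 := fun (t : ℕ) (x : EnvPath E) =>
    lyapunov_nonneg (φ := φ) (θ := θ x) (Q := Q x) hα t
  have hsq : ∀ t x, ∑ i, Q x (t + 1) i ^ 2 ≤ 2 * lyapunov α φ (θ x) (Q x) t := fun t x => by
    have := mul_nonneg hα.le (sum_sqNorm_nonneg fun k => φ k - θ x t k)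
    unfold lyapunov
    linarith
  have hQ0 := fun (t : ℕ) (x : EnvPath E) (i : Fin m) => (run x).queue_nonneg (t + 1) i
  have hstep : ∀ t, ∫ x, Real.exp (η / (4 * D ^ 2) * √(2 * lyapunov α φ (θ x) (Q x) (t + 1))) ∂M.ν ≤
      (1 - η / (4 * D ^ 2) * η / 4) *
        ∫ x, Real.exp (η / (4 * D ^ 2) * √(2 * lyapunov α φ (θ x) (Q x) t)) ∂M.ν +
        Real.exp (η / (4 * D ^ 2) * (2 / η * (β + η * σ) + D)) := fun t => by
    refine integral_exp_sqrt_step_le (R := fun x => ∑ i, Q x (t + 1) i * M.constraintAt x t i φ)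
      (κ := K * Ψ * √m) (c := m * ((t + 1 : ℕ) * (K * Ψ)) ^ 2 / 2 + 2 * α * K)
      (measurable_lyapunov run hα t) (measurable_lyapunov run hα (t + 1))
      (Finset.measurable_sum _ fun i _ =>
        ((measurable_iterates run hα t).2 i).mul (measurable_constraintAt t i φ))
      (hL0 t) (fun x => (run x).lyapunov_le hM hΨ hα hθ₀ hφ t.le_succ) (hL0 (t + 1))
      (fun x => (run x).lyapunov_le hM hΨ hα hθ₀ hφ le_rfl) hβ0 (by positivity) hη hσ0 hD rfl rfl
      (fun x => (run x).lyapunov_succ_le hM hV hα hφ t) (fun x => ?_)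
      fun F hF hF0 ⟨C, hC⟩ => ?_
    · have h1 : |∑ i, Q x (t + 1) i * M.constraintAt x t i φ| ≤ (∑ i, Q x (t + 1) i) * (K * Ψ) := by
        rw [Finset.sum_mul]
        refine (Finset.abs_sum_le_sum_abs _ _).trans (Finset.sum_le_sum fun i _ => ?_)
        rw [abs_mul, abs_of_nonneg (hQ0 t x i)]
        exact mul_le_mul_of_nonneg_left (hM.abs_constraintAt_le hφ x t i) (hQ0 t x i)
      -- Cauchy–Schwarz over the m queues. This √m, cubed in 32D³/η², is the source of the power
      -- m^{3/2}.
      have h2 : ∑ i, Q x (t + 1) i ≤ √m * √(2 * lyapunov α φ (θ x) (Q x) t) := by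
        rw [← Real.sqrt_mul (Nat.cast_nonneg m)]
        refine Real.le_sqrt_of_sq_le ?_
        have h3 := sq_sum_le_card_mul_sum_sq (s := (Finset.univ : Finset (Fin m)))
          (f := fun i => Q x (t + 1) i)
        rw [Finset.card_univ, Fintype.card_fin] at h3
        exact h3.trans (mul_le_mul_of_nonneg_left (hsq t x) (Nat.cast_nonneg m))
      calc _ ≤ _ := h1
        _ ≤ √m * √(2 * lyapunov α φ (θ x) (Q x) t) * (K * Ψ) :=
            mul_le_mul_of_nonneg_right h2 (by positivity)
        _ = _ := by ring
    · have hqc := fun i => integral_queue_mul_constraintAt run hM hΨ hα hφ hF (t := t) (C := C)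
        (fun x => by rw [abs_of_nonneg (hF0 _)]; exact hC x) i
      simp only [Finset.mul_sum]
      rw [integral_finsetSum _ fun i _ => (hqc i).2.1]
      have h1 : ∑ i, ∫ x, F (lyapunov α φ (θ x) (Q x) t) * (Q x (t + 1) i *
          M.constraintAt x t i φ) ∂M.ν ≤
          ∑ i, -η * ∫ x, F (lyapunov α φ (θ x) (Q x) t) * Q x (t + 1) i ∂M.ν :=
        Finset.sum_le_sum fun i _ => by
          rw [(hqc i).2.2, mul_comm]
          exact mul_le_mul_of_nonneg_right (hγ i t)
            (integral_nonneg fun x => mul_nonneg (hF0 _) (hQ0 t x i))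
      refine h1.trans ?_
      rw [← Finset.mul_sum, neg_mul, neg_mul, neg_le_neg_iff]
      refine mul_le_mul_of_nonneg_left ?_ hη.le
      rw [← integral_finsetSum _ fun i _ => (hqc i).1]
      have hC0 : 0 ≤ C := by
        obtain ⟨x₀⟩ : Nonempty (EnvPath E) := Measure.nonempty_of_neZero M.ν
        exact (hF0 _).trans (hC x₀)
      refine integral_mono (integrable_of_measurable_of_abs_le
        (B := C * (√(2 * (m * (t * (K * Ψ)) ^ 2 / 2 + 2 * α * K)) + σ))
        ((hF.comp (measurable_lyapunov run hα t)).mul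
          ((((measurable_lyapunov run hα t).const_mul 2).sqrt).sub_const σ)) fun x => ?_)
        (integrable_finsetSum _ fun i _ => (hqc i).1) fun x => ?_
      · rw [abs_mul, abs_of_nonneg (hF0 _)]
        refine mul_le_mul (hC x) ?_ (abs_nonneg _) hC0
        have h2 : √(2 * lyapunov α φ (θ x) (Q x) t) ≤
            √(2 * (m * (t * (K * Ψ)) ^ 2 / 2 + 2 * α * K)) :=
          Real.sqrt_le_sqrt (mul_le_mul_of_nonneg_left
            ((run x).lyapunov_le hM hΨ hα hθ₀ hφ le_rfl) zero_le_two)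
        have h3 := Real.sqrt_nonneg (2 * lyapunov α φ (θ x) (Q x) t)
        rw [abs_le]
        constructor <;> linarith
      · change F _ * _ ≤ _
        rw [← Finset.mul_sum]
        refine mul_le_mul_of_nonneg_left ?_ (hF0 _)
        rw [sub_le_iff_le_add]
        have hs0 : 0 ≤ ∑ i, Q x (t + 1) i := Finset.sum_nonneg fun i _ => hQ0 t x i
        refine Real.sqrt_le_iff.2 ⟨by linarith, ?_⟩
        have h2 := Finset.sum_sq_le_sq_sum_of_nonneg
          (s := (Finset.univ : Finset (Fin m))) (f := fun i => Q x (t + 1) i) fun i _ => hQ0 t x i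
        have h3 := mul_le_mul_of_nonneg_left ((run x).sum_sqNorm_sub_le hθ₀ hφ t) hα.le
        have h4 := mul_nonneg hs0 hσ0.le
        unfold lyapunov
        nlinarith
  have hηD : η ≤ D := by
    rw [hD]
    have : 0 ≤ K * Ψ * √m := by positivity
    linarith
  have hσB : σ ≤ 2 / η * (β + η * σ) := by
    have h1 : 2 / η * (β + η * σ) = 2 * β / η + 2 * σ := by field_simp
    have h2 : 0 ≤ 2 * β / η := by positivity
    linarith
  have hZm : ∀ t, Measurable fun x => √(2 * lyapunov α φ (θ x) (Q x) t) := fun t =>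
    ((measurable_lyapunov run hα t).const_mul 2).sqrt
  have hZc : ∀ t x, √(2 * lyapunov α φ (θ x) (Q x) t) ≤
      √(2 * (m * (t * (K * Ψ)) ^ 2 / 2 + 2 * α * K)) := fun t x =>
    Real.sqrt_le_sqrt (mul_le_mul_of_nonneg_left
      ((run x).lyapunov_le hM hΨ hα hθ₀ hφ le_rfl) zero_le_two)
  have hfin := integral_le_of_exp_step (μ := M.ν)
    (Z := fun t x => √(2 * lyapunov α φ (θ x) (Q x) t)) hη hηD rfl (fun x => ?_) hZm
    (fun t x => Real.sqrt_nonneg _) (fun t => ⟨_, hZc t⟩) hstep t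
  · refine le_trans (integral_mono (integrable_queue run hM hΨ hα t i)
      (integrable_of_measurable_of_abs_le
        (B := √(2 * (m * (t * (K * Ψ)) ^ 2 / 2 + 2 * α * K))) (hZm t) fun x => ?_)
      fun x => ?_) hfin
    · rw [abs_of_nonneg (Real.sqrt_nonneg _)]; exact hZc t x
    · refine Real.le_sqrt_of_sq_le ((Finset.single_le_sum (f := fun i => Q x (t + 1) i ^ 2)
        (fun i _ => sq_nonneg _) (Finset.mem_univ i)).trans (hsq t x))
  · refine (Real.sqrt_le_iff.2 ⟨hσ0.le, ?_⟩).trans hσB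
    have := (run x).lyapunov_zero_le hα hθ₀ hφ
    rw [hσ2]
    linarith

end Expectation

end IsAlgorithmRun

end Model

/-! ### Tracking the stationary laws of slowly varying chains. -/

section Tracking

/-- Sum the recursion: the first r terms cost at most 2 each, every δ lies in at most r windows, and
the share ρ of the total moves to the left-hand side. -/
theorem sum_le_of_block_contraction {a δ : ℕ → ℝ} {r : ℕ} {ρ : ℝ} (hρ0 : 0 ≤ ρ) (hρ1 : ρ < 1)
    (ha0 : ∀ t, 0 ≤ a t) (ha2 : ∀ t, a t ≤ 2) (hδ : ∀ t, 0 ≤ δ t)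
    (hstep : ∀ t, a (t + r) ≤ ρ * a t + ∑ j ∈ Finset.range r, δ (t + j)) (N : ℕ) :
    ∑ t ∈ Finset.range N, a t ≤
      (2 * r + r * ∑ t ∈ Finset.range N, δ t) / (1 - ρ) := by
  rw [le_div_iff₀ (by linarith)]
  have hfirst : ∀ n, n ≤ r → ∑ t ∈ Finset.range n, a t ≤ 2 * r := fun n hn => by
    refine (Finset.sum_le_sum fun t _ => ha2 t).trans ?_
    have : (n : ℝ) ≤ r := by exact_mod_cast hn
    simp only [Finset.sum_const, Finset.card_range, nsmul_eq_mul]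
    linarith
  have hA0 : 0 ≤ ∑ t ∈ Finset.range N, a t := Finset.sum_nonneg fun t _ => ha0 t
  have hδ0 : 0 ≤ ∑ t ∈ Finset.range N, δ t := Finset.sum_nonneg fun t _ => hδ t
  have hr0 : (0 : ℝ) ≤ r := Nat.cast_nonneg r
  have key : ∑ t ∈ Finset.range N, a t ≤
      2 * r + ρ * ∑ t ∈ Finset.range N, a t + r * ∑ t ∈ Finset.range N, δ t := by
    rcases le_total N r with h | h
    · have h1 := hfirst N h
      have h2 := mul_nonneg hρ0 hA0
      have h3 := mul_nonneg hr0 hδ0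
      linarith
    · obtain ⟨n, rfl⟩ := Nat.exists_eq_add_of_le h
      have h1 : ∑ t ∈ Finset.range n, a (r + t) ≤
          ρ * ∑ t ∈ Finset.range n, a t +
            ∑ t ∈ Finset.range n, ∑ j ∈ Finset.range r, δ (t + j) := by
        rw [Finset.mul_sum, ← Finset.sum_add_distrib]
        exact Finset.sum_le_sum fun t _ => by rw [add_comm r t]; exact hstep t
      have h2 : ∑ t ∈ Finset.range n, ∑ j ∈ Finset.range r, δ (t + j) ≤
          r * ∑ t ∈ Finset.range (r + n), δ t := by
        rw [Finset.sum_comm]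
        calc _ ≤ ∑ _j ∈ Finset.range r, ∑ t ∈ Finset.range (r + n), δ t := by
              refine Finset.sum_le_sum fun j hj => ?_
              rw [Finset.range_eq_Ico, Finset.sum_Ico_add' δ 0 n j, Finset.range_eq_Ico]
              refine Finset.sum_le_sum_of_subset_of_nonneg (fun t ht => ?_) fun t _ _ => hδ t
              rw [Finset.mem_range] at hj
              rw [Finset.mem_Ico] at ht ⊢
              omega
          _ = _ := by simp
      have h3 : ∑ t ∈ Finset.range n, a t ≤ ∑ t ∈ Finset.range (r + n), a t :=
        Finset.sum_le_sum_of_subset_of_nonneg (Finset.range_mono (by omega)) fun t _ _ => ha0 t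
      have h4 := mul_le_mul_of_nonneg_left h3 hρ0
      have h5 := Finset.sum_range_add a r n
      have h6 := hfirst r le_rfl
      linarith
  linarith

variable {S : Type*} [Fintype S] [DecidableEq S]

/-- A state distribution driven by slowly varying transition matrices stays close to their
stationary distributions. -/
theorem sum_l1Norm_sub_le_of_mixing {v d : ℕ → S → ℝ} {R : ℕ → Matrix S S ℝ} {r : ℕ} {ρ : ℝ}
    (hρ0 : 0 ≤ ρ) (hρ1 : ρ < 1) (hR : ∀ t, R t ∈ Matrix.rowStochastic ℝ S)
    (hv : ∀ t, v t ∈ stdSimplex ℝ S) (hvs : ∀ t, v (t + 1) = Matrix.vecMul (v t) (R t))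
    (hd : ∀ t, IsStationary (R t) (d t))
    (hmix : ∀ t, l1Norm (Matrix.vecMul (v t - d t) (List.ofFn fun j : Fin r => R (t + j)).prod) ≤
      ρ * l1Norm (v t - d t)) (N : ℕ) :
    ∑ t ∈ Finset.range N, l1Norm (v t - d t) ≤
      (2 * r + r * ∑ t ∈ Finset.range N, l1Norm (d t - d (t + 1))) / (1 - ρ) := by
  refine sum_le_of_block_contraction hρ0 hρ1 (fun t => l1Norm_nonneg _)
    (fun t => l1Norm_sub_le_two (hv t) (hd t).1) (fun t => l1Norm_nonneg _) (fun t => ?_) N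
  have hone : ∀ t, v (t + 1) - d (t + 1) =
      Matrix.vecMul (v t - d t) (R t) + (d t - d (t + 1)) := fun t => by
    rw [Matrix.sub_vecMul, ← hvs, (hd t).2]
    abel
  -- Stochastic matrices do not expand ℓ¹ distances, so the deviation differs from its undisturbed
  -- propagation by at most the accumulated movement of the stationary laws.
  have hdev : ∀ n, l1Norm (v (t + n) - d (t + n) -
      Matrix.vecMul (v t - d t) (List.ofFn fun j : Fin n => R (t + j)).prod) ≤
      ∑ j ∈ Finset.range n, l1Norm (d (t + j) - d (t + j + 1)) := by
    intro n
    induction n with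
    | zero => simp [l1Norm]
    | succ n ih =>
      rw [List.ofFn_succ', List.concat_eq_append, List.prod_append, List.prod_singleton,
        Finset.sum_range_succ]
      have hsplit : v (t + (n + 1)) - d (t + (n + 1)) - Matrix.vecMul (v t - d t)
          ((List.ofFn fun j : Fin n => R (t + (j.castSucc : Fin (n + 1)))).prod *
            R (t + (Fin.last n : Fin (n + 1)))) =
          Matrix.vecMul (v (t + n) - d (t + n) -
            Matrix.vecMul (v t - d t) (List.ofFn fun j : Fin n => R (t + j)).prod) (R (t + n)) +
            (d (t + n) - d (t + n + 1)) := by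
        rw [← add_assoc, hone (t + n)]
        generalize v (t + n) - d (t + n) = a
        rw [Matrix.sub_vecMul (R (t + n)) a, Matrix.vecMul_vecMul]
        simp only [Fin.val_castSucc, Fin.val_last]
        abel
      rw [hsplit]
      exact (l1Norm_add_le _ _).trans
        (add_le_add ((l1Norm_vecMul_le (hR _) _).trans ih) le_rfl)
  have h1 := l1Norm_add_le (v (t + r) - d (t + r) -
      Matrix.vecMul (v t - d t) (List.ofFn fun j : Fin r => R (t + j)).prod)
      (Matrix.vecMul (v t - d t) (List.ofFn fun j : Fin r => R (t + j)).prod)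
  rw [sub_add_cancel] at h1
  linarith [hdev r, hmix t]

theorem l1Norm_stateMass_sub_le {S A : Type*} [Fintype S] [Fintype A] (θ θ' : S → A → ℝ) :
    l1Norm (stateMass θ - stateMass θ') ≤ entryNorm (θ - θ') :=
  Finset.sum_le_sum fun s _ => by
    simp only [Pi.sub_apply, stateMass, ← Finset.sum_sub_distrib]
    exact Finset.abs_sum_le_sum_abs _ _

end Tracking

/-! ### State marginals and the cost of imperfect tracking. -/

namespace Model

variable {K m : ℕ} {S A : Fin K → Type*} [∀ k, Fintype (S k)] [∀ k, Fintype (A k)]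
  [∀ k, DecidableEq (S k)] {E : Type*} [MeasurableSpace E] {M : Model K m S A E}

/-- The marginal of a joint state distribution on the `k`-th MDP. -/
def stateMarginal (u : (∀ k, S k) → ℝ) (k : Fin K) (s : S k) : ℝ :=
  ∑ y : ∀ k, S k, if y k = s then u y else 0

theorem sum_stateMarginal_mul (u : (∀ k, S k) → ℝ) (k : Fin K) (c : S k → ℝ) :
    ∑ s, stateMarginal u k s * c s = ∑ y, u y * c (y k) :=
  sum_sum_ite_mul u (fun y => y k) c

theorem stateMarginal_mem_stdSimplex {u : (∀ k, S k) → ℝ} (hu : u ∈ stdSimplex ℝ (∀ k, S k))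
    (k : Fin K) : stateMarginal u k ∈ stdSimplex ℝ (S k) := by
  refine ⟨fun s => Finset.sum_nonneg fun y _ => ?_, ?_⟩
  · split_ifs
    · exact hu.1 y
    · exact le_rfl
  · simpa [hu.2] using sum_stateMarginal_mul u k fun _ => 1

theorem policyMatrix_separable (π : ∀ k, S k → A k → ℝ) (y y' : ∀ k, S k) :
    policyMatrix M.jointP (separable π) y y' = ∏ k, policyMatrix (M.P k) (π k) (y k) (y' k) := by
  simp only [policyMatrix, Matrix.of_apply, separable, jointP, Fintype.prod_sum,
    Finset.prod_mul_distrib]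

/-- Under a separable policy the k-th coordinate moves by its own kernel, whatever the other
coordinates do. The joint law `u` need not be a product. -/
theorem stateMarginal_vecMul {π : ∀ k, S k → A k → ℝ} (hπ : ∀ k, IsPolicy (π k))
    (u : (∀ k, S k) → ℝ) (k : Fin K) :
    stateMarginal (Matrix.vecMul u (policyMatrix M.jointP (separable π))) k =
      Matrix.vecMul (stateMarginal u k) (policyMatrix (M.P k) (π k)) := by
  funext s'
  have h1 : Matrix.vecMul (stateMarginal u k) (policyMatrix (M.P k) (π k)) s' =
      ∑ y, u y * policyMatrix (M.P k) (π k) (y k) s' :=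
    sum_stateMarginal_mul u k fun s => policyMatrix (M.P k) (π k) s s'
  have h2 : stateMarginal (Matrix.vecMul u (policyMatrix M.jointP (separable π))) k s' =
      ∑ y', Matrix.vecMul u (policyMatrix M.jointP (separable π)) y' *
        if y' k = s' then 1 else 0 := by
    simp only [stateMarginal, mul_ite, mul_one, mul_zero]
  rw [h1, h2]
  simp only [Matrix.vecMul, dotProduct, Finset.sum_mul]
  rw [Finset.sum_comm]
  refine Finset.sum_congr rfl fun y _ => ?_
  simp only [mul_assoc, ← Finset.mul_sum, policyMatrix_separable]
  congr 1
  rw [sum_prod_mul_apply (p := fun j => policyMatrix (M.P j) (π j) (y j)) (fun j =>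
    Matrix.sum_row_of_mem_rowStochastic
      (policyMatrix_mem_rowStochastic (M.P_stochastic j) (hπ j)) (y j)) k
      fun z => if z = s' then 1 else 0]
  simp

/-- The expected one-slot cost under the joint state distribution `u` and the joint policy `Pi`. -/
def jointCost (u : (∀ k, S k) → ℝ) (Pi : (∀ k, S k) → (∀ k, A k) → ℝ) (c : ∀ k, S k → A k → ℝ) :
    ℝ :=
  ∑ y, ∑ b, u y * Pi y b * ∑ k, c k (y k) (b k)

theorem jointCost_separable {π : ∀ k, S k → A k → ℝ} (hπ : ∀ k, IsPolicy (π k))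
    (u : (∀ k, S k) → ℝ) (c : ∀ k, S k → A k → ℝ) :
    jointCost u (separable π) c = ∑ k, ∑ s, stateMarginal u k s * ∑ a, π k s a * c k s a := by
  simp only [sum_stateMarginal_mul]
  rw [Finset.sum_comm]
  refine Finset.sum_congr rfl fun y _ => ?_
  simp only [mul_assoc, ← Finset.mul_sum]
  congr 1
  simp only [Finset.mul_sum]
  rw [Finset.sum_comm]
  exact Finset.sum_congr rfl fun k _ =>
    sum_prod_mul_apply (p := fun j => π j (y j)) (fun j => (hπ j (y j)).2) k (c k (y k))

/-- The total distance between the state marginals of `u` and the state distributions of `θ`. -/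
def trackingError (u : (∀ k, S k) → ℝ) (θ : ∀ k, S k → A k → ℝ) : ℝ :=
  ∑ k, l1Norm (stateMarginal u k - stateMass (θ k))

theorem abs_sum_policy_mul_le {A : Type*} [Fintype A] {p c : A → ℝ} (hp : p ∈ stdSimplex ℝ A)
    {B : ℝ} (hc : ∀ a, |c a| ≤ B) : |∑ a, p a * c a| ≤ B := by
  have h := abs_sum_mul_le_l1Norm (d := p) hc
  have h1 : l1Norm p = 1 := by
    rw [← hp.2]
    exact Finset.sum_congr rfl fun a _ => abs_of_nonneg (hp.1 a)
  rwa [h1, mul_one] at h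

/-- Each `θ k` is its state mass times its recovered policy, so the two costs use the same action
probabilities and differ only in their state marginals. -/
theorem abs_jointCost_prescribedPolicy_sub_le {θ : ∀ k, S k → A k → ℝ}
    (hθ : ∀ k, θ k ∈ stateActionPolyhedron (M.P k)) (hpos : ∀ k s, 0 < stateMass (θ k) s)
    (u : (∀ k, S k) → ℝ) {c : ∀ k, S k → A k → ℝ} {B : ℝ} (hc : ∀ k s a, |c k s a| ≤ B) :
    |jointCost u (prescribedPolicy θ) c - ∑ k, pairing (c k) (θ k)| ≤ B * trackingError u θ := by
  have hπ : ∀ k, IsPolicy (recoveredPolicy (θ k)) := fun k =>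
    isPolicy_recoveredPolicy (hθ k) (hpos k)
  have hpair : ∀ k, pairing (c k) (θ k) =
      ∑ s, stateMass (θ k) s * ∑ a, recoveredPolicy (θ k) s a * c k s a := fun k => by
    refine Finset.sum_congr rfl fun s _ => ?_
    rw [Finset.mul_sum]
    refine Finset.sum_congr rfl fun a _ => ?_
    rw [← mul_assoc, stateMass_mul_recoveredPolicy (hpos k s), mul_comm]
  unfold prescribedPolicy trackingError
  rw [jointCost_separable hπ, ← Finset.sum_sub_distrib, Finset.mul_sum]
  refine (Finset.abs_sum_le_sum_abs _ _).trans (Finset.sum_le_sum fun k _ => ?_)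
  rw [hpair, ← Finset.sum_sub_distrib]
  simp only [← sub_mul]
  exact abs_sum_mul_le_l1Norm (d := stateMarginal u k - stateMass (θ k))
    fun s => abs_sum_policy_mul_le (hπ k s) (hc k s)

theorem abs_jointCost_sub_le {Pi : (∀ k, S k) → (∀ k, A k) → ℝ} (hPi : IsPolicy Pi)
    (u d : (∀ k, S k) → ℝ) {c : ∀ k, S k → A k → ℝ} {B : ℝ} (hc : ∀ k s a, |c k s a| ≤ B) :
    |jointCost u Pi c - jointCost d Pi c| ≤ K * B * l1Norm (u - d) := by
  have h : jointCost u Pi c - jointCost d Pi c =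
      ∑ y, (u - d) y * ∑ b, Pi y b * ∑ k, c k (y k) (b k) := by
    unfold jointCost
    rw [← Finset.sum_sub_distrib]
    refine Finset.sum_congr rfl fun y _ => ?_
    rw [← Finset.sum_sub_distrib, Finset.mul_sum]
    refine Finset.sum_congr rfl fun b _ => ?_
    rw [_root_.Pi.sub_apply]
    ring
  rw [h]
  exact abs_sum_mul_le_l1Norm fun y => abs_sum_policy_mul_le (hPi y) fun b =>
    abs_sum_le_card_mul fun k => hc k _ _

/-- The state law of the algorithm tracks the state distributions of its iterates. -/
theorem sum_trackingError_le {r : ℕ} {τ : ℝ} (hmix : M.IsMixing r τ) {d₀ : (∀ k, S k) → ℝ}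
    (hd₀ : d₀ ∈ stdSimplex ℝ (∀ k, S k)) {θ : EnvPath E → ℕ → ∀ k, S k → A k → ℝ} (x : EnvPath E)
    (hθ : ∀ x t k, θ x t k ∈ stateActionPolyhedron (M.P k))
    (hpos : ∀ x t k s, 0 < stateMass (θ x t k) s) (N : ℕ) :
    ∑ t ∈ Finset.range N,
        trackingError (M.stateLaw d₀ (fun t x => prescribedPolicy (θ x t)) x t) (θ x t) ≤
      (2 * r * K + r * ∑ t ∈ Finset.range N, ∑ k, entryNorm (θ x t k - θ x (t + 1) k)) /
        (1 - Real.exp (-1 / τ)) := by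
  obtain ⟨hr, hτ, hcontr⟩ := hmix
  set ρ := Real.exp (-1 / τ) with hρ
  have hρ1 : ρ < 1 := by
    rw [hρ, Real.exp_lt_one_iff]
    exact div_neg_of_neg_of_pos (by norm_num) (by linarith)
  have hπ : ∀ x t k, IsPolicy (recoveredPolicy (θ x t k)) := fun x t k =>
    isPolicy_recoveredPolicy (hθ x t k) (hpos x t k)
  have hpol : ∀ t x, IsPolicy (prescribedPolicy (θ x t)) := fun t x s =>
    prod_mem_stdSimplex fun k => hπ x t k (s k)
  set u := M.stateLaw d₀ (fun t x => prescribedPolicy (θ x t)) x with hu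
  have hus : ∀ t, u t ∈ stdSimplex ℝ (∀ k, S k) := stateLaw_mem_stdSimplex hd₀ hpol x
  have hk : ∀ k, ∑ t ∈ Finset.range N, l1Norm (stateMarginal (u t) k - stateMass (θ x t k)) ≤
      (2 * r + r * ∑ t ∈ Finset.range N, entryNorm (θ x t k - θ x (t + 1) k)) / (1 - ρ) :=
    fun k => by
    refine (sum_l1Norm_sub_le_of_mixing (v := fun t => stateMarginal (u t) k)
      (d := fun t => stateMass (θ x t k)) (r := r)
      (R := fun t => policyMatrix (M.P k) (recoveredPolicy (θ x t k))) (Real.exp_pos _).le hρ1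
      (fun t => policyMatrix_mem_rowStochastic (M.P_stochastic k) (hπ x t k))
      (fun t => stateMarginal_mem_stdSimplex (hus t) k)
      (fun t => stateMarginal_vecMul (hπ x t) (u t) k)
      (fun t => isStationary_stateMass (hθ x t k) (hpos x t k))
      (fun t => hcontr k _ _ (stateMarginal_mem_stdSimplex (hus t) k)
        (stateMass_mem_stdSimplex (hθ x t k)) (fun j => recoveredPolicy (θ x (t + j) k))
        fun j => hπ x _ k) N).trans ?_
    refine div_le_div_of_nonneg_right ?_ (by linarith)
    refine add_le_add le_rfl (mul_le_mul_of_nonneg_left ?_ (Nat.cast_nonneg r))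
    exact Finset.sum_le_sum fun t _ => l1Norm_stateMass_sub_le _ _
  unfold trackingError
  rw [Finset.sum_comm]
  refine (Finset.sum_le_sum fun k _ => hk k).trans (le_of_eq ?_)
  rw [Finset.sum_comm (s := Finset.range N), Finset.mul_sum Finset.univ, ← Finset.sum_div,
    Finset.sum_add_distrib]
  congr 2
  simp
  ring

theorem stateLaw_const (d₀ : (∀ k, S k) → ℝ) (Pi : (∀ k, S k) → (∀ k, A k) → ℝ) (x : EnvPath E)
    (t : ℕ) :
    M.stateLaw d₀ (fun _ _ => Pi) x t = Matrix.vecMul d₀ (policyMatrix M.jointP Pi ^ t) := by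
  induction t with
  | zero => simp [stateLaw]
  | succ t ih => rw [stateLaw, ih, Matrix.vecMul_vecMul, ← pow_succ]

/-- Under a stationary policy, the total distance to the stationary distribution is bounded. -/
theorem IsJointMixing.sum_l1Norm_sub_le {r₁ : ℝ} (hmix : M.IsJointMixing r₁)
    {Pi : (∀ k, S k) → (∀ k, A k) → ℝ} (hPi : IsPolicy Pi) {d₀ d : (∀ k, S k) → ℝ}
    (hd₀ : d₀ ∈ stdSimplex ℝ (∀ k, S k)) (hd : IsStationary (policyMatrix M.jointP Pi) d)
    (x : EnvPath E) (I : Finset ℕ) :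
    ∑ t ∈ I, l1Norm (M.stateLaw d₀ (fun _ _ => Pi) x t - d) ≤
      2 * Real.exp 1 / (1 - Real.exp (-1 / r₁)) := by
  obtain ⟨hr, hle⟩ := hmix
  set q := Real.exp (-1 / r₁) with hq
  have hq0 : 0 ≤ q := (Real.exp_pos _).le
  have hq1 : q < 1 := by
    rw [hq, Real.exp_lt_one_iff]
    exact div_neg_of_neg_of_pos (by norm_num) hr
  have hterm : ∀ t, l1Norm (M.stateLaw d₀ (fun _ _ => Pi) x t - d) ≤ 2 * Real.exp 1 * q ^ t :=
    fun t => by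
    have h := hle Pi d₀ d hPi hd₀ hd t
    rw [Matrix.sub_vecMul, hd.vecMul_pow, ← stateLaw_const d₀ Pi x] at h
    refine h.trans (le_of_eq ?_)
    rw [hq, ← Real.exp_nat_mul, mul_assoc, ← Real.exp_add]
    congr 2
    field_simp
    ring
  calc _ ≤ ∑ t ∈ I, 2 * Real.exp 1 * q ^ t := Finset.sum_le_sum fun t _ => hterm t
    _ = 2 * Real.exp 1 * ∑ t ∈ I, q ^ t := by rw [Finset.mul_sum]
    _ ≤ 2 * Real.exp 1 * (1 - q)⁻¹ := by
        refine mul_le_mul_of_nonneg_left ?_ (by positivity)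
        rw [← tsum_geometric_of_lt_one hq0 hq1]
        exact (summable_geometric_of_lt_one hq0 hq1).sum_le_tsum I fun t _ => pow_nonneg hq0 t
    _ = _ := by rw [div_eq_mul_inv]

end Model

/-! ### Costs along trajectories and the comparator. -/

namespace Model

variable {K m : ℕ} {S A : Fin K → Type*} [∀ k, Fintype (S k)] [∀ k, Fintype (A k)]
  {E : Type*} [MeasurableSpace E] {M : Model K m S A E}

/-- A probability vector needs a nonempty index set, and for K = 0 the constraint value would be 0,
which is not below −η. -/
theorem Slater.nonempty {η : ℝ} (hη : 0 < η) (hm : 1 ≤ m) (h : M.Slater η) :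
    1 ≤ K ∧ (∀ k, Nonempty (S k)) ∧ ∀ k, Nonempty (A k) := by
  obtain ⟨π, d, hπ, hd, hle⟩ := h
  obtain ⟨y⟩ : Nonempty (∀ k, S k) := by
    by_contra hne
    rw [not_nonempty_iff] at hne
    have := hd.1.2
    simp at this
  refine ⟨?_, fun k => ⟨y k⟩, fun k => ?_⟩
  · by_contra hK
    have hK0 : K = 0 := by omega
    subst hK0
    have := hle ⟨0, hm⟩ 0
    simp at this
    linarith
  · by_contra hne
    rw [not_nonempty_iff] at hne
    have := (hπ k (y k)).2
    simp at this

theorem BoundedBy.nonneg {Ψ : ℝ} (hM : M.BoundedBy Ψ) (hK : 1 ≤ K) [∀ k, Nonempty (S k)]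
    [∀ k, Nonempty (A k)] : 0 ≤ Ψ := by
  have hν : IsProbabilityMeasure M.ν := M.isProb
  obtain ⟨x⟩ : Nonempty (EnvPath E) := Measure.nonempty_of_neZero M.ν
  exact (abs_nonneg _).trans (hM.1 ⟨0, hK⟩ (Classical.arbitrary _) (Classical.arbitrary _) (x.1 0))

section Costs

variable {d₀ : (∀ k, S k) → ℝ} {pol : ℕ → EnvPath E → (∀ k, S k) → (∀ k, A k) → ℝ}

theorem abs_jointCost_le {u : (∀ k, S k) → ℝ} (hu : u ∈ stdSimplex ℝ (∀ k, S k))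
    {Pi : (∀ k, S k) → (∀ k, A k) → ℝ} (hPi : IsPolicy Pi) {c : ∀ k, S k → A k → ℝ} {B : ℝ}
    (hc : ∀ k s a, |c k s a| ≤ B) : |jointCost u Pi c| ≤ K * B := by
  unfold jointCost
  simp only [mul_assoc, ← Finset.mul_sum]
  exact abs_sum_policy_mul_le hu fun y => abs_sum_policy_mul_le (hPi y) fun b =>
    abs_sum_le_card_mul fun k => hc k _ _

theorem integrable_jointCost (hd₀ : d₀ ∈ stdSimplex ℝ (∀ k, S k))
    (hpol : ∀ t x, IsPolicy (pol t x)) (hmeas : ∀ t y b, Measurable fun x => pol t x y b) (t : ℕ)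
    {c : EnvPath E → ∀ k, S k → A k → ℝ} (hcm : ∀ k s a, Measurable fun x => c x k s a) {B : ℝ}
    (hc : ∀ x k s a, |c x k s a| ≤ B) :
    Integrable (fun x => jointCost (M.stateLaw d₀ pol x t) (pol t x) (c x)) M.ν := by
  have hν : IsProbabilityMeasure M.ν := M.isProb
  refine integrable_of_measurable_of_abs_le (B := K * B)
    (Finset.measurable_sum _ fun y _ => Finset.measurable_sum _ fun b _ =>
      ((measurable_stateLaw hmeas t y).mul (hmeas t y b)).mul
        (Finset.measurable_sum _ fun k _ => hcm k _ _)) fun x => ?_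
  exact abs_jointCost_le (stateLaw_mem_stdSimplex hd₀ hpol x t) (hpol t x) (hc x)

variable {Ω : Type*} [MeasurableSpace Ω] {Pr : Measure Ω} [IsProbabilityMeasure Pr]
  {ξ : Ω → EnvPath E} {s : ℕ → Ω → ∀ k, S k} {a : ℕ → Ω → ∀ k, A k}

theorem IsTrajectory.integral_sum_cost (tr : M.IsTrajectory Pr d₀ pol ξ s a)
    (hd₀ : d₀ ∈ stdSimplex ℝ (∀ k, S k)) (hpol : ∀ t x, IsPolicy (pol t x))
    (hmeas : ∀ t y b, Measurable fun x => pol t x y b) (I : Finset ℕ)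
    {c : ℕ → EnvPath E → ∀ k, S k → A k → ℝ} (hcm : ∀ t k s a, Measurable fun x => c t x k s a)
    {B : ℝ} (hc : ∀ t x k s a, |c t x k s a| ≤ B) :
    ∫ w, ∑ t ∈ I, ∑ k, c t (ξ w) k (s t w k) (a t w k) ∂Pr =
      ∫ x, ∑ t ∈ I, jointCost (M.stateLaw d₀ pol x t) (pol t x) (c t x) ∂M.ν := by
  have h := fun t => tr.integral_cost hd₀ hpol hmeas t
    (c := fun x y b => ∑ k, c t x k (y k) (b k)) (B := K * B)
    (fun y b => Finset.measurable_sum _ fun k _ => hcm t k _ _)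
    fun x y b => abs_sum_le_card_mul fun k => hc t x k _ _
  rw [integral_finsetSum _ fun t _ => (h t).1, integral_finsetSum _ fun t _ =>
    integrable_jointCost hd₀ hpol hmeas t (hcm t) (hc t)]
  exact Finset.sum_congr rfl fun t _ => (h t).2

theorem IsTrajectory.totalPenalty_eq (tr : M.IsTrajectory Pr d₀ pol ξ s a) {Ψ : ℝ}
    (hM : M.BoundedBy Ψ) (hd₀ : d₀ ∈ stdSimplex ℝ (∀ k, S k)) (hpol : ∀ t x, IsPolicy (pol t x))
    (hmeas : ∀ t y b, Measurable fun x => pol t x y b) (b T : ℕ) :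
    M.totalPenalty Pr ξ s a b T = ∫ x, ∑ t ∈ Finset.Ico b (b + T),
      jointCost (M.stateLaw d₀ pol x t) (pol t x) (M.f x t) ∂M.ν :=
  tr.integral_sum_cost hd₀ hpol hmeas _ (c := fun t x => M.f x t)
    (fun t k s a => IsAlgorithmRun.measurable_f k s a t) fun _ _ k s a => hM.1 k s a _

theorem IsTrajectory.totalConstraint_eq (tr : M.IsTrajectory Pr d₀ pol ξ s a) {Ψ : ℝ}
    (hM : M.BoundedBy Ψ) (hd₀ : d₀ ∈ stdSimplex ℝ (∀ k, S k)) (hpol : ∀ t x, IsPolicy (pol t x))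
    (hmeas : ∀ t y b, Measurable fun x => pol t x y b) (b T : ℕ) (i : Fin m) :
    M.totalConstraint Pr ξ s a b T i = ∫ x, ∑ t ∈ Finset.Ico b (b + T),
      jointCost (M.stateLaw d₀ pol x t) (pol t x) (M.g x t i) ∂M.ν :=
  tr.integral_sum_cost hd₀ hpol hmeas _ (c := fun t x => M.g x t i)
    (fun t k s a => IsAlgorithmRun.measurable_g i k s a t) fun _ _ k s a => hM.2 i k s a _

end Costs

section Comparator

variable [∀ k, DecidableEq (S k)] {d₀ : (∀ k, S k) → ℝ} {Ω : Type*} [MeasurableSpace Ω]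
  {Pr : Measure Ω} [IsProbabilityMeasure Pr] {ξ : Ω → EnvPath E} {s : ℕ → Ω → ∀ k, S k}
  {a : ℕ → Ω → ∀ k, A k} {Pi : (∀ k, S k) → (∀ k, A k) → ℝ}

theorem measurable_penaltyAt {φ : EnvPath E → ∀ k, S k → A k → ℝ}
    (hφ : ∀ k s a, Measurable fun x => φ x k s a) (t : ℕ) :
    Measurable fun x => M.penaltyAt x t (φ x) :=
  Finset.measurable_sum _ fun k _ => IsAlgorithmRun.measurable_pairing
    (fun s a => IsAlgorithmRun.measurable_f k s a t) fun s a => hφ k s a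

theorem integrable_penaltyAt {Ψ : ℝ} (hM : M.BoundedBy Ψ) {φ : EnvPath E → ∀ k, S k → A k → ℝ}
    (hφm : ∀ k s a, Measurable fun x => φ x k s a)
    (hφ : ∀ x k, φ x k ∈ stateActionPolyhedron (M.P k)) (t : ℕ) :
    Integrable (fun x => M.penaltyAt x t (φ x)) M.ν := by
  have hν : IsProbabilityMeasure M.ν := M.isProb
  exact integrable_of_measurable_of_abs_le (measurable_penaltyAt hφm t) fun x =>
    hM.abs_penaltyAt_le (hφ x) x t

theorem integrable_constraintAt {Ψ : ℝ} (hM : M.BoundedBy Ψ) {φ : ∀ k, S k → A k → ℝ}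
    (hφ : ∀ k, φ k ∈ stateActionPolyhedron (M.P k)) (t : ℕ) (i : Fin m) :
    Integrable (fun x => M.constraintAt x t i φ) M.ν := by
  have hν : IsProbabilityMeasure M.ν := M.isProb
  exact integrable_of_measurable_of_abs_le (measurable_constraintAt t i φ) fun x =>
    hM.abs_constraintAt_le hφ x t i

/-- A feasible stationary policy yields nearly feasible stationary state-action vectors with nearly
the same total penalty. -/
theorem IsTrajectory.exists_comparator [Nonempty (∀ k, S k)]
    (tr : M.IsTrajectory Pr d₀ (fun _ _ => Pi) ξ s a) {Ψ r₁ c₁ : ℝ} (hM : M.BoundedBy Ψ)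
    (hΨ : 0 ≤ Ψ) (hmix : M.IsJointMixing r₁) (hc₁ : c₁ = 2 * Real.exp 1 / (1 - Real.exp (-1 / r₁)))
    (hPi : IsPolicy Pi) (hd₀ : d₀ ∈ stdSimplex ℝ (∀ k, S k)) {b T : ℕ} (hT : 1 ≤ T)
    (hfeas : ∀ i, M.totalConstraint Pr ξ s a b T i ≤ 0) :
    ∃ φ : ∀ k, S k → A k → ℝ, (∀ k, φ k ∈ stateActionPolyhedron (M.P k)) ∧
      (∀ i t, ∫ x, M.constraintAt x t i φ ∂M.ν ≤ K * Ψ * c₁ / T) ∧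
      ∑ t ∈ Finset.Ico b (b + T), ∫ x, M.penaltyAt x t φ ∂M.ν ≤
        M.totalPenalty Pr ξ s a b T + K * Ψ * c₁ := by
  have hν : IsProbabilityMeasure M.ν := M.isProb
  have hmeas : ∀ (t : ℕ) (y : ∀ k, S k) (b : ∀ k, A k),
      Measurable fun x : EnvPath E => (fun (_ : ℕ) (_ : EnvPath E) => Pi) t x y b :=
    fun _ _ _ => measurable_const
  obtain ⟨d, hd⟩ := exists_isStationary
    (policyMatrix_mem_rowStochastic M.jointP_mem_stdSimplex hPi)
  set φ := stateActionMarginal d Pi with hφdef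
  have hφ := M.stateActionMarginal_mem hPi hd
  have hclose : ∀ (x : EnvPath E) (c : ℕ → ∀ k, S k → A k → ℝ), (∀ t k s a, |c t k s a| ≤ Ψ) →
      ∑ t ∈ Finset.Ico b (b + T), ∑ k, pairing (c t k) (φ k) ≤ (∑ t ∈ Finset.Ico b (b + T),
        jointCost (M.stateLaw d₀ (fun _ _ => Pi) x t) Pi (c t)) + K * Ψ * c₁ := fun x c hc => by
    have h1 : ∀ t, ∑ k, pairing (c t k) (φ k) ≤
        jointCost (M.stateLaw d₀ (fun _ _ => Pi) x t) Pi (c t) +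
          K * Ψ * l1Norm (M.stateLaw d₀ (fun _ _ => Pi) x t - d) := fun t => by
      have h := (abs_le.1 (abs_jointCost_sub_le hPi (M.stateLaw d₀ (fun _ _ => Pi) x t) d
        (hc t))).1
      have h2 : ∑ k, pairing (c t k) (φ k) = jointCost d Pi (c t) :=
        sum_pairing_stateActionMarginal d Pi (c t)
      linarith
    refine (Finset.sum_le_sum fun t _ => h1 t).trans ?_
    rw [Finset.sum_add_distrib, ← Finset.mul_sum, hc₁]
    refine add_le_add le_rfl (mul_le_mul_of_nonneg_left ?_ (by positivity))
    exact hmix.sum_l1Norm_sub_le hPi hd₀ hd x _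
  refine ⟨φ, hφ, fun i t => ?_, ?_⟩
  · have h1 := integral_mono (integrable_finsetSum (Finset.Ico b (b + T)) fun t _ =>
      integrable_constraintAt hM hφ t i) ((integrable_finsetSum (Finset.Ico b (b + T)) fun t _ =>
        integrable_jointCost hd₀ (fun _ _ => hPi) hmeas t
        (c := fun x => M.g x t i) (fun k s a => IsAlgorithmRun.measurable_g i k s a t)
        fun x k s a => hM.2 i k s a _).add (integrable_const (K * Ψ * c₁)))
        fun x => hclose x (fun t => M.g x t i) fun t k s a => hM.2 i k s a _
    simp only [_root_.Pi.add_apply] at h1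
    rw [integral_add (integrable_finsetSum (Finset.Ico b (b + T)) fun t _ =>
        integrable_jointCost hd₀ (fun _ _ => hPi) hmeas t
        (c := fun x => M.g x t i) (fun k s a => IsAlgorithmRun.measurable_g i k s a t)
        fun x k s a => hM.2 i k s a _) (integrable_const _),
      ← tr.totalConstraint_eq hM hd₀ (fun _ _ => hPi) hmeas b T i,
      integral_finsetSum _ fun t _ => integrable_constraintAt hM hφ t i,
      Finset.sum_congr rfl fun t _ => integral_constraintAt_eq t i φ, integral_const,
      probReal_univ, one_smul, Finset.sum_const, Nat.card_Ico, Nat.add_sub_cancel_left,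
      nsmul_eq_mul] at h1
    have hT0 : (0 : ℝ) < T := by exact_mod_cast hT
    -- The constraint noise is identically distributed, so all slots have equal expectation; the
    -- bound on the sum of T of them, which feasibility supplies, divides by T.
    rw [integral_constraintAt_eq, le_div_iff₀ hT0]
    linarith [hfeas i]
  · have h1 := integral_mono (integrable_finsetSum (Finset.Ico b (b + T)) fun t _ =>
      integrable_penaltyAt hM (φ := fun _ => φ) (fun _ _ _ => measurable_const) (fun _ => hφ) t)
      ((integrable_finsetSum (Finset.Ico b (b + T)) fun t _ =>
        integrable_jointCost hd₀ (fun _ _ => hPi) hmeas t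
        (c := fun x => M.f x t) (fun k s a => IsAlgorithmRun.measurable_f k s a t)
        fun x k s a => hM.1 k s a _).add (integrable_const (K * Ψ * c₁)))
        fun x => hclose x (fun t => M.f x t) fun t k s a => hM.1 k s a _
    simp only [_root_.Pi.add_apply] at h1
    rwa [integral_add (integrable_finsetSum (Finset.Ico b (b + T)) fun t _ =>
        integrable_jointCost hd₀ (fun _ _ => hPi) hmeas t
        (c := fun x => M.f x t) (fun k s a => IsAlgorithmRun.measurable_f k s a t)
        fun x k s a => hM.1 k s a _) (integrable_const _),
      ← tr.totalPenalty_eq hM hd₀ (fun _ _ => hPi) hmeas b T,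
      integral_finsetSum _ fun t _ => integrable_penaltyAt hM (φ := fun _ => φ)
        (fun _ _ _ => measurable_const) (fun _ => hφ) t, integral_const,
      probReal_univ, one_smul] at h1

end Comparator

/-! ### Performance of the algorithm. -/

section Algorithm

variable [∀ k, DecidableEq (S k)] {V α Ψ : ℝ} {θ₀ : ∀ k, S k → A k → ℝ}
  {θ : EnvPath E → ℕ → ∀ k, S k → A k → ℝ} {Q : EnvPath E → ℕ → Fin m → ℝ}
  {d₀ : (∀ k, S k) → ℝ} {Ω : Type*} [MeasurableSpace Ω] {Pr : Measure Ω} [IsProbabilityMeasure Pr]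
  {ξ : Ω → EnvPath E} {s : ℕ → Ω → ∀ k, S k} {a : ℕ → Ω → ∀ k, A k}

namespace IsAlgorithmRun

theorem measurable_prescribedPolicy (run : ∀ x, M.IsAlgorithmRun V α θ₀ x (θ x) (Q x))
    (hα : 0 < α) (t : ℕ) (y : ∀ k, S k) (b : ∀ k, A k) :
    Measurable fun x => prescribedPolicy (θ x t) y b := by
  have hθ := (measurable_iterates run hα t).1
  have h : ∀ k, Measurable fun x => recoveredPolicy (θ x t k) (y k) (b k) := fun k =>
    (hθ k _ _).div (Finset.measurable_sum _ fun a _ => hθ k _ a)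
  exact Finset.measurable_prod Finset.univ fun k _ => h k

theorem stateMass_pos [∀ k, Nonempty (A k)] (hU : M.Unichain)
    (run : ∀ x, M.IsAlgorithmRun V α θ₀ x (θ x) (Q x))
    (hθ₀ : ∀ k, θ₀ k ∈ stateActionPolyhedron (M.P k)) (x : EnvPath E) (t : ℕ) (k : Fin K)
    (z : S k) : 0 < stateMass (θ x t k) z := by
  obtain ⟨r, -, hr⟩ := hU.exists_worstReach_pos
  exact OCMDP.stateMass_pos (M.P_stochastic k) (hr k) ((run x).mem hθ₀ t k) z

theorem sum_entryNorm_step_le (run : ∀ x, M.IsAlgorithmRun V α θ₀ x (θ x) (Q x))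
    (hM : M.BoundedBy Ψ) (hΨ : 0 ≤ Ψ) (hV : 0 ≤ V) (hα : 0 < α)
    (hθ₀ : ∀ k, θ₀ k ∈ stateActionPolyhedron (M.P k)) (x : EnvPath E) (N : ℕ) :
    ∑ t ∈ Finset.range N, ∑ k, entryNorm (θ x t k - θ x (t + 1) k) ≤
      (∑ k, (Fintype.card (A k) : ℝ) * Fintype.card (S k)) * Ψ / (2 * α) *
        (N * V + ∑ t ∈ Finset.range N, ∑ i, Q x (t + 1) i) := by
  calc _ ≤ ∑ t ∈ Finset.range N, ∑ k, (Fintype.card (A k) : ℝ) * Fintype.card (S k) *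
        (Ψ * (V + ∑ i, Q x (t + 1) i)) / (2 * α) :=
        Finset.sum_le_sum fun t _ => Finset.sum_le_sum fun k _ =>
          (run x).entryNorm_step_le hM hΨ hV hα hθ₀ t k
    _ = ∑ t ∈ Finset.range N, (∑ k, (Fintype.card (A k) : ℝ) * Fintype.card (S k)) * Ψ / (2 * α) *
        (V + ∑ i, Q x (t + 1) i) := by
        refine Finset.sum_congr rfl fun t _ => ?_
        rw [← Finset.sum_div, ← Finset.sum_mul]
        ring
    _ = _ := by
        rw [← Finset.mul_sum, Finset.sum_add_distrib]
        simp

/-- The expected cost of the algorithm exceeds the cost of its iterates by at most a tracking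
term. The bound `Z` is any integrable pathwise bound on the costs of the iterates. -/
theorem integral_sum_jointCost_le [∀ k, Nonempty (A k)] (hU : M.Unichain)
    (run : ∀ x, M.IsAlgorithmRun V α θ₀ x (θ x) (Q x)) (hM : M.BoundedBy Ψ) (hΨ : 0 ≤ Ψ)
    (hV : 0 ≤ V) (hα : 0 < α) (hθ₀ : ∀ k, θ₀ k ∈ stateActionPolyhedron (M.P k)) {r : ℕ} {τ : ℝ}
    (hmix : M.IsMixing r τ) (hd₀ : d₀ ∈ stdSimplex ℝ (∀ k, S k)) (b T : ℕ)
    {c : ℕ → EnvPath E → ∀ k, S k → A k → ℝ} (hcm : ∀ t k s a, Measurable fun x => c t x k s a)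
    (hc : ∀ t x k s a, |c t x k s a| ≤ Ψ) {Z : EnvPath E → ℝ} (hZ : Integrable Z M.ν) {w : ℝ}
    (hle : ∀ x, ∑ t ∈ Finset.Ico b (b + T), ∑ k, pairing (c t x k) (θ x t k) ≤
      Z x + w * ∑ t ∈ Finset.range (b + T), ∑ k, entryNorm (θ x t k - θ x (t + 1) k))
    (hw : 0 ≤ w) {σ : ℝ}
    (hσ : σ = (∑ k, (Fintype.card (A k) : ℝ) * Fintype.card (S k)) * Ψ / (2 * α) *
        ((b + T : ℕ) * V + ∑ t ∈ Finset.range (b + T), ∑ i, ∫ x, Q x (t + 1) i ∂M.ν)) :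
    ∫ x, ∑ t ∈ Finset.Ico b (b + T), jointCost
        (M.stateLaw d₀ (fun t x => prescribedPolicy (θ x t)) x t) (prescribedPolicy (θ x t))
        (c t x) ∂M.ν ≤
      ∫ x, Z x ∂M.ν + w * σ + Ψ * ((2 * r * K + r * σ) / (1 - Real.exp (-1 / τ))) := by
  have hν : IsProbabilityMeasure M.ν := M.isProb
  have hmem := fun x => (run x).mem hθ₀
  have hpos := stateMass_pos hU run hθ₀
  have hpol : ∀ t x, IsPolicy (prescribedPolicy (θ x t)) := fun t x s =>
    prod_mem_stdSimplex fun k => isPolicy_recoveredPolicy (hmem x t k) (hpos x t k) (s k)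
  have hρ : 0 < 1 - Real.exp (-1 / τ) := by
    rw [sub_pos, Real.exp_lt_one_iff]
    exact div_neg_of_neg_of_pos (by norm_num) (by linarith [hmix.2.1])
  set N := b + T with hN
  set κ : ℝ := (∑ k, (Fintype.card (A k) : ℝ) * Fintype.card (S k)) * Ψ / (2 * α) with hκ
  set B : EnvPath E → ℝ := fun x => κ * (N * V + ∑ t ∈ Finset.range N, ∑ i, Q x (t + 1) i) with hB
  have hBi : Integrable B M.ν :=
    ((integrable_const _).add (integrable_finsetSum _ fun t _ => integrable_finsetSum _ fun i _ =>
      integrable_queue run hM hΨ hα t i)).const_mul κ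
  have hBint : ∫ x, B x ∂M.ν = σ := by
    rw [hσ, integral_const_mul, integral_add (integrable_const _)
      (integrable_finsetSum _ fun t _ => integrable_finsetSum _ fun i _ =>
        integrable_queue run hM hΨ hα t i), integral_const, probReal_univ, one_smul,
      integral_finsetSum _ fun t _ => integrable_finsetSum _ fun i _ =>
        integrable_queue run hM hΨ hα t i]
    congr 2
    exact Finset.sum_congr rfl fun t _ =>
      integral_finsetSum _ fun i _ => integrable_queue run hM hΨ hα t i
  have hpath : ∀ x, ∑ t ∈ Finset.Ico b N, jointCost
      (M.stateLaw d₀ (fun t x => prescribedPolicy (θ x t)) x t) (prescribedPolicy (θ x t))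
      (c t x) ≤ Z x + (w + Ψ * r / (1 - Real.exp (-1 / τ))) * B x +
        Ψ * (2 * r * K) / (1 - Real.exp (-1 / τ)) := fun x => by
    set e : ℕ → ℝ := fun t => trackingError
      (M.stateLaw d₀ (fun t x => prescribedPolicy (θ x t)) x t) (θ x t) with he
    have h1 : ∑ t ∈ Finset.Ico b N, jointCost
        (M.stateLaw d₀ (fun t x => prescribedPolicy (θ x t)) x t) (prescribedPolicy (θ x t))
        (c t x) ≤ ∑ t ∈ Finset.Ico b N, (∑ k, pairing (c t x k) (θ x t k) + Ψ * e t) :=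
      Finset.sum_le_sum fun t _ => by
        have := (abs_le.1 (abs_jointCost_prescribedPolicy_sub_le (hmem x t) (hpos x t)
          (M.stateLaw d₀ (fun t x => prescribedPolicy (θ x t)) x t) (hc t x))).2
        simp only [he]
        linarith
    rw [Finset.sum_add_distrib, ← Finset.mul_sum] at h1
    have h2 : ∑ t ∈ Finset.Ico b N, e t ≤ ∑ t ∈ Finset.range N, e t :=
      Finset.sum_le_sum_of_subset_of_nonneg (fun t ht => by
        rw [Finset.mem_Ico] at ht; exact Finset.mem_range.2 ht.2) fun t _ _ =>
        Finset.sum_nonneg fun k _ => l1Norm_nonneg _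
    have h3 := sum_trackingError_le hmix hd₀ x hmem hpos N
    have h4 := sum_entryNorm_step_le run hM hΨ hV hα hθ₀ x N
    have h5 := hle x
    set D := ∑ t ∈ Finset.range N, ∑ k, entryNorm (θ x t k - θ x (t + 1) k)
    have h6 : (2 * r * K + r * D) / (1 - Real.exp (-1 / τ)) ≤
        (2 * r * K + r * B x) / (1 - Real.exp (-1 / τ)) :=
      div_le_div_of_nonneg_right
        (add_le_add le_rfl (mul_le_mul_of_nonneg_left h4 (Nat.cast_nonneg r))) hρ.le
    have h7 := mul_le_mul_of_nonneg_left ((h2.trans h3).trans h6) hΨ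
    have h8 := mul_le_mul_of_nonneg_left h4 hw
    have h9 : Ψ * ((2 * r * K + r * B x) / (1 - Real.exp (-1 / τ))) =
        Ψ * r / (1 - Real.exp (-1 / τ)) * B x + Ψ * (2 * r * K) / (1 - Real.exp (-1 / τ)) := by
      ring
    change w * D ≤ w * B x at h8
    linarith
  have hZB : Integrable (fun x => Z x + (w + Ψ * r / (1 - Real.exp (-1 / τ))) * B x) M.ν :=
    hZ.add (hBi.const_mul _)
  refine (integral_mono (integrable_finsetSum _ fun t _ => integrable_jointCost hd₀ hpol
    (measurable_prescribedPolicy run hα) t (hcm t) (hc t)) (hZB.add (integrable_const _))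
    hpath).trans (le_of_eq ?_)
  simp only [Pi.add_apply]
  rw [integral_add hZB (integrable_const _), integral_add hZ (hBi.const_mul _),
    integral_const_mul, hBint, integral_const, probReal_univ, one_smul]
  ring

end IsAlgorithmRun

theorem totalPenalty_le [∀ k, Nonempty (A k)] (hU : M.Unichain)
    (run : ∀ x, M.IsAlgorithmRun V α θ₀ x (θ x) (Q x)) (hM : M.BoundedBy Ψ) (hΨ : 0 ≤ Ψ)
    (hV : 0 ≤ V) (hα : 0 < α) (hθ₀ : ∀ k, θ₀ k ∈ stateActionPolyhedron (M.P k)) {r : ℕ} {τ : ℝ}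
    (hmix : M.IsMixing r τ) (hd₀ : d₀ ∈ stdSimplex ℝ (∀ k, S k))
    (tr : M.IsTrajectory Pr d₀ (fun t x => prescribedPolicy (θ x t)) ξ s a) (b T : ℕ) {σ : ℝ}
    (hσ : σ = (∑ k, (Fintype.card (A k) : ℝ) * Fintype.card (S k)) * Ψ / (2 * α) *
        ((b + T : ℕ) * V + ∑ t ∈ Finset.range (b + T), ∑ i, ∫ x, Q x (t + 1) i ∂M.ν)) :
    M.totalPenalty Pr ξ s a b T ≤
      ∑ t ∈ Finset.Ico b (b + T), ∫ x, M.penaltyAt x t (θ x t) ∂M.ν +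
        Ψ * ((2 * r * K + r * σ) / (1 - Real.exp (-1 / τ))) := by
  have hmem := fun x => (run x).mem hθ₀
  have hpos := IsAlgorithmRun.stateMass_pos hU run hθ₀
  have hpol : ∀ t x, IsPolicy (prescribedPolicy (θ x t)) := fun t x s =>
    prod_mem_stdSimplex fun k => isPolicy_recoveredPolicy (hmem x t k) (hpos x t k) (s k)
  have hpen := fun t => integrable_penaltyAt hM (φ := fun x => θ x t)
    (IsAlgorithmRun.measurable_iterates run hα t).1 (fun x => hmem x t) t
  rw [tr.totalPenalty_eq hM hd₀ hpol (IsAlgorithmRun.measurable_prescribedPolicy run hα) b T]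
  have h := IsAlgorithmRun.integral_sum_jointCost_le hU run hM hΨ hV hα hθ₀ hmix hd₀ b T
    (c := fun t x => M.f x t) (fun t k s a => IsAlgorithmRun.measurable_f k s a t)
    (fun _ _ k s a => hM.1 k s a _)
    (integrable_finsetSum (Finset.Ico b (b + T)) fun t _ => hpen t) (w := 0)
    (fun x => by rw [zero_mul, add_zero]; rfl) le_rfl hσ
  rwa [zero_mul, add_zero, integral_finsetSum _ fun t _ => hpen t] at h

/-- The queue adds g_{i,t} at θ_{t+1}, while slot t is charged at θ_t. The queue increments
telescope to the final queue, and the shift of the index costs Ψ times the movement. -/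
theorem totalConstraint_le [∀ k, Nonempty (A k)] (hU : M.Unichain)
    (run : ∀ x, M.IsAlgorithmRun V α θ₀ x (θ x) (Q x)) (hM : M.BoundedBy Ψ) (hΨ : 0 ≤ Ψ)
    (hV : 0 ≤ V) (hα : 0 < α) (hθ₀ : ∀ k, θ₀ k ∈ stateActionPolyhedron (M.P k)) {r : ℕ} {τ : ℝ}
    (hmix : M.IsMixing r τ) (hd₀ : d₀ ∈ stdSimplex ℝ (∀ k, S k))
    (tr : M.IsTrajectory Pr d₀ (fun t x => prescribedPolicy (θ x t)) ξ s a) (b T : ℕ) (i : Fin m)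
    {σ : ℝ} (hσ : σ = (∑ k, (Fintype.card (A k) : ℝ) * Fintype.card (S k)) * Ψ / (2 * α) *
        ((b + T : ℕ) * V + ∑ t ∈ Finset.range (b + T), ∑ i, ∫ x, Q x (t + 1) i ∂M.ν)) :
    M.totalConstraint Pr ξ s a b T i ≤ ∫ x, Q x (b + T + 1) i ∂M.ν + Ψ * σ +
        Ψ * ((2 * r * K + r * σ) / (1 - Real.exp (-1 / τ))) := by
  have hmem := fun x => (run x).mem hθ₀
  have hpos := IsAlgorithmRun.stateMass_pos hU run hθ₀
  have hpol : ∀ t x, IsPolicy (prescribedPolicy (θ x t)) := fun t x s =>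
    prod_mem_stdSimplex fun k => isPolicy_recoveredPolicy (hmem x t k) (hpos x t k) (s k)
  rw [tr.totalConstraint_eq hM hd₀ hpol (IsAlgorithmRun.measurable_prescribedPolicy run hα) b T]
  refine IsAlgorithmRun.integral_sum_jointCost_le hU run hM hΨ hV hα hθ₀ hmix hd₀ b T
    (c := fun t x => M.g x t i) (fun t k s a => IsAlgorithmRun.measurable_g i k s a t)
    (fun _ _ k s a => hM.2 i k s a _)
    (IsAlgorithmRun.integrable_queue run hM hΨ hα (b + T) i) (fun x => ?_) hΨ hσ
  have h1 : ∀ t, ∑ k, pairing (M.g x t i k) (θ x t k) ≤ (Q x (t + 2) i - Q x (t + 1) i) +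
      Ψ * ∑ k, entryNorm (θ x t k - θ x (t + 1) k) := fun t => by
    have h2 := (run x).add_constraintAt_le t i
    have h3 : ∑ k, pairing (M.g x t i k) (θ x t k) - M.constraintAt x t i (θ x (t + 1)) ≤
        Ψ * ∑ k, entryNorm (θ x t k - θ x (t + 1) k) := by
      unfold constraintAt
      rw [← Finset.sum_sub_distrib, Finset.mul_sum]
      refine Finset.sum_le_sum fun k _ => ?_
      rw [← pairing_sub]
      exact (le_abs_self _).trans (abs_pairing_le (fun s a => hM.2 i k s a _) _)
    linarith
  refine (Finset.sum_le_sum fun t _ => h1 t).trans ?_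
  rw [Finset.sum_add_distrib, ← Finset.mul_sum]
  refine add_le_add ?_ (mul_le_mul_of_nonneg_left ?_ hΨ)
  · rw [Finset.sum_Ico_eq_sum_range, Nat.add_sub_cancel_left]
    have h4 := Finset.sum_range_sub (fun j => Q x (b + j + 1) i) T
    have h5 := (run x).queue_nonneg (b + 0 + 1) i
    have h6 : ∑ j ∈ Finset.range T, (Q x (b + j + 2) i - Q x (b + j + 1) i) =
        Q x (b + T + 1) i - Q x (b + 0 + 1) i := h4
    linarith
  · exact Finset.sum_le_sum_of_subset_of_nonneg (fun t ht => by
      rw [Finset.mem_Ico] at ht; exact Finset.mem_range.2 ht.2) fun t _ _ =>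
        Finset.sum_nonneg fun k _ => entryNorm_nonneg _

/-- Regret of the iterates against fixed state-action vectors. -/
theorem sum_penaltyAt_sub_le (run : ∀ x, M.IsAlgorithmRun V α θ₀ x (θ x) (Q x))
    (hM : M.BoundedBy Ψ) (hΨ : 0 ≤ Ψ) (hV : 0 ≤ V) (hα : 0 < α)
    (hθ₀ : ∀ k, θ₀ k ∈ stateActionPolyhedron (M.P k)) {φ : ∀ k, S k → A k → ℝ}
    (hφ : ∀ k, φ k ∈ stateActionPolyhedron (M.P k)) {γ : ℝ}
    (hγ : ∀ i t, ∫ x, M.constraintAt x t i φ ∂M.ν ≤ γ) (b T : ℕ) :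
    V * ∑ t ∈ Finset.Ico b (b + T),
        (∫ x, M.penaltyAt x t (θ x t) ∂M.ν - ∫ x, M.penaltyAt x t φ ∂M.ν) ≤
      2 * α * K + (b + T : ℕ) * (m * (K * Ψ) ^ 2 / 2 + V ^ 2 * Ψ ^ 2 *
        (∑ k, (Fintype.card (A k) : ℝ) * Fintype.card (S k)) / (4 * α)) +
        γ * ∑ t ∈ Finset.range (b + T), ∑ i, ∫ x, Q x (t + 1) i ∂M.ν +
        V * (b * (2 * (K * Ψ))) := by
  have hν : IsProbabilityMeasure M.ν := M.isProb
  have hmem := fun x => (run x).mem hθ₀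
  have hi1 := fun t => integrable_penaltyAt hM (φ := fun x => θ x t)
    (IsAlgorithmRun.measurable_iterates run hα t).1 (fun x => hmem x t) t
  have hi2 := fun t => integrable_penaltyAt hM (φ := fun _ => φ) (fun _ _ _ => measurable_const)
    (fun _ => hφ) t
  have h := IsAlgorithmRun.sum_integral_le_of_step run hM hΨ hα hθ₀ hφ hγ
    (p := fun t x => V * (M.penaltyAt x t (θ x t) - M.penaltyAt x t φ))
    (fun t => ((hi1 t).sub (hi2 t)).const_mul V)
    (fun t x => (run x).penaltyAt_add_lyapunov_le hM hV hα hφ t) (b + T)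
  set D : ℕ → ℝ := fun t =>
    ∫ x, M.penaltyAt x t (θ x t) ∂M.ν - ∫ x, M.penaltyAt x t φ ∂M.ν with hD
  have hDi : ∀ t, ∫ x, V * (M.penaltyAt x t (θ x t) - M.penaltyAt x t φ) ∂M.ν = V * D t :=
    fun t => by rw [integral_const_mul, integral_sub (hi1 t) (hi2 t)]
  simp only [hDi, ← Finset.mul_sum] at h
  have habs : ∀ {p : EnvPath E → ℝ}, (∀ x, |p x| ≤ K * Ψ) → |∫ x, p x ∂M.ν| ≤ K * Ψ :=
    fun {p} hp => by
      have := norm_integral_le_of_norm_le_const (μ := M.ν) (f := p) (C := K * Ψ)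
        (Filter.Eventually.of_forall hp)
      simpa using this
  have hlow : ∀ t, -(2 * (K * Ψ)) ≤ D t := fun t => by
    have h1 := (abs_le.1 (habs fun x => hM.abs_penaltyAt_le (hmem x t) x t)).1
    have h2 := (abs_le.1 (habs fun x => hM.abs_penaltyAt_le hφ x t)).2
    simp only [hD]
    linarith
  -- The drift argument has to start at slot 0; each slot before b is discarded at a cost of at most
  -- 2KΨ.
  have hsplit : ∑ t ∈ Finset.range (b + T), D t =
      ∑ t ∈ Finset.range b, D t + ∑ t ∈ Finset.Ico b (b + T), D t :=
    (Finset.sum_range_add_sum_Ico D (Nat.le_add_right b T)).symm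
  have hfirst : -(b * (2 * (K * Ψ))) ≤ ∑ t ∈ Finset.range b, D t := by
    have := Finset.sum_le_sum fun t (_ : t ∈ Finset.range b) => hlow t
    simp only [Finset.sum_const, Finset.card_range, nsmul_eq_mul] at this
    linarith
  have h3 := mul_le_mul_of_nonneg_left hfirst hV
  rw [hsplit, mul_add] at h
  linarith

end Algorithm

end Model

/-! ### The constants -/

/-- Rate of the average expected queue lengths. -/
def queueRate (Ψ η : ℝ) : ℝ := (2 + 4 * Ψ + Ψ ^ 2) / η

/-- Rate of the total movement of the iterates. -/
def stepRate (Ψ η : ℝ) : ℝ := Ψ * (1 + queueRate Ψ η)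

/-- Rate of the total cost difference between the algorithm and its iterates. -/
def trackingRate (Ψ η : ℝ) (r : ℕ) (τ : ℝ) : ℝ :=
  Ψ * (r * (2 + stepRate Ψ η) / (1 - Real.exp (-1 / τ)))

/-- Total distance of a stationary policy to its stationary distribution. -/
def mixingTotal (r₁ : ℝ) : ℝ := 2 * Real.exp 1 / (1 - Real.exp (-1 / r₁))

/-- The constant of the regret bound. -/
def penaltyConstant (Ψ η : ℝ) (r : ℕ) (τ r₁ : ℝ) : ℝ :=
  2 + 2 * Ψ ^ 2 + Ψ * mixingTotal r₁ * queueRate Ψ η + 2 * Ψ + trackingRate Ψ η r τ +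
    Ψ * mixingTotal r₁

/-- The constant of the constraint violation bound. -/
def constraintConstant (Ψ η : ℝ) (r : ℕ) (τ : ℝ) : ℝ :=
  2 / η * (2 * Ψ + Ψ ^ 2 + 2 * η) + (Ψ + η) + 32 * (Ψ + η) ^ 3 / η ^ 2 + Ψ * stepRate Ψ η +
    trackingRate Ψ η r τ

theorem one_sub_exp_neg_inv_pos {τ : ℝ} (hτ : 0 < τ) : 0 < 1 - Real.exp (-1 / τ) := by
  rw [sub_pos, Real.exp_lt_one_iff]
  exact div_neg_of_neg_of_pos (by norm_num) hτ

theorem queueRate_nonneg {Ψ η : ℝ} (hΨ : 0 ≤ Ψ) (hη : 0 < η) : 0 ≤ queueRate Ψ η := by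
  unfold queueRate
  positivity

theorem stepRate_nonneg {Ψ η : ℝ} (hΨ : 0 ≤ Ψ) (hη : 0 < η) : 0 ≤ stepRate Ψ η :=
  mul_nonneg hΨ (add_nonneg zero_le_one (queueRate_nonneg hΨ hη))

theorem trackingRate_nonneg {Ψ η τ : ℝ} (hΨ : 0 ≤ Ψ) (hη : 0 < η) (hτ : 0 < τ) (r : ℕ) :
    0 ≤ trackingRate Ψ η r τ :=
  mul_nonneg hΨ (div_nonneg (mul_nonneg (Nat.cast_nonneg r)
    (add_nonneg zero_le_two (stepRate_nonneg hΨ hη))) (one_sub_exp_neg_inv_pos hτ).le)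

theorem mixingTotal_nonneg {r₁ : ℝ} (hr₁ : 0 < r₁) : 0 ≤ mixingTotal r₁ :=
  div_nonneg (by positivity) (one_sub_exp_neg_inv_pos hr₁).le

/-! ### Elementary estimates, with sT = √T and W = Σ_k |A||S|. -/

section Estimates

variable {Ψ η K m W T sT N q σ : ℝ}

/-- As N ≤ 2T, the right-hand side is at most 2TK + 4Ψ T^{3/2} K + Ψ² T m K². Each monomial is at
most m K² T^{3/2}, which explains the numerator of `queueRate`. -/
theorem queue_sum_estimate (hΨ : 0 ≤ Ψ) (hη : 0 < η) (hK : 1 ≤ K) (hm : 1 ≤ m) (hsT : 1 ≤ sT)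
    (hT : T = sT ^ 2) (hN : N ≤ 2 * T)
    (hq : η * q ≤ 2 * T * K + N * (2 * sT * (K * Ψ) + m * (K * Ψ) ^ 2 / 2)) :
    q ≤ queueRate Ψ η * (m * K ^ 2 * (T * sT)) := by
  have hT0 : 0 ≤ T := by rw [hT]; positivity
  have hK2 : K ≤ m * K ^ 2 := by nlinarith
  have e1 : T * K ≤ m * K ^ 2 * (T * sT) := by
    calc T * K = K * (T * 1) := by ring
      _ ≤ m * K ^ 2 * (T * sT) := by gcongr
  have e2 : T * sT * K ≤ m * K ^ 2 * (T * sT) := by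
    rw [mul_comm]
    gcongr
  have e3 : T * (m * K ^ 2) ≤ m * K ^ 2 * (T * sT) := by
    calc T * (m * K ^ 2) = m * K ^ 2 * (T * 1) := by ring
      _ ≤ m * K ^ 2 * (T * sT) := by gcongr
  have h1 : N * (2 * sT * (K * Ψ) + m * (K * Ψ) ^ 2 / 2) ≤
      2 * T * (2 * sT * (K * Ψ) + m * (K * Ψ) ^ 2 / 2) :=
    mul_le_mul_of_nonneg_right hN (by positivity)
  have h2 := mul_le_mul_of_nonneg_left e2 hΨ
  have h3 := mul_le_mul_of_nonneg_left e3 (sq_nonneg Ψ)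
  have h4 : η * q ≤ η * (queueRate Ψ η * (m * K ^ 2 * (T * sT))) := by
    have h5 : η * (queueRate Ψ η * (m * K ^ 2 * (T * sT))) =
        (2 + 4 * Ψ + Ψ ^ 2) * (m * K ^ 2 * (T * sT)) := by
      unfold queueRate
      field_simp
    rw [h5]
    linarith
  exact le_of_mul_le_mul_left h4 hη

theorem step_sum_estimate (hΨ : 0 ≤ Ψ) (hη : 0 < η) (hK : 1 ≤ K) (hm : 1 ≤ m) (hW : 0 ≤ W)
    (hsT : 1 ≤ sT) (hT : T = sT ^ 2) (hN : N ≤ 2 * T)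
    (hq : q ≤ queueRate Ψ η * (m * K ^ 2 * (T * sT)))
    (hσ : σ = W * Ψ / (2 * T) * (N * sT + q)) : σ ≤ stepRate Ψ η * (m * K ^ 2 * W * sT) := by
  have hT0 : 0 < T := by rw [hT]; positivity
  have hcq := queueRate_nonneg hΨ hη
  have h1 : N * sT + q ≤ 2 * T * sT + queueRate Ψ η * (m * K ^ 2 * (T * sT)) :=
    add_le_add (mul_le_mul_of_nonneg_right hN (by linarith)) hq
  have h2 : σ ≤ W * Ψ / (2 * T) * (2 * T * sT + queueRate Ψ η * (m * K ^ 2 * (T * sT))) := by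
    rw [hσ]
    exact mul_le_mul_of_nonneg_left h1 (by positivity)
  have h3 : W * Ψ / (2 * T) * (2 * T * sT + queueRate Ψ η * (m * K ^ 2 * (T * sT))) =
      Ψ * (1 + queueRate Ψ η * (m * K ^ 2) / 2) * (W * sT) := by
    field_simp
  have h4 : 1 + queueRate Ψ η * (m * K ^ 2) / 2 ≤ (1 + queueRate Ψ η) * (m * K ^ 2) := by
    have : 1 ≤ m * K ^ 2 := by nlinarith
    nlinarith [mul_nonneg hcq (by linarith : (0 : ℝ) ≤ m * K ^ 2)]
  rw [h3] at h2
  refine h2.trans ?_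
  calc Ψ * (1 + queueRate Ψ η * (m * K ^ 2) / 2) * (W * sT)
      ≤ Ψ * ((1 + queueRate Ψ η) * (m * K ^ 2)) * (W * sT) := by gcongr
    _ = stepRate Ψ η * (m * K ^ 2 * W * sT) := by unfold stepRate; ring

theorem tracking_estimate {X τ : ℝ} {r : ℕ} (hΨ : 0 ≤ Ψ) (hτ : 0 < τ) (hKX : K ≤ X)
    (hσX : σ ≤ stepRate Ψ η * X) :
    Ψ * ((2 * r * K + r * σ) / (1 - Real.exp (-1 / τ))) ≤ trackingRate Ψ η r τ * X := by
  have hρ := one_sub_exp_neg_inv_pos hτ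
  have hr : (0 : ℝ) ≤ r := Nat.cast_nonneg r
  have h1 := mul_le_mul_of_nonneg_left hKX hr
  have h2 := mul_le_mul_of_nonneg_left hσX hr
  have h3 : (2 * r * K + r * σ) / (1 - Real.exp (-1 / τ)) ≤
      (r * (2 + stepRate Ψ η) * X) / (1 - Real.exp (-1 / τ)) :=
    div_le_div_of_nonneg_right (by linarith) hρ.le
  refine (mul_le_mul_of_nonneg_left h3 hΨ).trans (le_of_eq ?_)
  unfold trackingRate
  ring

/-- Everything is divided by V = √T. The term from the competitor's slack, of order 1/T times
T^{3/2}, becomes a multiple of m K³ without any power of T. -/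
theorem regret_estimate {X c₁ Δ b : ℝ} (hΨ : 0 ≤ Ψ) (hc₁ : 0 ≤ c₁) (hK : 1 ≤ K)
    (hW : 0 ≤ W) (hm : 0 ≤ m) (hsT : 1 ≤ sT) (hT : T = sT ^ 2) (hN : N ≤ 2 * T) (hb : b ≤ 1)
    (hq : q ≤ queueRate Ψ η * (m * K ^ 2 * (T * sT))) (hcq : 0 ≤ queueRate Ψ η)
    (hX1 : K * sT ≤ X) (hX2 : m * K ^ 2 * sT ≤ X) (hX3 : W * sT ≤ X) (hX4 : m * K ^ 3 ≤ X)
    (hX5 : K ≤ X)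
    (h : sT * Δ ≤ 2 * T * K + N * (m * (K * Ψ) ^ 2 / 2 + sT ^ 2 * Ψ ^ 2 * W / (4 * T)) +
      K * Ψ * c₁ / T * q + sT * (b * (2 * (K * Ψ)))) :
    Δ ≤ (2 + 2 * Ψ ^ 2 + Ψ * c₁ * queueRate Ψ η + 2 * Ψ) * X := by
  have hsT0 : 0 < sT := by linarith
  have hT0 : 0 < T := by rw [hT]; positivity
  have h1 : N * (m * (K * Ψ) ^ 2 / 2 + sT ^ 2 * Ψ ^ 2 * W / (4 * T)) ≤
      sT * (Ψ ^ 2 * (m * K ^ 2 * sT) + Ψ ^ 2 * (W * sT) / 2) := by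
    calc _ ≤ 2 * T * (m * (K * Ψ) ^ 2 / 2 + sT ^ 2 * Ψ ^ 2 * W / (4 * T)) :=
          mul_le_mul_of_nonneg_right hN (by positivity)
      _ = _ := by rw [hT]; field_simp; ring
  have h2 : K * Ψ * c₁ / T * q ≤ sT * (Ψ * c₁ * queueRate Ψ η * (m * K ^ 3)) := by
    calc _ ≤ K * Ψ * c₁ / T * (queueRate Ψ η * (m * K ^ 2 * (T * sT))) :=
          mul_le_mul_of_nonneg_left hq (by positivity)
      _ = _ := by field_simp
  have h3 : b * (2 * (K * Ψ)) ≤ 2 * Ψ * K := by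
    have : 0 ≤ 2 * (K * Ψ) := by positivity
    nlinarith
  have h4 := mul_le_mul_of_nonneg_left h3 hsT0.le
  have h5 : 2 * T * K = sT * (2 * (K * sT)) := by rw [hT]; ring
  have h6 : sT * Δ ≤ sT * (2 * (K * sT) + (Ψ ^ 2 * (m * K ^ 2 * sT) + Ψ ^ 2 * (W * sT) / 2) +
      Ψ * c₁ * queueRate Ψ η * (m * K ^ 3) + 2 * Ψ * K) := by
    linarith
  have h7 := le_of_mul_le_mul_left h6 hsT0
  have g1 := mul_le_mul_of_nonneg_left hX2 (sq_nonneg Ψ)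
  have g2 := mul_le_mul_of_nonneg_left hX3 (sq_nonneg Ψ)
  have g3 := mul_le_mul_of_nonneg_left hX4
    (mul_nonneg (mul_nonneg hΨ hc₁) hcq)
  have g4 := mul_le_mul_of_nonneg_left hX5 (mul_nonneg zero_le_two hΨ)
  have g5 : 0 ≤ Ψ ^ 2 * X := mul_nonneg (sq_nonneg _) (by linarith)
  linarith

/-- D ≤ (Ψ + η)√m K, and its cube gives the monomial m^{3/2} K³; the other terms need only smaller
powers of m. -/
theorem queue_estimate {X Y sm D : ℝ} (hΨ : 0 ≤ Ψ) (hη : 0 < η) (hK : 1 ≤ K) (hsm : 1 ≤ sm)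
    (hY : Y = sm ^ 3) (hsT : 1 ≤ sT) (hT : T = sT ^ 2) (hD : D = K * Ψ * sm + η)
    (hX1 : K * sT ≤ X) (hX2 : m * K ^ 2 ≤ X) (hX3 : Y * K ^ 3 ≤ X) (hX4 : sm * K ≤ X) :
    2 / η * ((2 * sT * (K * Ψ) + m * (K * Ψ) ^ 2 / 2) + η * (2 * √(T * K))) + D +
        32 * D ^ 3 / η ^ 2 ≤
      (2 / η * (2 * Ψ + Ψ ^ 2 + 2 * η) + (Ψ + η) + 32 * (Ψ + η) ^ 3 / η ^ 2) * X := by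
  have hD1 : D ≤ (Ψ + η) * (sm * K) := by
    have : 1 ≤ sm * K := by nlinarith
    rw [hD]
    nlinarith
  have hD0 : 0 ≤ D := by rw [hD]; positivity
  have hD3 : D ^ 3 ≤ (Ψ + η) ^ 3 * X := by
    calc D ^ 3 ≤ ((Ψ + η) * (sm * K)) ^ 3 := pow_le_pow_left₀ hD0 hD1 3
      _ = (Ψ + η) ^ 3 * (Y * K ^ 3) := by rw [hY]; ring
      _ ≤ _ := mul_le_mul_of_nonneg_left hX3 (by positivity)
  have hsqrt : √(T * K) ≤ X := by
    refine le_trans ?_ hX1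
    refine Real.sqrt_le_iff.2 ⟨by positivity, ?_⟩
    rw [hT]
    have : 0 ≤ sT ^ 2 * K * (K - 1) := mul_nonneg (by positivity) (by linarith)
    nlinarith
  have e1 := mul_le_mul_of_nonneg_left hX1 hΨ
  have e2 := mul_le_mul_of_nonneg_left hX2 (sq_nonneg Ψ)
  have e3 := mul_le_mul_of_nonneg_left hsqrt hη.le
  have e4 := mul_le_mul_of_nonneg_left hX4 (by linarith : 0 ≤ Ψ + η)
  have hX0 : 0 ≤ X := (Real.sqrt_nonneg _).trans hsqrt
  have h1 : (2 * sT * (K * Ψ) + m * (K * Ψ) ^ 2 / 2) + η * (2 * √(T * K)) ≤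
      (2 * Ψ + Ψ ^ 2 + 2 * η) * X := by
    have : 0 ≤ Ψ ^ 2 * X := by positivity
    linarith
  have h2 := mul_le_mul_of_nonneg_left h1 (by positivity : 0 ≤ 2 / η)
  have h3 : 32 * D ^ 3 / η ^ 2 ≤ 32 * ((Ψ + η) ^ 3 * X) / η ^ 2 := by gcongr
  calc _ ≤ 2 / η * ((2 * Ψ + Ψ ^ 2 + 2 * η) * X) + (Ψ + η) * X +
        32 * ((Ψ + η) ^ 3 * X) / η ^ 2 := by linarith
    _ = _ := by ring

/-- Every MDP contributes at least 1 to W, so K ≤ W and a surplus power of K, as in K³, is absorbed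
by W. -/
theorem monomial_bounds {W Y : ℝ} (hK : 1 ≤ K) (hKW : K ≤ W) (hm : 1 ≤ m) (hmY : m ≤ Y)
    (hsT : 1 ≤ sT) :
    m * K ^ 2 * W * sT ≤ Y * K ^ 2 * W * sT ∧ K * sT ≤ Y * K ^ 2 * W * sT ∧
      m * K ^ 2 * sT ≤ Y * K ^ 2 * W * sT ∧ W * sT ≤ Y * K ^ 2 * W * sT ∧
      m * K ^ 3 ≤ Y * K ^ 2 * W * sT ∧ Y * K ^ 3 ≤ Y * K ^ 2 * W * sT := by
  have hW : 1 ≤ W := hK.trans hKW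
  have hY : 1 ≤ Y := hm.trans hmY
  refine ⟨by gcongr, ?_, ?_, ?_, ?_, ?_⟩
  · calc K * sT = 1 * (K * 1) * 1 * sT := by ring
      _ ≤ Y * (K * K) * W * sT := by gcongr
      _ = _ := by ring
  · calc m * K ^ 2 * sT = m * K ^ 2 * 1 * sT := by ring
      _ ≤ _ := by gcongr
  · calc W * sT = 1 * 1 ^ 2 * W * sT := by ring
      _ ≤ _ := by gcongr
  · calc m * K ^ 3 = m * K ^ 2 * K * 1 := by ring
      _ ≤ _ := by gcongr
  · calc Y * K ^ 3 = Y * K ^ 2 * K * 1 := by ring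
      _ ≤ _ := by gcongr

end Estimates

end

end OCMDP

/-! ### Assembly of the two bounds. -/

theorem mainTheorem1 :
    -- the constant depends only on `Ψ`, `η` and the mixing parameters `r`, `τ`, `r₁`
    ∃ C : ℝ → ℝ → ℕ → ℝ → ℝ → ℝ,
    ∀ (K m : ℕ) (_ : 1 ≤ m) (S A : Fin K → Type*)
      [∀ k, Fintype (S k)] [∀ k, Fintype (A k)] [∀ k, DecidableEq (S k)]
      (E : Type*) [MeasurableSpace E] (M : OCMDP.Model K m S A E) (Ψ η : ℝ),
      M.BoundedBy Ψ → M.Unichain → 0 < η → M.Slater η →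
      -- mixing parameters exist
      (∃ (r : ℕ) (τ r₁ : ℝ), M.IsMixing r τ ∧ M.IsJointMixing r₁) ∧
      ∀ (r : ℕ) (τ r₁ : ℝ), M.IsMixing r τ → M.IsJointMixing r₁ →
      -- the horizon, the first slot that is counted, the initial distribution
      ∀ (T : ℕ) (_ : 1 ≤ T) (b : ℕ) (_ : b ≤ 1) (d₀ : (∀ k, S k) → ℝ)
        (_ : d₀ ∈ stdSimplex ℝ (∀ k, S k))
        -- the algorithm with `V = √T` and `α = T`
        (θ₀ : ∀ k, S k → A k → ℝ) (_ : ∀ k, OCMDP.IsStateActionVector (M.P k) (θ₀ k))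
        (θ : OCMDP.EnvPath E → ℕ → ∀ k, S k → A k → ℝ) (Q : OCMDP.EnvPath E → ℕ → Fin m → ℝ)
        (_ : ∀ x, M.IsAlgorithmRun (Real.sqrt T) T θ₀ x (θ x) (Q x))
        -- the state-action process under the algorithm
        (Ω : Type*) [MeasurableSpace Ω] (Pr : MeasureTheory.Measure Ω)
        [MeasureTheory.IsProbabilityMeasure Pr] (ξ : Ω → OCMDP.EnvPath E)
        (s : ℕ → Ω → ∀ k, S k) (a : ℕ → Ω → ∀ k, A k)
        (_ : M.IsTrajectory Pr d₀ (fun t x => OCMDP.prescribedPolicy (θ x t)) ξ s a),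
        -- regret against every feasible joint randomized stationary policy
        (∀ (Pi : (∀ k, S k) → (∀ k, A k) → ℝ) (_ : OCMDP.IsPolicy Pi)
          (Ω' : Type*) [MeasurableSpace Ω'] (Pr' : MeasureTheory.Measure Ω')
          [MeasureTheory.IsProbabilityMeasure Pr'] (ξ' : Ω' → OCMDP.EnvPath E)
          (s' : ℕ → Ω' → ∀ k, S k) (a' : ℕ → Ω' → ∀ k, A k)
          (_ : M.IsTrajectory Pr' d₀ (fun _ _ => Pi) ξ' s' a')
          (_ : ∀ i, M.totalConstraint Pr' ξ' s' a' b T i ≤ 0),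
          M.totalPenalty Pr ξ s a b T - M.totalPenalty Pr' ξ' s' a' b T ≤
            C Ψ η r τ r₁ * ((m : ℝ) ^ (3 / 2 : ℝ) * (K : ℝ) ^ 2 *
              (∑ k, (Fintype.card (A k) : ℝ) * Fintype.card (S k)) * Real.sqrt T)) ∧
        -- constraint violation
        ∀ i, M.totalConstraint Pr ξ s a b T i ≤
          C Ψ η r τ r₁ * ((m : ℝ) ^ (3 / 2 : ℝ) * (K : ℝ) ^ 2 *
            (∑ k, (Fintype.card (A k) : ℝ) * Fintype.card (S k)) * Real.sqrt T) := by
  -- Both constants are nonnegative, so their sum serves both bounds.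
  refine ⟨fun Ψ η r τ r₁ => OCMDP.penaltyConstant Ψ η r τ r₁ + OCMDP.constraintConstant Ψ η r τ, ?_⟩
  intro K m hm S A _ _ _ E _ M Ψ η hM hU hη hS
  obtain ⟨hK, hSne, hAne⟩ := hS.nonempty hη hm
  have hΨ : 0 ≤ Ψ := hM.nonneg hK
  refine ⟨?_, ?_⟩
  · obtain ⟨r, τ, h₁⟩ := hU.exists_isMixing
    obtain ⟨r₁, h₂⟩ := hU.exists_isJointMixing
    exact ⟨r, τ, r₁, h₁, h₂⟩
  intro r τ r₁ hmix hjmix T hT b hb d₀ hd₀ θ₀ hθ₀' θ Q run Ω _ Pr _ ξ s a tr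
  have hθ₀ : ∀ k, θ₀ k ∈ OCMDP.stateActionPolyhedron (M.P k) := fun k =>
    (hθ₀' k).mem_stateActionPolyhedron
  have hτ : 0 < τ := by linarith [hmix.2.1]
  have hKr : (1 : ℝ) ≤ K := by exact_mod_cast hK
  have hmr : (1 : ℝ) ≤ m := by exact_mod_cast hm
  have hTr : (1 : ℝ) ≤ T := by exact_mod_cast hT
  have hsT : 1 ≤ √(T : ℝ) := Real.one_le_sqrt.2 hTr
  have hTsq : (T : ℝ) = √(T : ℝ) ^ 2 := (Real.sq_sqrt (by linarith)).symm
  have hsm : 1 ≤ √(m : ℝ) := Real.one_le_sqrt.2 hmr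
  have hmsq : (m : ℝ) = √(m : ℝ) ^ 2 := (Real.sq_sqrt (by linarith)).symm
  have hY : (m : ℝ) ^ (3 / 2 : ℝ) = √(m : ℝ) ^ 3 := by
    rw [Real.sqrt_eq_rpow, ← Real.rpow_natCast, ← Real.rpow_mul (by linarith)]
    norm_num
  set W : ℝ := ∑ k, (Fintype.card (A k) : ℝ) * Fintype.card (S k) with hWdef
  have hKW : (K : ℝ) ≤ W := by
    have h1 : ∀ k, (1 : ℝ) ≤ (Fintype.card (A k) : ℝ) * Fintype.card (S k) := fun k => by
      have hA : (1 : ℝ) ≤ Fintype.card (A k) := by exact_mod_cast Fintype.card_pos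
      have hS : (1 : ℝ) ≤ Fintype.card (S k) := by exact_mod_cast Fintype.card_pos
      nlinarith
    have h2 := Finset.sum_le_sum fun k (_ : k ∈ Finset.univ) => h1 k
    simpa using h2
  -- The drift sums run over the b + T slots from 0 on, and b ≤ 1 ≤ T; this covers both conventions
  -- for the first slot.
  have hN : ((b + T : ℕ) : ℝ) ≤ 2 * T := by
    have : (b : ℝ) ≤ 1 := by exact_mod_cast hb
    push_cast
    linarith
  set Y : ℝ := (m : ℝ) ^ (3 / 2 : ℝ) with hYdef
  set sT : ℝ := √(T : ℝ) with hsTdef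
  have hmY : (m : ℝ) ≤ Y := by
    rw [hY]
    nlinarith [sq_nonneg √(m : ℝ)]
  have hsmY : √(m : ℝ) ≤ Y := by nlinarith
  have hY1 : 1 ≤ Y := hmr.trans hmY
  have hW1 : 1 ≤ W := hKr.trans hKW
  set X : ℝ := Y * (K : ℝ) ^ 2 * W * sT with hX
  obtain ⟨hP, hKsT, hmK2sT, hWsT, hmK3, hYK3⟩ :=
    OCMDP.monomial_bounds hKr hKW hmr hmY hsT
  rw [← hX] at hP hKsT hmK2sT hWsT hmK3 hYK3
  have hKX : (K : ℝ) ≤ X := (le_mul_of_one_le_right (by linarith) hsT).trans hKsT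
  have hmK2 : (m : ℝ) * K ^ 2 ≤ X :=
    (le_mul_of_one_le_right (by positivity) hsT).trans hmK2sT
  have hsmK : √(m : ℝ) * K ≤ X := by
    calc √(m : ℝ) * K ≤ Y * K ^ 3 := by
          gcongr
          nlinarith [mul_nonneg (by linarith : (0 : ℝ) ≤ (K : ℝ) - 1) (by linarith : (0 : ℝ) ≤ K)]
      _ ≤ X := hYK3
  have hX0 : 0 ≤ X := by linarith
  have hsT0 : 0 ≤ sT := by linarith
  have hα : (0 : ℝ) < T := by linarith
  -- the total queue length and the total movement of the iterates
  set q : ℝ := ∑ t ∈ Finset.range (b + T), ∑ i, ∫ x, Q x (t + 1) i ∂M.ν with hqdef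
  have hq : q ≤ OCMDP.queueRate Ψ η * (m * K ^ 2 * (T * sT)) :=
    OCMDP.queue_sum_estimate hΨ hη hKr hmr hsT hTsq hN
      (OCMDP.Model.IsAlgorithmRun.sum_integral_queue_le run hM hΨ hsT0 hα hθ₀ hS (b + T))
  obtain ⟨σ, hσ⟩ : ∃ σ : ℝ, σ = W * Ψ / (2 * T) * ((b + T : ℕ) * sT + q) := ⟨_, rfl⟩
  have hσX : σ ≤ OCMDP.stepRate Ψ η * X :=
    (OCMDP.step_sum_estimate hΨ hη hKr hmr (by linarith) hsT hTsq hN hq hσ).trans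
      (mul_le_mul_of_nonneg_left hP (OCMDP.stepRate_nonneg hΨ hη))
  have htrack := OCMDP.tracking_estimate (r := r) hΨ hτ hKX hσX
  have hr₁ : 0 < r₁ := hjmix.1
  have hc₁ := OCMDP.mixingTotal_nonneg hr₁
  have hcq := OCMDP.queueRate_nonneg hΨ hη
  have hcs := OCMDP.stepRate_nonneg hΨ hη
  have hct := OCMDP.trackingRate_nonneg hΨ hη hτ r
  have hpc : 0 ≤ OCMDP.penaltyConstant Ψ η r τ r₁ := by
    unfold OCMDP.penaltyConstant
    positivity
  have hcc : 0 ≤ OCMDP.constraintConstant Ψ η r τ := by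
    unfold OCMDP.constraintConstant
    positivity
  refine ⟨?_, fun i => ?_⟩
  · intro Pi hPi Ω' _ Pr' _ ξ' s' a' tr' hfeas
    obtain ⟨φ, hφ, hγ, hpen⟩ := tr'.exists_comparator hM hΨ hjmix rfl hPi hd₀ hT hfeas
    have h1 := OCMDP.Model.totalPenalty_le hU run hM hΨ hsT0 hα hθ₀ hmix hd₀ tr b T hσ
    have h2 := OCMDP.Model.sum_penaltyAt_sub_le run hM hΨ hsT0 hα hθ₀ hφ hγ b T
    have h3 := OCMDP.regret_estimate hΨ hc₁ hKr (by linarith) (by linarith) hsT hTsq hN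
      (by exact_mod_cast hb) hq hcq hKsT hmK2sT hWsT hmK3 hKX h2
    rw [Finset.sum_sub_distrib] at h3
    have h4 : K * Ψ * OCMDP.mixingTotal r₁ ≤ Ψ * OCMDP.mixingTotal r₁ * X := by
      have := mul_le_mul_of_nonneg_left hKX (mul_nonneg hΨ hc₁)
      linarith
    have h5 : OCMDP.penaltyConstant Ψ η r τ r₁ * X =
        (2 + 2 * Ψ ^ 2 + Ψ * OCMDP.mixingTotal r₁ * OCMDP.queueRate Ψ η + 2 * Ψ) * X +
          OCMDP.trackingRate Ψ η r τ * X + Ψ * OCMDP.mixingTotal r₁ * X := by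
      unfold OCMDP.penaltyConstant
      ring
    have h6 := mul_nonneg hcc hX0
    change _ ≤ _ + K * Ψ * OCMDP.mixingTotal r₁ at hpen
    linarith
  · have h1 := OCMDP.Model.totalConstraint_le hU run hM hΨ hsT0 hα hθ₀ hmix hd₀ tr b T i hσ
    have h2 := OCMDP.Model.IsAlgorithmRun.integral_queue_le run hM hΨ hsT0 hα hK hθ₀ hη hS rfl
      (b + T) i
    have h3 := OCMDP.queue_estimate (m := m) hΨ hη hKr hsm hY hsT hTsq rfl hKsT hmK2 hYK3 hsmK
    have h4 := mul_le_mul_of_nonneg_left hσX hΨ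
    have h5 : OCMDP.constraintConstant Ψ η r τ * X =
        (2 / η * (2 * Ψ + Ψ ^ 2 + 2 * η) + (Ψ + η) + 32 * (Ψ + η) ^ 3 / η ^ 2) * X +
          Ψ * (OCMDP.stepRate Ψ η * X) + OCMDP.trackingRate Ψ η r τ * X := by
      unfold OCMDP.constraintConstant
      ring
    have h6 := mul_nonneg hpc hX0
    linarith
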